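/- Let $\mathbb D=\{z\in\mathbb C:|z|<1\}$ and $1<\alpha\le 2$. Let $Co(\alpha)$ be the class of functions $f:\mathbb D\to\mathbb C$ such that (i) $f$ is analytic in $\mathbb D$, $f(0)=0$, $f'(0)=1$, and $f(z)\to\infty$ as $z\to1$ in $\mathbb D$; (ii) $f$ is injective on $\mathbb D$ and $\mathbb C\setminus f(\mathbb D)$ is convex; (iii) the opening angle of $f(\mathbb D)$ at $\infty$, that is, the measure of the set of $\theta\in(-\pi,\pi]$ such that $te^{i\theta}\in f(\mathbb D)$ for all large $t$, is at most $\pi\alpha$. Let $\Pi_{\alpha-1}$ be the Kaplan class $K(\alpha-1,0)$, that is, the class of nonvanishing analytic functions $s$ in $\mathbb D$ with $s(0)=1$ such that, for all $0<r<1$ and $\theta_1<\theta_2<\theta_1+2\pi$, $$-(\alpha-1)\pi\le\int_{\theta_1}^{\theta_2}\Big\{\operatorname{Re}\frac{re^{i\theta}s'(re^{i\theta})}{s(re^{i\theta})}-\frac{\alpha-1}{2}\Big\}\,d\theta\le 0 .$$ For $g(z)=\sum_{n\ge0}a_nz^n$ and $h(z)=\sum_{n\ge0}b_nz^n$ analytic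 in $\mathbb D$ put $(g\star h)(z)=\sum_{n\ge0}a_nb_nz^n$. **Theorem.** Let $f$ be analytic in $\mathbb D$ with $f(0)=0$, $f'(0)=1$, and let $s(z)=(1-z)^{\alpha+1}f'(z)$ (principal branch). Then $f\in Co(\alpha)$ if and only if $$s(z)\star\Big(\frac{z}{(1-z)^2}+\frac{1-\alpha}{x+1}\,\frac{1}{1-z}\Big)\neq0\qquad\text{for all }z\in\mathbb D\text{ and all }x\in\mathbb C\text{ with }|x|=1,\ x\neq-1. \tag{$*$}$$ Moreover, $f\in Co(\alpha)$ if and only if $s\in\Pi_{\alpha-1}$ and $(*)$ holds. -/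

import Mathlib

open Filter Topology MeasureTheory

noncomputable section

namespace Concave

/-- The open unit disk of the complex plane. -/
def unitDisk : Set ℂ := Metric.ball 0 1

/-- Analytic functions on the unit disk with `f 0 = 0` and `f' 0 = 1`
(only the values on the disk matter). -/
def classA : Set (ℂ → ℂ) :=
  {f | DifferentiableOn ℂ f unitDisk ∧ f 0 = 0 ∧ deriv f 0 = 1}

/-- The opening angle at infinity of a plane domain: the total angular size of the set of
directions `θ` for which the points `t * exp (iθ)` belong to the domain for all large `t`. If the
complement is an unbounded closed convex set, then this is `2π` minus the angle of the recession
cone of the complement. -/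
def openingAngleAtInfinity (Ω : Set ℂ) : ℝ :=
  volume.real {θ : ℝ | θ ∈ Set.Ioc (-Real.pi) Real.pi ∧
    ∀ᶠ t : ℝ in atTop, (t : ℂ) * Complex.exp (θ * Complex.I) ∈ Ω}

/-- The concave univalent functions with opening angle at most `π * α` at infinity. -/
def Co (α : ℝ) : Set (ℂ → ℂ) :=
  {f | f ∈ classA ∧
    Tendsto f (𝓝[unitDisk] 1) (Bornology.cobounded ℂ) ∧
    Set.InjOn f unitDisk ∧
    Convex ℝ (f '' unitDisk)ᶜ ∧
    openingAngleAtInfinity (f '' unitDisk) ≤ Real.pi * α}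

/-- The Kaplan class `K(a, b)`. -/
def kaplanClass (a b : ℝ) : Set (ℂ → ℂ) :=
  {s | DifferentiableOn ℂ s unitDisk ∧ (∀ z ∈ unitDisk, s z ≠ 0) ∧ s 0 = 1 ∧
    ∀ r θ₁ θ₂ : ℝ, 0 < r → r < 1 → θ₁ < θ₂ → θ₂ < θ₁ + 2 * Real.pi →
      -(a * Real.pi) ≤
        (∫ θ in θ₁..θ₂,
          (((r * Complex.exp (θ * Complex.I)) * deriv s (r * Complex.exp (θ * Complex.I))
            / s (r * Complex.exp (θ * Complex.I))).re - (a - b) / 2)) ∧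
      (∫ θ in θ₁..θ₂,
          (((r * Complex.exp (θ * Complex.I)) * deriv s (r * Complex.exp (θ * Complex.I))
            / s (r * Complex.exp (θ * Complex.I))).re - (a - b) / 2)) ≤ b * Real.pi}

/-- The class `Π_l`, for real `l`. -/
def PiClass (l : ℝ) : Set (ℂ → ℂ) :=
  if 0 ≤ l then kaplanClass l 0 else kaplanClass 0 (-l)

/-- The `n`-th Taylor coefficient at the origin. -/
def taylorCoeff (f : ℂ → ℂ) (n : ℕ) : ℂ := iteratedDeriv n f 0 / (n.factorial : ℂ)

/-- The Hadamard product (convolution) of two functions analytic in the unit disk;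
the series converges absolutely there. -/
def hadamard (f g : ℂ → ℂ) (z : ℂ) : ℂ :=
  ∑' n : ℕ, taylorCoeff f n * taylorCoeff g n * z ^ n

/-- The kernel `z / (1 - z)² + ((1 - α) / (x + 1)) * 1 / (1 - z)`. -/
def kernel (α : ℝ) (x : ℂ) (z : ℂ) : ℂ :=
  z / (1 - z) ^ 2 + ((1 - (α : ℂ)) / (x + 1)) * (1 / (1 - z))

/-- The function `(1 - z) ^ (α + 1) * f' z` attached to `f` (principal branch of the power). -/
def attached (α : ℝ) (f : ℂ → ℂ) (z : ℂ) : ℂ :=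
  (1 - z) ^ ((α : ℂ) + 1) * deriv f z

end Concave

end

noncomputable section

namespace Concave

open ComplexConjugate

/-! Everything passes through one analytic criterion, `mem_Co_iff`: `f` belongs to `Co α` exactly
when `s = attached α f` has no zero and Re(z s'/s) < (α-1)/2 on the disk.

The convolution condition is this criterion in disguise. The n-th Taylor coefficient of the kernel
is n + (1-α)/(x+1), so the Hadamard product equals z s' + (1-α)/(x+1) s. As x runs over the unit
circle without -1, 1/(x+1) runs over the line Re = 1/2; hence (*) says that z s'/s avoids the line
Re = (α-1)/2. Since z s'/s vanishes at 0, connectedness puts it to the left of that line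
(`forall_add_ne_zero_iff`); an open mapping argument excludes zeros of s. The same inequality, with
the mean value property, gives the Kaplan condition (`mem_kaplanClass_zero`).

For the criterion, the Cayley transform replaces f by F on the right half-plane, with 1 going to ∞.
With q = F''/F', the inequality becomes Re(ζ - (ζ²-1) q/(α-1)) > 0.

From geometry to the inequality: convexity of the complement makes F + t(F - v) preserve the image
for every omitted v. The resulting semigroup on the disk has a boundary point which f(z) → ∞ at 1
forces to be 1, so Re((F - v)/F') ≥ 0 (`re_sub_div_deriv_nonneg`). Taking v nearest to F(ζ) and
using Schwarz–Pick twice gives Re q ≥ 0 (`re_deriv_deriv_div_nonneg`). The opening angle bounds the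
oscillation of arg F' by (α-1)π (`im_log_deriv_sub_le`), hence |q| Re ζ ≤ α-1. A Julia-type limit at
∞ combines these into |q|² Re ζ ≤ (α-1) Re q, which implies the inequality (`re_sub_mul_pos`).

From the inequality to geometry: Schwarz–Pick against the point 1 gives Re q ≥ 0, and comparison
with log(1-z) bounds the oscillation of arg F' by (α-1)π ≤ π. So F' lies in a half-plane and F is
univalent. Lifting rays through F gives convexity of the complement (`ray_subset_image`,
`convex_compl_image`) and the opening angle (`openingAngle_le`); a distance estimate shows that
bounded sets have bounded preimages, which is the limit ∞ at 1 (`exists_norm_le_of_norm_image_le`).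
-/

/-- The open right half-plane. -/
def rightHalfPlane : Set ℂ := {ζ | 0 < ζ.re}

theorem isOpen_rightHalfPlane : IsOpen rightHalfPlane :=
  isOpen_lt continuous_const Complex.continuous_re

theorem convex_rightHalfPlane : Convex ℝ rightHalfPlane :=
  convex_halfSpace_re_gt 0

theorem one_mem_rightHalfPlane : (1 : ℂ) ∈ rightHalfPlane := by simp [rightHalfPlane]

theorem isOpen_unitDisk : IsOpen unitDisk := Metric.isOpen_ball

theorem mem_unitDisk {z : ℂ} : z ∈ unitDisk ↔ ‖z‖ < 1 := by simp [unitDisk]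

theorem zero_mem_unitDisk : (0 : ℂ) ∈ unitDisk := by simp [unitDisk]

/-! ### Schwarz–Pick inequalities -/

theorem normSq_add_conj_sub (u v : ℂ) :
    ‖u + conj v‖ ^ 2 - ‖u - v‖ ^ 2 = 4 * (u.re * v.re) := by
  simp only [Complex.sq_norm, Complex.normSq_apply, Complex.add_re, Complex.add_im,
    Complex.sub_re, Complex.sub_im, Complex.conj_re, Complex.conj_im]
  ring

theorem norm_sub_le_norm_add_conj {u v : ℂ} (h : 0 ≤ u.re * v.re) : ‖u - v‖ ≤ ‖u + conj v‖ := by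
  have := normSq_add_conj_sub u v
  exact (sq_le_sq₀ (norm_nonneg _) (norm_nonneg _)).1 (by linarith)

theorem add_conj_ne_zero {u v : ℂ} (hu : 0 ≤ u.re) (hv : 0 < v.re) : u + conj v ≠ 0 := by
  intro h
  have := congrArg Complex.re h
  simp at this
  linarith

/-- Conjugating by Cayley maps that send a and g(a) to 0 reduces this to the Schwarz lemma on the
disk. -/
theorem schwarz_pick_of_pos {g : ℂ → ℂ} (hg : DifferentiableOn ℂ g rightHalfPlane)
    (hre : ∀ ζ ∈ rightHalfPlane, 0 < (g ζ).re) {ζ a : ℂ} (hζ : ζ ∈ rightHalfPlane)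
    (ha : a ∈ rightHalfPlane) :
    ‖g ζ - g a‖ * ‖ζ + conj a‖ ≤ ‖g ζ + conj (g a)‖ * ‖ζ - a‖ := by
  have ha' : 0 < a.re := ha
  have hζ' : 0 < ζ.re := hζ
  set C : ℂ → ℂ := fun w => (a + conj a * w) / (1 - w) with hC
  have hne : ∀ w ∈ Metric.ball (0 : ℂ) 1, 1 - w ≠ 0 := by
    intro w hw h
    have : w = 1 := by linear_combination -h
    simp [this] at hw
  have hCmap : ∀ w ∈ Metric.ball (0 : ℂ) 1, C w ∈ rightHalfPlane := by
    intro w hw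
    have h1 : 0 < Complex.normSq (1 - w) := Complex.normSq_pos.2 (hne w hw)
    have hw1 : w.re * w.re + w.im * w.im < 1 := by
      have : ‖w‖ < 1 := by simpa using hw
      have h2 : ‖w‖ ^ 2 < 1 := by nlinarith [norm_nonneg w]
      rwa [Complex.sq_norm, Complex.normSq_apply] at h2
    show 0 < (C w).re
    rw [hC]
    simp only [Complex.div_re]
    rw [← add_div]
    apply div_pos _ h1
    simp
    nlinarith
  have hCd : DifferentiableOn ℂ C (Metric.ball 0 1) := by
    intro w hw
    apply DifferentiableAt.differentiableWithinAt
    have := hne w hw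
    fun_prop (disch := assumption)
  set ψ : ℂ → ℂ := fun w => (g (C w) - g a) / (g (C w) + conj (g a)) with hψ
  have hgC : DifferentiableOn ℂ (fun w => g (C w)) (Metric.ball 0 1) :=
    hg.comp hCd hCmap
  have hψd : DifferentiableOn ℂ ψ (Metric.ball 0 1) := by
    apply (hgC.sub_const _).div (hgC.add_const _)
    intro w hw
    exact add_conj_ne_zero (hre _ (hCmap w hw)).le (hre a ha)
  have hψm : Set.MapsTo ψ (Metric.ball 0 1) (Metric.closedBall 0 1) := by
    intro w hw
    simp only [hψ, mem_closedBall_zero_iff, norm_div]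
    apply div_le_one_of_le₀ _ (norm_nonneg _)
    exact norm_sub_le_norm_add_conj (mul_nonneg (hre _ (hCmap w hw)).le (hre a ha).le)
  have hψ0 : ψ 0 = 0 := by simp [hψ, hC]
  have hden : ζ + conj a ≠ 0 := add_conj_ne_zero hζ'.le ha'
  set w := (ζ - a) / (ζ + conj a) with hw
  have h4 := normSq_add_conj_sub ζ a
  have hwn : ‖w‖ < 1 := by
    rw [hw, norm_div, div_lt_one (norm_pos_iff.2 hden)]
    apply lt_of_pow_lt_pow_left₀ 2 (norm_nonneg _)
    nlinarith [mul_pos hζ' ha']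
  have hCw : C w = ζ := by
    have h1 := hne w (by simpa using hwn)
    rw [hC]
    simp only
    rw [div_eq_iff h1, hw]
    field_simp
    ring
  have key := Complex.norm_le_norm_of_mapsTo_ball hψd hψm hψ0 hwn
  simp only [hψ, hCw] at key
  rw [hw, norm_div, norm_div, div_le_div_iff₀ (norm_pos_iff.2 (add_conj_ne_zero (hre _ hζ).le (hre a ha)))
    (norm_pos_iff.2 hden)] at key
  linarith

/-- The Schwarz–Pick inequality for holomorphic self-maps of the closed right half-plane. -/
theorem schwarz_pick_half {g : ℂ → ℂ} (hg : DifferentiableOn ℂ g rightHalfPlane)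
    (hre : ∀ ζ ∈ rightHalfPlane, 0 ≤ (g ζ).re) {ζ a : ℂ} (hζ : ζ ∈ rightHalfPlane)
    (ha : a ∈ rightHalfPlane) :
    ‖g ζ - g a‖ * ‖ζ + conj a‖ ≤ ‖g ζ + conj (g a)‖ * ‖ζ - a‖ := by
  -- Boundary values of the half-plane are allowed for g, so the strict case is applied to g + ε and
  -- ε tends to 0.
  have h1 : ∀ᶠ ε : ℝ in 𝓝[>] 0, ‖g ζ - g a‖ * ‖ζ + conj a‖ ≤
      ‖(g ζ + ε) + conj (g a + ε)‖ * ‖ζ - a‖ := by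
    filter_upwards [self_mem_nhdsWithin] with ε hε
    have hε : 0 < ε := hε
    have := schwarz_pick_of_pos (g := fun z => g z + ε) (hg.add_const _)
      (fun z hz => by have := hre z hz; simp; linarith) hζ ha
    simpa using this
  have h2 : Tendsto (fun ε : ℝ => ‖(g ζ + ε) + conj (g a + ε)‖ * ‖ζ - a‖) (𝓝[>] 0)
      (𝓝 (‖(g ζ + (0 : ℝ)) + conj (g a + (0 : ℝ))‖ * ‖ζ - a‖)) := by
    apply tendsto_nhdsWithin_of_tendsto_nhds
    apply Continuous.tendsto (f := fun ε : ℝ => ‖(g ζ + ε) + conj (g a + ε)‖ * ‖ζ - a‖)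
    have : Continuous fun ε : ℝ => conj (g a + (ε : ℂ)) :=
      Complex.continuous_conj.comp (by fun_prop)
    fun_prop
  simpa using ge_of_tendsto h2 h1

/-- Squaring and eliminating the differences turns Schwarz–Pick into a statement about real parts;
it serves below as a Harnack inequality. -/
theorem schwarz_pick_half_sq {g : ℂ → ℂ} (hg : DifferentiableOn ℂ g rightHalfPlane)
    (hre : ∀ ζ ∈ rightHalfPlane, 0 ≤ (g ζ).re) {ζ a : ℂ} (hζ : ζ ∈ rightHalfPlane)
    (ha : a ∈ rightHalfPlane) :
    ‖g ζ + conj (g a)‖ ^ 2 * (ζ.re * a.re) ≤ (g ζ).re * (g a).re * ‖ζ + conj a‖ ^ 2 := by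
  have h := schwarz_pick_half hg hre hζ ha
  have h2 : (‖g ζ - g a‖ * ‖ζ + conj a‖) ^ 2 ≤ (‖g ζ + conj (g a)‖ * ‖ζ - a‖) ^ 2 :=
    pow_le_pow_left₀ (by positivity) h 2
  rw [mul_pow, mul_pow] at h2
  have e1 := normSq_add_conj_sub ζ a
  have e2 := normSq_add_conj_sub (g ζ) (g a)
  have e3 : ‖ζ - a‖ ^ 2 = ‖ζ + conj a‖ ^ 2 - 4 * (ζ.re * a.re) := by linarith
  have e4 : ‖g ζ - g a‖ ^ 2 = ‖g ζ + conj (g a)‖ ^ 2 - 4 * ((g ζ).re * (g a).re) := by linarith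
  rw [e3, e4] at h2
  nlinarith

/-- The limit ζ → a of the two-point inequality divided by |ζ - a|. -/
theorem schwarz_pick_half_deriv {g : ℂ → ℂ} (hg : DifferentiableOn ℂ g rightHalfPlane)
    (hre : ∀ ζ ∈ rightHalfPlane, 0 ≤ (g ζ).re) {a : ℂ} (ha : a ∈ rightHalfPlane) :
    ‖deriv g a‖ * a.re ≤ (g a).re := by
  have ha' : 0 < a.re := ha
  have hda : DifferentiableAt ℂ g a := hg.differentiableAt (isOpen_rightHalfPlane.mem_nhds ha)
  have h1 := (hasDerivAt_iff_tendsto_slope.1 hda.hasDerivAt).norm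
  have hc : ∀ u : ℂ, ‖u + conj u‖ = |2 * u.re| := by
    intro u
    rw [Complex.add_conj, Complex.norm_real, Real.norm_eq_abs]
  have h2 : Tendsto (fun ζ => ‖g ζ + conj (g a)‖ / ‖ζ + conj a‖) (𝓝[≠] a)
      (𝓝 (‖g a + conj (g a)‖ / ‖a + conj a‖)) := by
    apply tendsto_nhdsWithin_of_tendsto_nhds
    apply ContinuousAt.tendsto (f := fun ζ => ‖g ζ + conj (g a)‖ / ‖ζ + conj a‖)
    have hd := hda.continuousAt
    apply ContinuousAt.div (by fun_prop) (by fun_prop)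
    rw [norm_ne_zero_iff]
    exact add_conj_ne_zero ha'.le ha'
  have h3 : ‖deriv g a‖ ≤ ‖g a + conj (g a)‖ / ‖a + conj a‖ := by
    apply le_of_tendsto_of_tendsto h1 h2
    have : ∀ᶠ ζ in 𝓝[≠] a, ζ ∈ rightHalfPlane :=
      nhdsWithin_le_nhds (isOpen_rightHalfPlane.mem_nhds ha)
    filter_upwards [this, self_mem_nhdsWithin] with ζ hζ hne
    have hne : ζ ≠ a := hne
    have h4 := schwarz_pick_half hg hre hζ ha
    have hden : ζ + conj a ≠ 0 := add_conj_ne_zero (le_of_lt hζ) ha'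
    rw [slope_def_field, norm_div, div_le_div_iff₀ (norm_pos_iff.2 (sub_ne_zero.2 hne))
      (norm_pos_iff.2 hden)]
    exact h4
  rw [hc, hc, abs_of_nonneg (by linarith [hre a ha]), abs_of_pos (by linarith),
    le_div_iff₀ (by linarith)] at h3
  linarith

/-- The Schwarz–Pick inequality for self-maps of the unit disk. -/
theorem schwarz_pick_disk {φ : ℂ → ℂ} (hφ : DifferentiableOn ℂ φ unitDisk)
    (hm : Set.MapsTo φ unitDisk unitDisk) {z a : ℂ} (hz : z ∈ unitDisk) (ha : a ∈ unitDisk) :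
    ‖φ z - φ a‖ ^ 2 * ((1 - ‖z‖ ^ 2) * (1 - ‖a‖ ^ 2)) ≤
      ‖z - a‖ ^ 2 * ((1 - ‖φ z‖ ^ 2) * (1 - ‖φ a‖ ^ 2)) := by
  have hid : ∀ u b : ℂ, ‖1 - conj b * u‖ ^ 2 - ‖u - b‖ ^ 2 = (1 - ‖u‖ ^ 2) * (1 - ‖b‖ ^ 2) := by
    intro u b
    simp only [Complex.sq_norm, Complex.normSq_apply, Complex.sub_re, Complex.sub_im,
      Complex.mul_re, Complex.mul_im, Complex.conj_re, Complex.conj_im, Complex.one_re,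
      Complex.one_im]
    ring
  have hsq : ∀ u ∈ unitDisk, 0 < 1 - ‖u‖ ^ 2 := by
    intro u hu
    have := mem_unitDisk.1 hu
    nlinarith [norm_nonneg u]
  have hne : ∀ u ∈ unitDisk, ∀ b ∈ unitDisk, 1 - conj b * u ≠ 0 := by
    intro u hu b hb h
    have h1 := hid u b
    rw [h] at h1
    have := mul_pos (hsq u hu) (hsq b hb)
    simp at h1
    nlinarith [sq_nonneg ‖u - b‖]
  have hle : ∀ u ∈ unitDisk, ∀ b ∈ unitDisk, ‖(u - b) / (1 - conj b * u)‖ < 1 := by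
    intro u hu b hb
    rw [norm_div, div_lt_one (norm_pos_iff.2 (hne u hu b hb))]
    apply lt_of_pow_lt_pow_left₀ 2 (norm_nonneg _)
    nlinarith [hid u b, mul_pos (hsq u hu) (hsq b hb)]
  have hna : -a ∈ unitDisk := by rw [mem_unitDisk, norm_neg]; exact mem_unitDisk.1 ha
  set C : ℂ → ℂ := fun w => (w - (-a)) / (1 - conj (-a) * w) with hC
  have hCmap : Set.MapsTo C unitDisk unitDisk := fun w hw => mem_unitDisk.2 (hle w hw _ hna)
  have hCd : DifferentiableOn ℂ C unitDisk := by
    intro w hw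
    apply DifferentiableAt.differentiableWithinAt
    have := hne w hw _ hna
    fun_prop (disch := assumption)
  have hφC : DifferentiableOn ℂ (fun w => φ (C w)) unitDisk := hφ.comp hCd hCmap
  set b := φ a with hb
  have hbm : b ∈ unitDisk := hm ha
  set ψ : ℂ → ℂ := fun w => (φ (C w) - b) / (1 - conj b * φ (C w)) with hψ
  have hψd : DifferentiableOn ℂ ψ (Metric.ball 0 1) := by
    apply (hφC.sub_const _).div
    · exact (differentiableOn_const _).sub (hφC.const_mul _)
    · intro w hw
      exact hne _ (hm (hCmap hw)) _ hbm
  have hψm : Set.MapsTo ψ (Metric.ball 0 1) (Metric.closedBall 0 1) := by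
    intro w hw
    rw [mem_closedBall_zero_iff]
    exact (hle _ (hm (hCmap hw)) _ hbm).le
  have hψ0 : ψ 0 = 0 := by simp [hψ, hC, hb]
  set w := (z - a) / (1 - conj a * z) with hw
  have hwn : ‖w‖ < 1 := hle z hz a ha
  have hCw : C w = z := by
    have h1 := hne z hz a ha
    have h2 := hne w (mem_unitDisk.2 hwn) _ hna
    rw [hC]
    simp only
    have hw' : w * (1 - conj a * z) = z - a := div_mul_cancel₀ _ h1
    rw [div_eq_iff h2]
    apply mul_right_cancel₀ h1
    rw [map_neg]
    linear_combination (1 - z * conj a) * hw'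
  have key := Complex.norm_le_norm_of_mapsTo_ball hψd hψm hψ0 hwn
  simp only [hψ, hCw] at key
  rw [hw, norm_div, norm_div, div_le_div_iff₀ (norm_pos_iff.2 (hne _ (hm hz) _ hbm))
    (norm_pos_iff.2 (hne z hz a ha))] at key
  have h2 := pow_le_pow_left₀ (by positivity) key 2
  rw [mul_pow, mul_pow] at h2
  have e1 := hid (φ z) b
  have e2 := hid z a
  rw [show ‖1 - conj a * z‖ ^ 2 = ‖z - a‖ ^ 2 + (1 - ‖z‖ ^ 2) * (1 - ‖a‖ ^ 2) by linarith,
    show ‖1 - conj b * φ z‖ ^ 2 = ‖φ z - b‖ ^ 2 + (1 - ‖φ z‖ ^ 2) * (1 - ‖b‖ ^ 2) by linarith] at h2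
  nlinarith

/-! ### Univalent functions and the semigroup of an omitted value -/

/-- An injective holomorphic function has a nonvanishing derivative and a holomorphic inverse. -/
theorem exists_holomorphic_inverse {f : ℂ → ℂ} {U : Set ℂ} (hU : IsOpen U)
    (hf : DifferentiableOn ℂ f U) (hinj : Set.InjOn f U) :
    IsOpen (f '' U) ∧ (∀ z ∈ U, deriv f z ≠ 0) ∧
      ∃ g : ℂ → ℂ, (∀ z ∈ U, g (f z) = z) ∧ ∀ z ∈ U, HasDerivAt g (deriv f z)⁻¹ (f z) := by
  have han : ∀ z ∈ U, AnalyticAt ℂ f z := fun z hz => hf.analyticAt (hU.mem_nhds hz)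
  have hnc : ∀ z ∈ U, ¬ ∀ᶠ w in 𝓝 z, f w = f z := by
    intro z hz h
    have h1 : ∀ᶠ w in 𝓝[≠] z, f w = f z ∧ w ∈ U ∧ w ≠ z :=
      ((h.and (hU.mem_nhds hz)).filter_mono nhdsWithin_le_nhds).and self_mem_nhdsWithin
        |>.mono fun w hw => ⟨hw.1.1, hw.1.2, hw.2⟩
    obtain ⟨w, h2, h3, h4⟩ := h1.exists
    exact h4 (hinj h3 hz h2)
  have hmap : ∀ z ∈ U, 𝓝 (f z) ≤ map f (𝓝 z) := fun z hz =>
    ((han z hz).eventually_constant_or_nhds_le_map_nhds).resolve_left (hnc z hz)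
  have hopen : ∀ V ⊆ U, IsOpen V → IsOpen (f '' V) := by
    intro V hVU hV
    rw [isOpen_iff_mem_nhds]
    rintro _ ⟨z, hz, rfl⟩
    exact hmap z (hVU hz) (image_mem_map (hV.mem_nhds hz))
  set g := Function.invFunOn f U with hg
  have hgf : ∀ z ∈ U, g (f z) = z := fun z hz => hinj.leftInvOn_invFunOn hz
  have hcont : ∀ z ∈ U, ContinuousAt g (f z) := by
    intro z hz
    rw [ContinuousAt, hgf z hz, tendsto_def]
    intro V hV
    have h1 : V ∩ U ∈ 𝓝 z := inter_mem hV (hU.mem_nhds hz)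
    have h2 : f '' (V ∩ U) ∈ 𝓝 (f z) := hmap z hz (image_mem_map h1)
    filter_upwards [h2]
    rintro _ ⟨w, ⟨hwV, hwU⟩, rfl⟩
    simpa [hgf w hwU] using hwV
  have hder : ∀ z ∈ U, deriv f z ≠ 0 → HasDerivAt g (deriv f z)⁻¹ (f z) := by
    intro z hz hne
    apply HasDerivAt.of_local_left_inverse (f := f) (hcont z hz)
    · rw [hgf z hz]; exact (han z hz).differentiableAt.hasDerivAt
    · exact hne
    · filter_upwards [(hopen U subset_rfl hU).mem_nhds (Set.mem_image_of_mem f hz)]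
      rintro _ ⟨w, hw, rfl⟩
      rw [hgf w hw]
  have hne : ∀ z ∈ U, deriv f z ≠ 0 := by
    intro z hz
    have hiso := (han z hz).deriv.eventually_eq_zero_or_eventually_ne_zero
    rcases hiso with h0 | h0
    · exfalso
      obtain ⟨r, hr, hball⟩ := Metric.eventually_nhds_iff_ball.1 (h0.and (hU.mem_nhds hz))
      apply hnc z hz
      filter_upwards [Metric.ball_mem_nhds z hr] with w hw
      exact (convex_ball z r).is_const_of_fderivWithin_eq_zero (𝕜 := ℂ)
        (hf.mono fun x hx => (hball x hx).2)
        (fun x hx => by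
          rw [fderivWithin_of_isOpen Metric.isOpen_ball hx]
          ext; simp [(hball x hx).1]) hw (Metric.mem_ball_self hr)
    -- At an isolated zero of f' the continuous inverse g is holomorphic off one point, hence
    -- holomorphic there too, and the chain rule for g ∘ f = id contradicts f' = 0.
    · have h1 : ∀ᶠ w in 𝓝[≠] (f z), DifferentiableAt ℂ g w := by
        have h2 : ∀ᶠ w in 𝓝 z, w ≠ z → (deriv f w ≠ 0 ∧ w ∈ U) := by
          filter_upwards [eventually_nhdsWithin_iff.1 h0, hU.mem_nhds hz] with w h3 h4 h5
          exact ⟨h3 h5, h4⟩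
        rw [eventually_nhdsWithin_iff]
        have h3 := hmap z hz (image_mem_map h2)
        filter_upwards [h3]
        rintro _ ⟨w, hw, rfl⟩ hne
        have hwz : w ≠ z := fun h => hne (by rw [h]; rfl)
        exact (hder w (hw hwz).2 (hw hwz).1).differentiableAt
      have h4 : DifferentiableAt ℂ g (f z) :=
        (Complex.analyticAt_of_differentiable_on_punctured_nhds_of_continuousAt h1
          (hcont z hz)).differentiableAt
      intro hzero
      have h5 := h4.hasDerivAt.comp z (han z hz).differentiableAt.hasDerivAt
      rw [hzero, mul_zero] at h5
      have h6 : HasDerivAt (g ∘ f) 1 z := by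
        apply (hasDerivAt_id z).congr_of_eventuallyEq
        filter_upwards [hU.mem_nhds hz] with w hw
        exact hgf w hw
      exact zero_ne_one (h5.unique h6)
  exact ⟨hopen U subset_rfl hU, hne, g, hgf, fun z hz => hder z hz (hne z hz)⟩

theorem hasDerivAt_nonneg_of_right {D : ℝ → ℝ} {d t₀ : ℝ} (h : HasDerivAt D d t₀)
    (hD : ∀ᶠ t in 𝓝[>] t₀, D t₀ ≤ D t) : 0 ≤ d := by
  have h1 : Tendsto (slope D t₀) (𝓝[>] t₀) (𝓝 d) :=
    (hasDerivAt_iff_tendsto_slope.1 h).mono_left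
      (nhdsWithin_mono t₀ (fun x (hx : t₀ < x) => hx.ne'))
  apply ge_of_tendsto h1
  filter_upwards [hD, self_mem_nhdsWithin] with t ht ht0
  rw [slope_def_field]
  exact div_nonneg (by linarith) (sub_nonneg.2 (le_of_lt ht0))

theorem hasDerivAt_nonneg_of_left {D : ℝ → ℝ} {d t₀ : ℝ} (h : HasDerivAt D d t₀)
    (hD : ∀ᶠ t in 𝓝[<] t₀, D t ≤ D t₀) : 0 ≤ d := by
  have h1 : Tendsto (slope D t₀) (𝓝[<] t₀) (𝓝 d) :=
    (hasDerivAt_iff_tendsto_slope.1 h).mono_left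
      (nhdsWithin_mono t₀ (fun x (hx : x < t₀) => hx.ne))
  apply ge_of_tendsto h1
  filter_upwards [hD, self_mem_nhdsWithin] with t ht ht0
  rw [slope_def_field]
  exact div_nonneg_of_nonpos (by linarith) (sub_nonpos.2 (le_of_lt ht0))

theorem hasDerivAt_norm_sq {γ : ℝ → ℂ} {γ' : ℂ} {t : ℝ} (h : HasDerivAt γ γ' t) :
    HasDerivAt (fun s => ‖γ s‖ ^ 2) (2 * (γ' * conj (γ t)).re) t := by
  have := h.norm_sq
  simpa [Complex.inner] using this

/-- The infinitesimal Schwarz–Pick inequality for the semigroup `f⁻¹ ∘ (f + t (f - v))` on the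
disk. -/
theorem infinitesimal_schwarz_pick {f : ℂ → ℂ} (hf : DifferentiableOn ℂ f unitDisk)
    (hinj : Set.InjOn f unitDisk) {v : ℂ}
    (hstar : ∀ w ∈ f '' unitDisk, ∀ t : ℝ, 0 ≤ t → w + t * (w - v) ∈ f '' unitDisk)
    {z a : ℂ} (hz : z ∈ unitDisk) (ha : a ∈ unitDisk) :
    (((f z - v) / deriv f z - (f a - v) / deriv f a) * conj (z - a)).re
        * ((1 - ‖z‖ ^ 2) * (1 - ‖a‖ ^ 2)) +
      ‖z - a‖ ^ 2 * (((f z - v) / deriv f z * conj z).re * (1 - ‖a‖ ^ 2) +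
        ((f a - v) / deriv f a * conj a).re * (1 - ‖z‖ ^ 2)) ≤ 0 := by
  obtain ⟨hΩ, hne, g, hgf, hg'⟩ := exists_holomorphic_inverse isOpen_unitDisk hf hinj
  have hgd : DifferentiableOn ℂ g (f '' unitDisk) := by
    rintro _ ⟨w, hw, rfl⟩
    exact (hg' w hw).differentiableAt.differentiableWithinAt
  have hgm : Set.MapsTo g (f '' unitDisk) unitDisk := by
    rintro _ ⟨w, hw, rfl⟩
    rwa [hgf w hw]
  set φ : ℝ → ℂ → ℂ := fun t w => g (f w + t * (f w - v)) with hφ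
  have hφd : ∀ w ∈ unitDisk, HasDerivAt (fun t => φ t w) ((f w - v) / deriv f w) 0 := by
    intro w hw
    have h1 : HasDerivAt (fun t : ℝ => f w + t * (f w - v)) (f w - v) 0 := by
      simpa using (((hasDerivAt_id (0 : ℝ)).ofReal_comp).mul_const (f w - v)).const_add (f w)
    have h2 : HasDerivAt g (deriv f w)⁻¹ (f w + ((0 : ℝ) : ℂ) * (f w - v)) := by
      simpa using hg' w hw
    have := h2.scomp_of_eq (0 : ℝ) h1 rfl
    simpa [div_eq_mul_inv, Function.comp_def, hφ] using this
  have hφ0 : ∀ w ∈ unitDisk, φ 0 w = w := by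
    intro w hw
    simp [hφ, hgf w hw]
  have hsp : ∀ t : ℝ, 0 ≤ t → ‖φ t z - φ t a‖ ^ 2 * ((1 - ‖z‖ ^ 2) * (1 - ‖a‖ ^ 2)) ≤
      ‖z - a‖ ^ 2 * ((1 - ‖φ t z‖ ^ 2) * (1 - ‖φ t a‖ ^ 2)) := by
    intro t ht
    have hm : Set.MapsTo (fun w => f w + t * (f w - v)) unitDisk (f '' unitDisk) :=
      fun w hw => hstar _ (Set.mem_image_of_mem f hw) t ht
    apply schwarz_pick_disk (φ := φ t) _ (hgm.comp hm) hz ha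
    exact hgd.comp (hf.add ((hf.sub_const v).const_mul (t : ℂ))) hm
  -- The difference of the two sides of Schwarz–Pick for φ t is nonnegative for t ≥ 0 and zero at t
  -- = 0, so its derivative at 0 is nonnegative.
  have hd := (((hasDerivAt_norm_sq (hφd z hz)).const_sub 1).mul
    ((hasDerivAt_norm_sq (hφd a ha)).const_sub 1)).const_mul (‖z - a‖ ^ 2) |>.sub
    ((hasDerivAt_norm_sq ((hφd z hz).sub (hφd a ha))).mul_const
      ((1 - ‖z‖ ^ 2) * (1 - ‖a‖ ^ 2)))
  have := hasDerivAt_nonneg_of_right hd (by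
    filter_upwards [self_mem_nhdsWithin] with t ht
    have := hsp t (le_of_lt ht)
    simp only [Pi.sub_apply, Pi.mul_apply, hφ0 z hz, hφ0 a ha]
    linarith)
  simp only [Pi.sub_apply, hφ0 z hz, hφ0 a ha] at this
  nlinarith

/-- At a maximum point of `‖F‖` on a circle, `F / F'` is a nonnegative multiple of the point. -/
theorem exists_sphere_div_deriv_eq {F : ℂ → ℂ} (hF : DifferentiableOn ℂ F unitDisk)
    (hne : ∀ z ∈ unitDisk, F z ≠ 0) (hne' : ∀ z ∈ unitDisk, deriv F z ≠ 0)
    {r : ℝ} (hr : 0 < r) (hr1 : r < 1) :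
    ∃ a : ℂ, ‖a‖ = r ∧ ∃ c : ℝ, 0 ≤ c ∧ F a / deriv F a = c * a := by
  have hsub : Metric.closedBall (0 : ℂ) r ⊆ unitDisk := Metric.closedBall_subset_ball hr1
  obtain ⟨a, ha, hmax⟩ := (isCompact_sphere (0 : ℂ) r).exists_isMaxOn
    (NormedSpace.sphere_nonempty.2 hr.le)
    (hF.continuousOn.mono (Metric.sphere_subset_closedBall.trans hsub)).norm
  have har : ‖a‖ = r := by simpa using ha
  have haD : a ∈ unitDisk := hsub (Metric.sphere_subset_closedBall ha)
  have ha0 : a ≠ 0 := by rw [← norm_pos_iff, har]; exact hr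
  have hda : HasDerivAt F (deriv F a) a :=
    (hF.differentiableAt (isOpen_unitDisk.mem_nhds haD)).hasDerivAt
  have hball : ∀ z ∈ Metric.closedBall (0 : ℂ) r, ‖F z‖ ≤ ‖F a‖ := by
    intro z hz
    apply Complex.norm_le_of_forall_mem_frontier_norm_le (U := Metric.ball 0 r)
      Metric.isBounded_ball
    · apply DifferentiableOn.diffContOnCl
      rw [closure_ball _ hr.ne']
      exact hF.mono hsub
    · intro w hw
      rw [frontier_ball _ hr.ne'] at hw
      exact hmax hw
    · rwa [closure_ball _ hr.ne']
  have h1 : HasDerivAt (fun θ : ℝ => F (a * Complex.exp (θ * Complex.I)))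
      (deriv F a * (a * Complex.I)) 0 := by
    have e1 : HasDerivAt (fun θ : ℝ => a * Complex.exp (θ * Complex.I)) (a * Complex.I) 0 := by
      simpa using ((((hasDerivAt_id (0 : ℝ)).ofReal_comp).mul_const Complex.I).cexp).const_mul a
    exact HasDerivAt.comp_of_eq (0 : ℝ) hda e1 (by simp)
  have h2 := hasDerivAt_norm_sq h1
  have h3 : IsLocalMax (fun θ : ℝ => ‖F (a * Complex.exp (θ * Complex.I))‖ ^ 2) 0 := by
    apply Eventually.of_forall
    intro θ
    have : ‖F (a * Complex.exp (θ * Complex.I))‖ ≤ ‖F a‖ := by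
      apply hball
      simp [Complex.norm_exp_ofReal_mul_I, har]
    simpa using pow_le_pow_left₀ (norm_nonneg _) this 2
  have h4 := h3.hasDerivAt_eq_zero h2
  have h5 : HasDerivAt (fun t : ℝ => F (t * a)) (deriv F a * a) 1 := by
    have e1 : HasDerivAt (fun t : ℝ => (t : ℂ) * a) a 1 := by
      simpa using ((hasDerivAt_id (1 : ℝ)).ofReal_comp).mul_const a
    exact HasDerivAt.comp_of_eq (1 : ℝ) hda e1 (by simp)
  have h6 := hasDerivAt_nonneg_of_left (hasDerivAt_norm_sq h5) (by
    filter_upwards [Ioo_mem_nhdsLT (show (0 : ℝ) < 1 by norm_num)] with t ht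
    have : ‖F (t * a)‖ ≤ ‖F a‖ := by
      apply hball
      simp [har, abs_of_pos ht.1]
      nlinarith [ht.1, ht.2]
    simpa using pow_le_pow_left₀ (norm_nonneg _) this 2)
  simp only [Complex.ofReal_zero, zero_mul, Complex.exp_zero, mul_one, Complex.ofReal_one,
    one_mul] at h4 h6
  -- Stationarity under rotation makes ρ real, growth in the radial direction makes it nonnegative,
  -- and F/F' = (|F|²/ρ) a at the maximum point.
  set ρ : ℂ := deriv F a * a * conj (F a) with hρ
  have hρ0 : ρ ≠ 0 :=
    mul_ne_zero (mul_ne_zero (hne' a haD) ha0) ((map_ne_zero _).2 (hne a haD))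
  have him : ρ.im = 0 := by
    have : (deriv F a * (a * Complex.I) * conj (F a)) = ρ * Complex.I := by rw [hρ]; ring
    rw [this] at h4
    simpa using h4
  have hre : ρ = (ρ.re : ℂ) := Complex.ext (by simp) (by simp [him])
  refine ⟨a, har, ‖F a‖ ^ 2 / ρ.re, div_nonneg (by positivity) (by linarith), ?_⟩
  push_cast
  rw [← hre, ← Complex.mul_conj', div_mul_eq_mul_div, div_eq_div_iff (hne' a haD) hρ0, hρ]
  ring

/-- The point b plays the role of the Denjoy–Wolff point of the semigroup. At a maximum point a of
|f - v| on |z| = r the generator (f - v)/f' is a nonnegative multiple of a; inserting this a in the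
infinitesimal Schwarz–Pick inequality and letting r → 1 along a convergent subsequence of such
points yields b. -/
theorem exists_boundary_direction {f : ℂ → ℂ} (hf : DifferentiableOn ℂ f unitDisk)
    (hinj : Set.InjOn f unitDisk) {v : ℂ} (hv : v ∉ f '' unitDisk)
    (hstar : ∀ w ∈ f '' unitDisk, ∀ t : ℝ, 0 ≤ t → w + t * (w - v) ∈ f '' unitDisk) :
    ∃ b : ℂ, ‖b‖ = 1 ∧ ∀ z ∈ unitDisk,
      0 ≤ ((f z - v) / deriv f z * conj (conj b * (b - z) ^ 2)).re := by
  obtain ⟨-, hne, -⟩ := exists_holomorphic_inverse isOpen_unitDisk hf hinj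
  have key : ∀ r : ℝ, 0 < r → r < 1 → ∃ a : ℂ, ‖a‖ = r ∧ ∀ z : ℂ, ‖z‖ ≤ r →
      ((f z - v) / deriv f z * conj (z - a)).re * (1 - ‖z‖ ^ 2) +
        ‖z - a‖ ^ 2 * ((f z - v) / deriv f z * conj z).re ≤ 0 := by
    intro r hr hr1
    have hd : ∀ z, deriv (fun z => f z - v) z = deriv f z := fun z => by simp
    obtain ⟨a, har, c, hc, hac⟩ := exists_sphere_div_deriv_eq (hf.sub_const v)
      (fun z hz h => hv ⟨z, hz, sub_eq_zero.1 h⟩) (fun z hz => by rw [hd]; exact hne z hz) hr hr1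
    rw [hd] at hac
    refine ⟨a, har, fun z hz => ?_⟩
    have hzD : z ∈ unitDisk := mem_unitDisk.2 (hz.trans_lt hr1)
    have haD : a ∈ unitDisk := mem_unitDisk.2 (by linarith)
    have h := infinitesimal_schwarz_pick hf hinj hstar hzD haD
    rw [hac] at h
    set V := (f z - v) / deriv f z
    have e1 : ((V - c * a) * conj (z - a)).re =
        (V * conj (z - a)).re - c * ((a * conj z).re - ‖a‖ ^ 2) := by
      rw [Complex.sq_norm, Complex.normSq_apply]
      simp
      ring
    have e2 : (c * a * conj a).re = c * ‖a‖ ^ 2 := by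
      rw [mul_assoc, Complex.mul_conj']
      norm_cast
    have e3 : (a * conj z).re ≤ r ^ 2 := by
      calc (a * conj z).re ≤ ‖a * conj z‖ := Complex.re_le_norm _
        _ = ‖a‖ * ‖z‖ := by simp
        _ ≤ r * r := by rw [har]; gcongr
        _ = r ^ 2 := by ring
    rw [e1, e2, har] at h
    have hM : 0 < 1 - r ^ 2 := by nlinarith
    have hz2 : 0 < 1 - ‖z‖ ^ 2 := by nlinarith [norm_nonneg z]
    -- The terms containing the unknown c have a favourable sign, because Re(a conj z) ≤ r², and can
    -- be dropped.
    have p1 : 0 ≤ c * (r ^ 2 - (a * conj z).re) * ((1 - ‖z‖ ^ 2) * (1 - r ^ 2)) := by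
      have : 0 ≤ r ^ 2 - (a * conj z).re := by linarith
      positivity
    have p2 : 0 ≤ ‖z - a‖ ^ 2 * (c * r ^ 2 * (1 - ‖z‖ ^ 2)) := by positivity
    by_contra hcon
    push Not at hcon
    have := mul_pos hcon hM
    nlinarith
  choose! A hA1 hA2 using key
  set r : ℕ → ℝ := fun n => 1 - 1 / ((n : ℝ) + 2) with hr
  have hr0 : ∀ n, 0 < r n := by
    intro n
    have : 1 / ((n : ℝ) + 2) < 1 := by
      rw [div_lt_one (by positivity)]; have : (0 : ℝ) ≤ n := n.cast_nonneg; linarith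
    simp only [hr]; linarith
  have hr1 : ∀ n, r n < 1 := by
    intro n
    have : 0 < 1 / ((n : ℝ) + 2) := by positivity
    simp only [hr]; linarith
  have hrt : Tendsto r atTop (𝓝 1) := by
    have : Tendsto (fun n : ℕ => 1 / ((n : ℝ) + 2)) atTop (𝓝 0) :=
      tendsto_const_nhds.div_atTop (tendsto_natCast_atTop_atTop.atTop_add tendsto_const_nhds)
    simpa [hr] using this.const_sub 1
  obtain ⟨b, -, φ, hφ, hb⟩ := (isCompact_closedBall (0 : ℂ) 1).tendsto_subseq
    (x := fun n => A (r n)) (fun n => by simp [hA1 _ (hr0 n) (hr1 n), (hr1 n).le])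
  have hrφ := hrt.comp hφ.tendsto_atTop
  have hb1 : ‖b‖ = 1 := by
    apply tendsto_nhds_unique hb.norm
    simpa [Function.comp_def, hA1 _ (hr0 _) (hr1 _)] using hrφ
  refine ⟨b, hb1, fun z hz => ?_⟩
  set V := (f z - v) / deriv f z with hV
  have hlim : (V * conj (z - b)).re * (1 - ‖z‖ ^ 2) + ‖z - b‖ ^ 2 * (V * conj z).re ≤ 0 := by
    have hcont : Continuous fun a : ℂ =>
        (V * conj (z - a)).re * (1 - ‖z‖ ^ 2) + ‖z - a‖ ^ 2 * (V * conj z).re := by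
      have : Continuous fun a : ℂ => conj (z - a) := Complex.continuous_conj.comp (by fun_prop)
      fun_prop
    apply le_of_tendsto ((hcont.tendsto b).comp hb)
    filter_upwards [hrφ.eventually (lt_mem_nhds (mem_unitDisk.1 hz))] with n hn
    exact hA2 _ (hr0 _) (hr1 _) z hn.le
  have hid : conj (conj b * (b - z) ^ 2) =
      -(conj (z - b) * ((1 : ℂ) - ‖z‖ ^ 2) + ‖z - b‖ ^ 2 * conj z) := by
    have hbb : b * conj b = 1 := by rw [Complex.mul_conj', hb1]; simp
    rw [← Complex.mul_conj', ← Complex.mul_conj']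
    simp only [map_mul, map_sub, map_pow, Complex.conj_conj]
    linear_combination (conj b - conj z) * hbb
  rw [hid]
  have : (V * -(conj (z - b) * ((1 : ℂ) - ‖z‖ ^ 2) + ‖z - b‖ ^ 2 * conj z)).re =
      -((V * conj (z - b)).re * (1 - ‖z‖ ^ 2) + ‖z - b‖ ^ 2 * (V * conj z).re) := by
    have : V * -(conj (z - b) * ((1 : ℂ) - ‖z‖ ^ 2) + ‖z - b‖ ^ 2 * conj z) =
      -(((1 - ‖z‖ ^ 2 : ℝ) : ℂ) * (V * conj (z - b)) + ((‖z - b‖ ^ 2 : ℝ) : ℂ) * (V * conj z)) := by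
      push_cast; ring
    rw [this, Complex.neg_re, Complex.add_re, Complex.re_ofReal_mul, Complex.re_ofReal_mul]
    ring
  rw [this]
  linarith

theorem re_mul_conj_mul_nonneg {u p w : ℂ} (hp : p ≠ 0) (h : 0 ≤ (u / p * conj w).re) :
    0 ≤ (p * w * conj u).re := by
  have e : u / p * conj w = conj (p * w * conj u) / ((Complex.normSq p : ℝ) : ℂ) := by
    rw [← Complex.mul_conj]
    have : conj p ≠ 0 := (map_ne_zero _).2 hp
    field_simp
    simp
    ring
  rw [e, Complex.div_ofReal_re, Complex.conj_re] at h
  have := Complex.normSq_pos.2 hp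
  by_contra hc
  push Not at hc
  exact absurd (div_neg_of_neg_of_pos hc this) (not_lt.2 h)

/-- A function that is injective on the disk with convex complement of the image and with
limit `∞` at `1` is starlike, with respect to each omitted value, in the sense of the parabolic
semigroup fixing `1`. -/
theorem re_sub_div_deriv_nonneg {f : ℂ → ℂ} (hf : DifferentiableOn ℂ f unitDisk)
    (hinj : Set.InjOn f unitDisk) (hconv : Convex ℝ (f '' unitDisk)ᶜ)
    (hlim : Tendsto f (𝓝[unitDisk] 1) (Bornology.cobounded ℂ)) {v : ℂ} (hv : v ∉ f '' unitDisk)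
    {z : ℂ} (hz : z ∈ unitDisk) :
    0 ≤ ((f z - v) / (deriv f z * (1 - z) ^ 2)).re := by
  obtain ⟨-, hne, -⟩ := exists_holomorphic_inverse isOpen_unitDisk hf hinj
  have hstar : ∀ w ∈ f '' unitDisk, ∀ t : ℝ, 0 ≤ t → w + t * (w - v) ∈ f '' unitDisk := by
    intro w hw t ht
    by_contra hcon
    -- The point w lies on the segment from w + t(w - v) to v; were both ends omitted, w would be
    -- omitted as well.
    have h1 : (w + t * (w - v)) ∈ (f '' unitDisk)ᶜ := hcon
    have h2 := hconv h1 hv (a := 1 / (1 + t)) (b := t / (1 + t)) (by positivity) (by positivity)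
      (by field_simp)
    apply h2
    convert hw using 1
    have : (1 : ℂ) + t ≠ 0 := by
      norm_cast; positivity
    simp only [Complex.real_smul]
    push_cast
    field_simp
    ring
  obtain ⟨b, hb1, hb⟩ := exists_boundary_direction hf hinj hv hstar
  have hbb : b * conj b = 1 := by rw [Complex.mul_conj', hb1]; simp
  by_cases hb' : b = 1
  · have h := hb z hz
    rw [hb'] at h
    simp only [map_one, one_mul] at h
    have h1z : (1 - z) ^ 2 ≠ 0 := by
      apply pow_ne_zero
      intro h0
      have : z = 1 := by linear_combination -h0
      rw [this] at hz
      simp [unitDisk] at hz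
    have e : (f z - v) / (deriv f z * (1 - z) ^ 2) =
        (f z - v) / deriv f z * conj ((1 - z) ^ 2) / ((Complex.normSq ((1 - z) ^ 2) : ℝ) : ℂ) := by
      rw [← Complex.mul_conj]
      have h2 : conj ((1 - z) ^ 2) ≠ 0 := (map_ne_zero _).2 h1z
      have := hne z hz
      field_simp
    rw [e, Complex.div_ofReal_re]
    exact div_nonneg h (Complex.normSq_nonneg _)
  · exfalso
    have hb0 : b ≠ 0 := by rw [← norm_pos_iff, hb1]; norm_num
    have hbs : b - 1 ≠ 0 := sub_ne_zero.2 hb'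
    set s : ℂ := (b + 1) / (b - 1) with hs
    have hsre : s.re = 0 := by
      have hc : conj s = -s := by
        have hcb : conj b = b⁻¹ := eq_inv_of_mul_eq_one_right hbb
        rw [hs, map_div₀, map_add, map_sub, map_one, hcb, ← neg_div]
        have : b⁻¹ - 1 ≠ 0 := by
          rw [sub_ne_zero]; intro h; exact hb' (inv_eq_one.1 h)
        rw [div_eq_div_iff this hbs]
        field_simp
        ring
      have := congrArg Complex.re hc
      simp at this
      linarith
    -- This is the hyperbolic geodesic from 1 to b: a horizontal ray in the half-plane model with b
    -- at infinity, s being the imaginary number for which γ 0 = 1. Along it |f - v| increases with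
    -- τ, so f stays bounded near 1, against f → ∞.
    set γ : ℝ → ℂ := fun τ => b * ((τ + s - 1) / (τ + s + 1)) with hγ
    have hden : ∀ τ : ℝ, 0 ≤ τ → (τ : ℂ) + s + 1 ≠ 0 := by
      intro τ hτ h
      have := congrArg Complex.re h
      simp [hsre] at this
      linarith
    have hγm : ∀ τ : ℝ, 0 < τ → γ τ ∈ unitDisk := by
      intro τ hτ
      rw [mem_unitDisk, hγ, norm_mul, hb1, one_mul, norm_div,
        div_lt_one (norm_pos_iff.2 (hden τ hτ.le))]
      apply lt_of_pow_lt_pow_left₀ 2 (norm_nonneg _)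
      simp only [Complex.sq_norm, Complex.normSq_apply]
      simp [hsre]
      nlinarith
    have hγd : ∀ τ : ℝ, 0 < τ → HasDerivAt γ (conj b * (b - γ τ) ^ 2 / 2) τ := by
      intro τ hτ
      have h0 := hden τ hτ.le
      have e1 : HasDerivAt (fun τ : ℝ => (τ : ℂ)) 1 τ := (hasDerivAt_id τ).ofReal_comp
      have e2 := (((e1.add_const s).sub_const 1).div ((e1.add_const s).add_const 1) h0).const_mul b
      refine HasDerivAt.congr_deriv (f := γ) e2 ?_
      rw [show γ τ = b * ((τ + s - 1) / (τ + s + 1)) from rfl]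
      field_simp
      linear_combination (-2) * hbb
    have hk : ∀ τ : ℝ, 0 < τ → HasDerivAt (fun τ => ‖f (γ τ) - v‖ ^ 2)
        (2 * (deriv f (γ τ) * (conj b * (b - γ τ) ^ 2 / 2) * conj (f (γ τ) - v)).re) τ := by
      intro τ hτ
      apply hasDerivAt_norm_sq
      have h1 := (hf.differentiableAt (isOpen_unitDisk.mem_nhds (hγm τ hτ))).hasDerivAt
      exact (h1.comp τ (hγd τ hτ)).sub_const v
    have hmono : MonotoneOn (fun τ => ‖f (γ τ) - v‖ ^ 2) (Set.Ioi 0) := by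
      apply monotoneOn_of_deriv_nonneg (convex_Ioi 0)
      · intro τ hτ
        exact (hk τ hτ).continuousAt.continuousWithinAt
      · intro τ hτ
        rw [interior_Ioi] at hτ
        exact (hk τ hτ).differentiableAt.differentiableWithinAt
      · intro τ hτ
        rw [interior_Ioi] at hτ
        rw [(hk τ hτ).deriv]
        have h1 := hb (γ τ) (hγm τ hτ)
        have h2 := re_mul_conj_mul_nonneg (hne _ (hγm τ hτ)) h1
        have e : deriv f (γ τ) * (conj b * (b - γ τ) ^ 2 / 2) * conj (f (γ τ) - v) =
          ((1 / 2 : ℝ) : ℂ) * (deriv f (γ τ) * (conj b * (b - γ τ) ^ 2) * conj (f (γ τ) - v)) := by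
          push_cast; ring
        rw [e, Complex.re_ofReal_mul]
        linarith
    have hγ1 : Tendsto γ (𝓝[>] 0) (𝓝[unitDisk] 1) := by
      apply tendsto_nhdsWithin_iff.2
      refine ⟨?_, by filter_upwards [self_mem_nhdsWithin] with τ hτ using hγm τ hτ⟩
      have hc : ContinuousAt γ 0 := by
        have := hden 0 le_rfl
        have h2 : ContinuousAt (fun τ : ℝ => (τ : ℂ)) 0 := Complex.continuous_ofReal.continuousAt
        exact continuousAt_const.mul (((h2.add continuousAt_const).sub continuousAt_const).div
          ((h2.add continuousAt_const).add continuousAt_const) this)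
      have h0 : γ 0 = 1 := by
        simp only [hγ, hs]
        have := hden 0 le_rfl
        rw [hs] at this
        rw [mul_div_assoc', div_eq_one_iff_eq this]
        simp
        field_simp
        ring
      have := hc.tendsto
      rw [h0] at this
      exact this.mono_left nhdsWithin_le_nhds
    have hinf := (tendsto_norm_cobounded_atTop.comp (hlim.comp hγ1)).eventually_gt_atTop
      (‖f (γ 1) - v‖ + ‖v‖)
    obtain ⟨τ, hτ1, hτ2⟩ := (hinf.and (Ioo_mem_nhdsGT (show (0 : ℝ) < 1 by norm_num))).exists
    have h1 := hmono (Set.mem_Ioi.2 hτ2.1) (Set.mem_Ioi.2 one_pos) hτ2.2.le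
    have h2 : ‖f (γ τ) - v‖ ≤ ‖f (γ 1) - v‖ :=
      (sq_le_sq₀ (norm_nonneg _) (norm_nonneg _)).1 h1
    have h3 := norm_sub_norm_le (f (γ τ)) v
    simp only [Function.comp_apply] at hτ1
    linarith

/-! ### Cayley transform, primitives and logarithms on the half-plane -/

/-- The Cayley transform of the half-plane onto the disk. -/
def toDisk (ζ : ℂ) : ℂ := (ζ - 1) / (ζ + 1)

/-- The Cayley transform of the disk onto the half-plane. -/
def toHalf (z : ℂ) : ℂ := (1 + z) / (1 - z)

theorem add_one_ne_zero_of_mem {ζ : ℂ} (hζ : ζ ∈ rightHalfPlane) : ζ + 1 ≠ 0 := by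
  intro h
  have h1 : 0 < ζ.re := hζ
  have := congrArg Complex.re h
  simp at this
  linarith

theorem one_sub_ne_zero_of_mem {z : ℂ} (hz : z ∈ unitDisk) : 1 - z ≠ 0 := by
  intro h
  have : z = 1 := by linear_combination -h
  rw [this] at hz
  simp [unitDisk] at hz

theorem toDisk_mem {ζ : ℂ} (hζ : ζ ∈ rightHalfPlane) : toDisk ζ ∈ unitDisk := by
  have h1 : 0 < ζ.re := hζ
  rw [mem_unitDisk, toDisk, norm_div, div_lt_one (norm_pos_iff.2 (add_one_ne_zero_of_mem hζ))]
  apply lt_of_pow_lt_pow_left₀ 2 (norm_nonneg _)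
  simp only [Complex.sq_norm, Complex.normSq_apply]
  simp
  nlinarith

theorem toHalf_re (z : ℂ) :
    (toHalf z).re = (1 - ‖z‖ ^ 2) / ‖1 - z‖ ^ 2 := by
  rw [toHalf, Complex.div_re, Complex.sq_norm, Complex.sq_norm, ← add_div]
  congr 1
  rw [Complex.normSq_apply]
  simp
  ring

theorem toHalf_mem {z : ℂ} (hz : z ∈ unitDisk) : toHalf z ∈ rightHalfPlane := by
  show 0 < (toHalf z).re
  rw [toHalf_re z]
  have := mem_unitDisk.1 hz
  have h2 := norm_pos_iff.2 (one_sub_ne_zero_of_mem hz)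
  apply div_pos _ (by positivity)
  nlinarith [norm_nonneg z]

theorem one_sub_toDisk {ζ : ℂ} (hζ : ζ ∈ rightHalfPlane) : 1 - toDisk ζ = 2 / (ζ + 1) := by
  have := add_one_ne_zero_of_mem hζ
  rw [toDisk]
  field_simp
  ring

theorem toHalf_toDisk {ζ : ℂ} (hζ : ζ ∈ rightHalfPlane) : toHalf (toDisk ζ) = ζ := by
  have := add_one_ne_zero_of_mem hζ
  rw [toHalf, one_sub_toDisk hζ, toDisk]
  field_simp
  ring

theorem toDisk_toHalf {z : ℂ} (hz : z ∈ unitDisk) : toDisk (toHalf z) = z := by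
  have h := one_sub_ne_zero_of_mem hz
  have h2 : toHalf z + 1 ≠ 0 := add_one_ne_zero_of_mem (toHalf_mem hz)
  rw [toDisk, div_eq_iff h2, toHalf]
  field_simp
  ring

theorem hasDerivAt_toDisk {ζ : ℂ} (hζ : ζ ∈ rightHalfPlane) :
    HasDerivAt toDisk (2 / (ζ + 1) ^ 2) ζ := by
  have h := add_one_ne_zero_of_mem hζ
  have := ((hasDerivAt_id ζ).sub_const 1).div ((hasDerivAt_id ζ).add_const 1) h
  refine HasDerivAt.congr_deriv (f := toDisk) this ?_
  simp only [id]
  field_simp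
  ring

theorem hasDerivAt_toHalf {z : ℂ} (hz : z ∈ unitDisk) :
    HasDerivAt toHalf (2 / (1 - z) ^ 2) z := by
  have h := one_sub_ne_zero_of_mem hz
  have := ((hasDerivAt_id z).const_add 1).div ((hasDerivAt_id z).const_sub 1) h
  refine HasDerivAt.congr_deriv (f := toHalf) this ?_
  simp only [id]
  field_simp
  ring

theorem toDisk_image : toDisk '' rightHalfPlane = unitDisk := by
  apply Set.Subset.antisymm
  · rintro _ ⟨ζ, hζ, rfl⟩
    exact toDisk_mem hζ
  · intro z hz
    exact ⟨_, toHalf_mem hz, toDisk_toHalf hz⟩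

theorem toDisk_injOn : Set.InjOn toDisk rightHalfPlane := by
  intro a ha b hb h
  rw [← toHalf_toDisk ha, h, toHalf_toDisk hb]

/-- The form h dζ is pulled back to the disk, integrated there, and transported back. -/
theorem exists_primitive_half {h : ℂ → ℂ} (hh : DifferentiableOn ℂ h rightHalfPlane) :
    ∃ ℓ : ℂ → ℂ, ∀ ζ ∈ rightHalfPlane, HasDerivAt ℓ (h ζ) ζ := by
  have h1 : DifferentiableOn ℂ (fun z => h (toHalf z) * (2 / (1 - z) ^ 2)) (Metric.ball 0 1) := by
    apply DifferentiableOn.mul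
    · exact hh.comp (fun z hz => (hasDerivAt_toHalf hz).differentiableAt.differentiableWithinAt)
        (fun z hz => toHalf_mem hz)
    · intro z hz
      apply DifferentiableAt.differentiableWithinAt
      have : (1 - z) ^ 2 ≠ 0 := pow_ne_zero 2 (one_sub_ne_zero_of_mem hz)
      fun_prop (disch := assumption)
  obtain ⟨ℓ, hℓ⟩ := h1.isExactOn_ball
  refine ⟨fun ζ => ℓ (toDisk ζ), fun ζ hζ => ?_⟩
  have h2 := (hℓ _ (toDisk_mem hζ)).comp ζ (hasDerivAt_toDisk hζ)
  refine h2.congr_deriv ?_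
  have := add_one_ne_zero_of_mem hζ
  beta_reduce
  rw [toHalf_toDisk hζ, one_sub_toDisk hζ]
  field_simp

theorem eqOn_of_hasDerivAt_zero {U : Set ℂ} (hU : IsOpen U) (hc : Convex ℝ U) {h : ℂ → ℂ}
    (hh : ∀ z ∈ U, HasDerivAt h 0 z) {a b : ℂ} (ha : a ∈ U) (hb : b ∈ U) : h a = h b := by
  apply hc.is_const_of_fderivWithin_eq_zero (𝕜 := ℂ)
    (fun z hz => (hh z hz).differentiableAt.differentiableWithinAt) _ ha hb
  intro z hz
  rw [fderivWithin_of_isOpen hU hz]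
  ext
  simp [(hh z hz).deriv]

theorem exists_log_half {h : ℂ → ℂ} (hh : DifferentiableOn ℂ h rightHalfPlane)
    (hne : ∀ ζ ∈ rightHalfPlane, h ζ ≠ 0) :
    ∃ L : ℂ → ℂ, ∀ ζ ∈ rightHalfPlane,
      HasDerivAt L (deriv h ζ / h ζ) ζ ∧ Complex.exp (L ζ) = h ζ := by
  have hd := (hh.deriv isOpen_rightHalfPlane).div hh hne
  obtain ⟨ℓ, hℓ⟩ := exists_primitive_half hd
  have hℓ : ∀ ζ ∈ rightHalfPlane, HasDerivAt ℓ (deriv h ζ / h ζ) ζ := hℓ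
  refine ⟨fun ζ => ℓ ζ + (Complex.log (h 1) - ℓ 1), fun ζ hζ => ⟨(hℓ ζ hζ).add_const _, ?_⟩⟩
  have hc : ∀ z ∈ rightHalfPlane, HasDerivAt (fun z => h z * Complex.exp (-ℓ z)) 0 z := by
    intro z hz
    have e1 := (hh.differentiableAt (isOpen_rightHalfPlane.mem_nhds hz)).hasDerivAt
    refine (e1.mul (hℓ z hz).neg.cexp).congr_deriv ?_
    have := hne z hz
    field_simp
    simp
  have := eqOn_of_hasDerivAt_zero isOpen_rightHalfPlane convex_rightHalfPlane hc hζ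
    one_mem_rightHalfPlane
  rw [Complex.exp_add, Complex.exp_sub, Complex.exp_log (hne 1 one_mem_rightHalfPlane)]
  rw [Complex.exp_neg, Complex.exp_neg] at this
  have e1 := Complex.exp_ne_zero (ℓ ζ)
  have e2 := Complex.exp_ne_zero (ℓ 1)
  field_simp at this ⊢
  rw [← this]

/-! ### Convexity of the images of vertical lines -/

theorem hasDerivAt_deriv_half {F : ℂ → ℂ} (hF : DifferentiableOn ℂ F rightHalfPlane) {ζ : ℂ}
    (hζ : ζ ∈ rightHalfPlane) : HasDerivAt F (deriv F ζ) ζ :=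
  (hF.differentiableAt (isOpen_rightHalfPlane.mem_nhds hζ)).hasDerivAt

/-- `hproj` says that v is the omitted value nearest to F(ζ), so the half-plane v + ω(F(ζ) - v), Re
ω > 0, lies in the image. The inverse of F on it is a self-map of the right half-plane, and
Schwarz–Pick at ω = 1 is the claim. -/
theorem norm_sub_le_re_mul_norm_deriv {F : ℂ → ℂ} (hF : DifferentiableOn ℂ F rightHalfPlane)
    (hinj : Set.InjOn F rightHalfPlane) {ζ v : ℂ} (hζ : ζ ∈ rightHalfPlane)
    (hv : v ∉ F '' rightHalfPlane)
    (hproj : ∀ k ∉ F '' rightHalfPlane, ((k - v) * conj (F ζ - v)).re ≤ 0) :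
    ‖F ζ - v‖ ≤ ζ.re * ‖deriv F ζ‖ := by
  obtain ⟨-, hne, g, hgf, hg'⟩ := exists_holomorphic_inverse isOpen_rightHalfPlane hF hinj
  set n := F ζ - v with hn
  have hn0 : n ≠ 0 := fun h => hv ⟨ζ, hζ, sub_eq_zero.1 h⟩
  have hmem : ∀ ω ∈ rightHalfPlane, v + ω * n ∈ F '' rightHalfPlane := by
    intro ω hω
    by_contra hcon
    have h1 := hproj _ hcon
    have : (v + ω * n - v) * conj n = ((Complex.normSq n : ℝ) : ℂ) * ω := by
      rw [← Complex.mul_conj]; ring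
    rw [this, Complex.re_ofReal_mul] at h1
    have h2 : 0 < ω.re := hω
    nlinarith [mul_pos (Complex.normSq_pos.2 hn0) h2]
  have hd : ∀ ω ∈ rightHalfPlane, HasDerivAt (fun ω => g (v + ω * n))
      ((deriv F (g (v + ω * n)))⁻¹ * n) ω := by
    intro ω hω
    obtain ⟨η, hη, hηe⟩ := hmem ω hω
    have h1 := hg' η hη
    rw [hηe] at h1
    have h2 : g (v + ω * n) = η := by rw [← hηe, hgf η hη]
    rw [h2]
    have h3 : HasDerivAt (fun ω => v + ω * n) n ω := by
      simpa using ((hasDerivAt_id ω).mul_const n).const_add v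
    exact h1.comp ω h3
  have h4 := schwarz_pick_half_deriv (g := fun ω => g (v + ω * n))
    (fun ω hω => (hd ω hω).differentiableAt.differentiableWithinAt)
    (fun ω hω => by
      obtain ⟨η, hη, hηe⟩ := hmem ω hω
      rw [← hηe, hgf η hη]
      exact le_of_lt hη) one_mem_rightHalfPlane
  have e1 : v + 1 * n = F ζ := by rw [hn]; ring
  rw [(hd 1 one_mem_rightHalfPlane).deriv] at h4
  simp only [e1, hgf ζ hζ, norm_mul, norm_inv, Complex.one_re, mul_one] at h4
  have := norm_pos_iff.2 (hne ζ hζ)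
  rw [inv_mul_le_iff₀ this] at h4
  linarith

theorem exists_nearest_point {K : Set ℂ} (hK : IsClosed K) (hc : Convex ℝ K)
    (hne : K.Nonempty) (w : ℂ) :
    ∃ v ∈ K, ∀ k ∈ K, ((k - v) * conj (w - v)).re ≤ 0 := by
  obtain ⟨v, hv, h⟩ := exists_norm_eq_iInf_of_complete_convex hne hK.isComplete hc w
  refine ⟨v, hv, fun k hk => ?_⟩
  have := (norm_eq_iInf_iff_real_inner_le_zero hc hv).1 h k hk
  simpa [Complex.inner, mul_comm] using this

/-- If the image of the half-plane has nonempty convex complement and every omitted value is seen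
from the rear along vertical lines, then the images of vertical lines are convex curves. -/
theorem re_deriv_deriv_div_nonneg {F : ℂ → ℂ} (hF : DifferentiableOn ℂ F rightHalfPlane)
    (hinj : Set.InjOn F rightHalfPlane) (hconv : Convex ℝ (F '' rightHalfPlane)ᶜ)
    (hne : (F '' rightHalfPlane)ᶜ.Nonempty)
    (hB : ∀ v ∉ F '' rightHalfPlane, ∀ ζ ∈ rightHalfPlane, 0 ≤ ((F ζ - v) / deriv F ζ).re)
    {ζ : ℂ} (hζ : ζ ∈ rightHalfPlane) : 0 ≤ (deriv (deriv F) ζ / deriv F ζ).re := by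
  obtain ⟨hopen, hF0, -⟩ := exists_holomorphic_inverse isOpen_rightHalfPlane hF hinj
  obtain ⟨v, hv, hproj⟩ := exists_nearest_point hopen.isClosed_compl hconv hne (F ζ)
  have hdist := norm_sub_le_re_mul_norm_deriv hF hinj hζ hv hproj
  have hF' := hF.deriv isOpen_rightHalfPlane
  set p : ℂ → ℂ := fun ζ => (F ζ - v) / deriv F ζ with hp
  have hpd : DifferentiableOn ℂ p rightHalfPlane := (hF.sub_const v).div hF' hF0
  have hsp := schwarz_pick_half_deriv hpd (hB v hv) hζ
  have hF0ζ := hF0 ζ hζ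
  have hp0 : p ζ ≠ 0 := div_ne_zero (fun h => hv ⟨ζ, hζ, sub_eq_zero.1 h⟩) hF0ζ
  have hple : ‖p ζ‖ ≤ ζ.re := by
    rw [hp, norm_div, div_le_iff₀ (norm_pos_iff.2 hF0ζ)]
    exact hdist
  have hpder := ((hasDerivAt_deriv_half hF hζ).sub_const v).div
    (hasDerivAt_deriv_half hF' hζ) hF0ζ
  have hpder : HasDerivAt p _ ζ := hpder
  -- From p' = 1 - p F''/F'. It remains to see Re(p'/p) ≤ Re(1/p) = Re p/|p|², which follows from
  -- |p| ≤ Re ζ (nearest point) and |p'| Re ζ ≤ Re p (Schwarz–Pick).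
  have hq : deriv (deriv F) ζ / deriv F ζ = (1 - deriv p ζ) / p ζ := by
    have : F ζ - v ≠ 0 := fun h => hv ⟨ζ, hζ, sub_eq_zero.1 h⟩
    rw [hpder.deriv, hp]
    field_simp
    ring
  have hx : 0 < ζ.re := hζ
  have hre := hB v hv ζ hζ
  have hre : 0 ≤ (p ζ).re := hre
  have hpn := norm_pos_iff.2 hp0
  rw [hq, sub_div, Complex.sub_re, one_div, Complex.inv_re, Complex.normSq_eq_norm_sq]
  have h1 : (deriv p ζ / p ζ).re ≤ ‖deriv p ζ‖ / ‖p ζ‖ := by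
    rw [← norm_div]; exact Complex.re_le_norm _
  have h2 : ‖deriv p ζ‖ / ‖p ζ‖ ≤ (p ζ).re / ‖p ζ‖ ^ 2 := by
    rw [div_le_div_iff₀ hpn (by positivity)]
    have : ‖deriv p ζ‖ * ‖p ζ‖ ≤ (p ζ).re :=
      (mul_le_mul_of_nonneg_left hple (norm_nonneg _)).trans hsp
    nlinarith
  linarith

/-! ### Size of the complement and oscillation of arg F' -/

/-- Otherwise the inverse g would be entire with Re g > 0, and Liouville's theorem applied to 1/(g +
1) would make it constant. -/
theorem exists_notMem_image_half {F : ℂ → ℂ} (hF : DifferentiableOn ℂ F rightHalfPlane)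
    (hinj : Set.InjOn F rightHalfPlane) : (F '' rightHalfPlane)ᶜ.Nonempty := by
  by_contra hcon
  rw [Set.not_nonempty_iff_eq_empty, Set.compl_empty_iff] at hcon
  obtain ⟨-, -, g, hgf, hg'⟩ := exists_holomorphic_inverse isOpen_rightHalfPlane hF hinj
  have hg : ∀ w, DifferentiableAt ℂ g w ∧ g w ∈ rightHalfPlane := by
    intro w
    have : w ∈ F '' rightHalfPlane := by rw [hcon]; trivial
    obtain ⟨ζ, hζ, rfl⟩ := this
    exact ⟨(hg' ζ hζ).differentiableAt, by rwa [hgf ζ hζ]⟩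
  have hd : Differentiable ℂ fun w => (g w + 1)⁻¹ :=
    fun w => ((hg w).1.add_const 1).inv (add_one_ne_zero_of_mem (hg w).2)
  have hb : Bornology.IsBounded (Set.range fun w => (g w + 1)⁻¹) := by
    rw [isBounded_iff_forall_norm_le]
    refine ⟨1, ?_⟩
    rintro _ ⟨w, rfl⟩
    rw [norm_inv]
    apply inv_le_one_of_one_le₀
    have h1 : 0 < (g w).re := (hg w).2
    have h2 := Complex.re_le_norm (g w + 1)
    simp at h2
    linarith
  have h2 : (2 : ℂ) ∈ rightHalfPlane := by simp [rightHalfPlane]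
  have := hd.apply_eq_apply_of_bounded hb (F 1) (F 2)
  simp only [hgf 1 one_mem_rightHalfPlane, hgf 2 h2] at this
  norm_num at this

/-- If the complement lay inside a circle, that circle would lie in the image and wind once around
an omitted v; but log(F - v) composed with the inverse of F is a primitive of 1/(w - v) on the
image. -/
theorem not_isBounded_compl_image_half {F : ℂ → ℂ} (hF : DifferentiableOn ℂ F rightHalfPlane)
    (hinj : Set.InjOn F rightHalfPlane) : ¬ Bornology.IsBounded (F '' rightHalfPlane)ᶜ := by
  intro hb
  obtain ⟨v, hv⟩ := exists_notMem_image_half hF hinj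
  obtain ⟨-, hne, g, hgf, hg'⟩ := exists_holomorphic_inverse isOpen_rightHalfPlane hF hinj
  obtain ⟨R, hR⟩ := hb.subset_ball (0 : ℂ)
  have hvR := hR hv
  have hR0 : 0 ≤ R := (dist_nonneg.trans (le_of_lt (Metric.mem_ball.1 hvR)))
  obtain ⟨ℓ, hℓ⟩ := exists_primitive_half
    ((hF.deriv isOpen_rightHalfPlane).div (hF.sub_const v)
      (fun ζ hζ h => hv ⟨ζ, hζ, sub_eq_zero.1 h⟩))
  have h1 : (∮ z in C(0, R), (z - v)⁻¹) = 2 * Real.pi * Complex.I :=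
    circleIntegral.integral_sub_inv_of_mem_ball hvR
  have h2 : (∮ z in C(0, R), (z - v)⁻¹) = 0 := by
    apply circleIntegral.integral_eq_zero_of_hasDerivWithinAt (f := fun w => ℓ (g w)) hR0
    intro w hw
    have hwm : w ∈ F '' rightHalfPlane := by
      by_contra hcon
      have := hR hcon
      rw [mem_ball_zero_iff] at this
      rw [mem_sphere_zero_iff_norm] at hw
      linarith
    obtain ⟨ζ, hζ, rfl⟩ := hwm
    have h3 := hℓ ζ hζ
    rw [← hgf ζ hζ] at h3
    have := h3.comp (F ζ) (hg' ζ hζ)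
    refine HasDerivAt.hasDerivWithinAt (this.congr_deriv ?_)
    have h4 : F ζ - v ≠ 0 := fun h => hv ⟨ζ, hζ, sub_eq_zero.1 h⟩
    have h5 := hne ζ hζ
    simp only [Pi.div_apply, hgf ζ hζ]
    field_simp
  rw [h2] at h1
  exact Complex.two_pi_I_ne_zero h1.symm

/-- Take v = te in `hB` for arbitrarily large t: the term -t Re(e/F') must not overwhelm the fixed
Re(F/F'). -/
theorem re_div_deriv_nonpos_of_frequently {F : ℂ → ℂ}
    (hB : ∀ v ∉ F '' rightHalfPlane, ∀ ζ ∈ rightHalfPlane, 0 ≤ ((F ζ - v) / deriv F ζ).re)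
    {e : ℂ} (he : ∃ᶠ t : ℝ in atTop, (t : ℂ) * e ∉ F '' rightHalfPlane) {ζ : ℂ}
    (hζ : ζ ∈ rightHalfPlane) : (e / deriv F ζ).re ≤ 0 := by
  by_contra hcon
  push Not at hcon
  obtain ⟨t, ht1, ht2⟩ := (he.and_eventually
    (eventually_gt_atTop ((F ζ / deriv F ζ).re / (e / deriv F ζ).re))).exists
  have h := hB _ ht1 ζ hζ
  rw [div_lt_iff₀ hcon] at ht2
  rw [sub_div, mul_div_assoc, Complex.sub_re, Complex.re_ofReal_mul] at h
  linarith

/-- A limit of v/|v| over omitted v tending to infinity; dividing `hB` by |v| gives the inequality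
in the limit. -/
theorem exists_recession_direction {F : ℂ → ℂ}
    (hunb : ¬ Bornology.IsBounded (F '' rightHalfPlane)ᶜ)
    (hB : ∀ v ∉ F '' rightHalfPlane, ∀ ζ ∈ rightHalfPlane, 0 ≤ ((F ζ - v) / deriv F ζ).re) :
    ∃ u : ℂ, ‖u‖ = 1 ∧ ∀ ζ ∈ rightHalfPlane, (u / deriv F ζ).re ≤ 0 := by
  have h1 : ∀ n : ℕ, ∃ v ∉ F '' rightHalfPlane, (n : ℝ) + 1 < ‖v‖ := by
    intro n
    by_contra hcon
    push Not at hcon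
    exact hunb (isBounded_iff_forall_norm_le.2 ⟨_, fun v hv => hcon v hv⟩)
  choose v hv hvn using h1
  have hpos : ∀ n, 0 < ‖v n‖ := fun n => lt_trans (by positivity) (hvn n)
  obtain ⟨u, hu, φ, hφ, hlim⟩ := (isCompact_sphere (0 : ℂ) 1).tendsto_subseq
    (x := fun n => v n / ‖v n‖) (fun n => by simp [(hpos n).ne'])
  refine ⟨u, by simpa using hu, fun ζ hζ => ?_⟩
  have h2 : Tendsto (fun n => (F ζ / deriv F ζ).re / ‖v (φ n)‖) atTop (𝓝 0) := by
    apply tendsto_const_nhds.div_atTop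
    apply tendsto_atTop_mono (fun n => (hvn (φ n)).le)
    exact (tendsto_natCast_atTop_atTop.comp hφ.tendsto_atTop).atTop_add tendsto_const_nhds
  have h3 : Tendsto (fun n => (v (φ n) / ‖v (φ n)‖ / deriv F ζ).re) atTop
      (𝓝 (u / deriv F ζ).re) :=
    (Complex.continuous_re.tendsto _).comp (hlim.div_const _)
  apply le_of_tendsto_of_tendsto' h3 h2
  intro n
  have h := hB _ (hv (φ n)) ζ hζ
  have e1 : v (φ n) / ‖v (φ n)‖ / deriv F ζ = v (φ n) / deriv F ζ / (‖v (φ n)‖ : ℝ) := by ring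
  rw [e1, Complex.div_ofReal_re]
  rw [sub_div, Complex.sub_re] at h
  have := hpos (φ n)
  exact div_le_div_of_nonneg_right (by linarith) this.le

/-- On a longer interval ψ and ψ + π would both be admissible for a whole range of ψ, and the cosine
would vanish identically on that range. -/
theorem sub_le_pi_of_cos_nonpos {θ ψ₁ ψ₂ : ℝ}
    (h : ∀ ψ ∈ Set.Icc ψ₁ ψ₂, Real.cos (θ - ψ) ≤ 0) : ψ₂ - ψ₁ ≤ Real.pi := by
  by_contra hcon
  push Not at hcon
  have hπ := Real.pi_gt_three
  have hz : ∀ ε, 0 ≤ ε → ε ≤ ψ₂ - ψ₁ - Real.pi → Real.cos (θ - (ψ₁ + ε)) = 0 := by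
    intro ε h0 h1
    apply le_antisymm (h _ ⟨by linarith, by linarith⟩)
    have := h (ψ₁ + ε + Real.pi) ⟨by linarith, by linarith⟩
    rw [show θ - (ψ₁ + ε + Real.pi) = θ - (ψ₁ + ε) - Real.pi by ring, Real.cos_sub_pi] at this
    linarith
  set ε := min (ψ₂ - ψ₁ - Real.pi) 1 with hε
  have hε0 : 0 < ε := lt_min (by linarith) one_pos
  have h1 := hz 0 le_rfl (by linarith)
  have h2 := hz ε hε0.le (min_le_left _ _)
  rw [add_zero] at h1
  rw [show θ - (ψ₁ + ε) = (θ - ψ₁) - ε by ring, Real.cos_sub, h1, zero_mul, zero_add] at h2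
  have h3 : 0 < Real.sin ε :=
    Real.sin_pos_of_pos_of_lt_pi hε0 (by linarith [min_le_right (ψ₂ - ψ₁ - Real.pi) 1])
  rcases mul_eq_zero.1 h2 with h4 | h4
  · have := Real.sin_sq_add_cos_sq (θ - ψ₁)
    rw [h1, h4] at this
    norm_num at this
  · linarith

theorem volume_cos_nonpos_inter_le {ψ₁ ψ₂ : ℝ} (h1 : ψ₂ - ψ₁ ≤ Real.pi) :
    volume.real ({θ : ℝ | Real.cos (θ - ψ₁) ≤ 0 ∧ Real.cos (θ - ψ₂) ≤ 0} ∩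
      Set.Ioc (-Real.pi) Real.pi) ≤ Real.pi - (ψ₂ - ψ₁) := by
  have hπ := Real.pi_pos
  set S := {θ : ℝ | Real.cos (θ - ψ₁) ≤ 0 ∧ Real.cos (θ - ψ₂) ≤ 0} with hS
  have hSm : MeasurableSet S := by
    apply IsClosed.measurableSet
    apply IsClosed.and
    · exact isClosed_le (by fun_prop) continuous_const
    · exact isClosed_le (by fun_prop) continuous_const
  have hper : volume (S ∩ Set.Ioc (-Real.pi) (-Real.pi + 2 * Real.pi)) =
      volume (S ∩ Set.Ioc (ψ₂ - Real.pi / 2) (ψ₂ - Real.pi / 2 + 2 * Real.pi)) := by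
    apply (isAddFundamentalDomain_Ioc Real.two_pi_pos (-Real.pi) volume).measure_set_eq
      (isAddFundamentalDomain_Ioc Real.two_pi_pos (ψ₂ - Real.pi / 2) volume) hSm
    rintro ⟨g, hg⟩
    obtain ⟨n, rfl⟩ := AddSubgroup.mem_zmultiples_iff.1 hg
    ext θ
    have e : ∀ ψ, Real.cos (n * (2 * Real.pi) + θ - ψ) = Real.cos (θ - ψ) := by
      intro ψ
      rw [show (n : ℝ) * (2 * Real.pi) + θ - ψ = (θ - ψ) + n * (2 * Real.pi) by ring,
        Real.cos_add_int_mul_two_pi]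
    simp [hS, AddSubgroup.vadd_def, e]
  rw [show -Real.pi + 2 * Real.pi = Real.pi by ring] at hper
  rw [measureReal_def, hper]
  -- In the period starting at ψ₂ - π/2 the solution set is one interval; the extra point is the
  -- right end of the period, which can belong to it when ψ₂ - ψ₁ = π.
  have hsub : S ∩ Set.Ioc (ψ₂ - Real.pi / 2) (ψ₂ - Real.pi / 2 + 2 * Real.pi) ⊆
      Set.Icc (ψ₂ + Real.pi / 2) (ψ₁ + 3 * Real.pi / 2) ∪ {ψ₁ + 5 * Real.pi / 2} := by
    rintro θ ⟨⟨hc1, hc2⟩, h3, h4⟩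
    have h5 : ψ₂ + Real.pi / 2 ≤ θ := by
      by_contra hcon
      push Not at hcon
      have := Real.cos_pos_of_mem_Ioo (x := θ - ψ₂) ⟨by linarith, by linarith⟩
      linarith
    by_cases h6 : θ ≤ ψ₁ + 3 * Real.pi / 2
    · exact Or.inl ⟨h5, h6⟩
    · right
      push Not at h6
      by_contra h7
      have h8 : θ < ψ₁ + 5 * Real.pi / 2 := lt_of_le_of_ne (by linarith) h7
      have := Real.cos_pos_of_mem_Ioo (x := θ - ψ₁ - 2 * Real.pi) ⟨by linarith, by linarith⟩
      rw [Real.cos_sub_two_pi] at this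
      linarith
  have h2 : volume (S ∩ Set.Ioc (ψ₂ - Real.pi / 2) (ψ₂ - Real.pi / 2 + 2 * Real.pi)) ≤
      ENNReal.ofReal (Real.pi - (ψ₂ - ψ₁)) := by
    refine (measure_mono hsub).trans ((measure_union_le _ _).trans ?_)
    rw [Real.volume_singleton, add_zero, Real.volume_Icc]
    apply ENNReal.ofReal_le_ofReal
    linarith
  exact ENNReal.toReal_le_of_le_ofReal (by linarith) h2

theorem re_exp_sub (θ : ℝ) (w : ℂ) :
    (Complex.exp (θ * Complex.I) / Complex.exp w).re =
      Real.exp (-w.re) * Real.cos (θ - w.im) := by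
  rw [← Complex.exp_sub, Complex.exp_re]
  simp

/-- A bound for the opening angle at infinity bounds the oscillation of the argument of the
derivative. -/
theorem im_log_deriv_sub_le {α : ℝ} {F L : ℂ → ℂ}
    (hunb : ¬ Bornology.IsBounded (F '' rightHalfPlane)ᶜ)
    (hB : ∀ v ∉ F '' rightHalfPlane, ∀ ζ ∈ rightHalfPlane, 0 ≤ ((F ζ - v) / deriv F ζ).re)
    (hangle : openingAngleAtInfinity (F '' rightHalfPlane) ≤ Real.pi * α)
    (hLc : ContinuousOn L rightHalfPlane)
    (hL : ∀ ζ ∈ rightHalfPlane, Complex.exp (L ζ) = deriv F ζ) (hα : 1 < α)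
    {ζ₁ ζ₂ : ℂ} (h₁ : ζ₁ ∈ rightHalfPlane) (h₂ : ζ₂ ∈ rightHalfPlane) :
    (L ζ₂).im - (L ζ₁).im ≤ (α - 1) * Real.pi := by
  have hπ := Real.pi_pos
  by_cases h0 : 0 < (L ζ₂).im - (L ζ₁).im
  swap
  · have : 0 ≤ (α - 1) * Real.pi := by nlinarith
    linarith
  obtain ⟨u, hu1, hu⟩ := exists_recession_direction hunb hB
  have hue : u = Complex.exp (u.arg * Complex.I) := by
    have := Complex.norm_mul_exp_arg_mul_I u
    rw [hu1] at this
    simpa using this.symm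
  have hpre : IsPreconnected ((fun ζ => (L ζ).im) '' rightHalfPlane) :=
    convex_rightHalfPlane.isPreconnected.image _
      (Complex.continuous_im.comp_continuousOn hLc)
  -- A first bound by π, from a single recession direction and the intermediate value property of
  -- arg F'; it is what the measure estimate for E needs.
  have hle : (L ζ₂).im - (L ζ₁).im ≤ Real.pi := by
    apply sub_le_pi_of_cos_nonpos (θ := u.arg)
    intro ψ hψ
    obtain ⟨ζ, hζ, rfl⟩ := hpre.ordConnected.out (Set.mem_image_of_mem _ h₁)
      (Set.mem_image_of_mem _ h₂) hψ
    have := hu ζ hζ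
    rw [hue, ← hL ζ hζ, re_exp_sub] at this
    by_contra hcon
    push Not at hcon
    have := mul_pos (Real.exp_pos (-(L ζ).re)) hcon
    linarith
  have hm := volume_cos_nonpos_inter_le hle
  rw [openingAngleAtInfinity] at hangle
  set A := {θ : ℝ | θ ∈ Set.Ioc (-Real.pi) Real.pi ∧
    ∀ᶠ t : ℝ in atTop, (t : ℂ) * Complex.exp (θ * Complex.I) ∈ F '' rightHalfPlane} with hA
  set E := {θ : ℝ | Real.cos (θ - (L ζ₁).im) ≤ 0 ∧ Real.cos (θ - (L ζ₂).im) ≤ 0} ∩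
      Set.Ioc (-Real.pi) Real.pi with hE
  -- A direction outside A meets the complement at arbitrarily large distances, hence makes an angle
  -- of at least π/2 with every value of F'. Measuring the cover gives 2π ≤ απ + π - oscillation.
  have hcover : Set.Ioc (-Real.pi) Real.pi ⊆ A ∪ E := by
    intro θ hθ
    by_cases hθA : θ ∈ A
    · exact Or.inl hθA
    · right
      have hfr : ∃ᶠ t : ℝ in atTop, (t : ℂ) * Complex.exp (θ * Complex.I) ∉ F '' rightHalfPlane :=
        fun h => hθA ⟨hθ, h.mono fun t ht => not_not.1 ht⟩
      have hcos : ∀ ζ ∈ rightHalfPlane, Real.cos (θ - (L ζ).im) ≤ 0 := by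
        intro ζ hζ
        have := re_div_deriv_nonpos_of_frequently hB hfr hζ
        rw [← hL ζ hζ, re_exp_sub] at this
        by_contra hcon
        push Not at hcon
        have := mul_pos (Real.exp_pos (-(L ζ).re)) hcon
        linarith
      exact ⟨⟨hcos _ h₁, hcos _ h₂⟩, hθ⟩
  have hfin : volume (Set.Ioc (-Real.pi) Real.pi) ≠ ⊤ := by simp
  have hAs : A ⊆ Set.Ioc (-Real.pi) Real.pi := fun θ hθ => hθ.1
  have hEs : E ⊆ Set.Ioc (-Real.pi) Real.pi := fun θ hθ => hθ.2
  have hun : volume (A ∪ E) ≠ ⊤ := measure_ne_top_of_subset (Set.union_subset hAs hEs) hfin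
  have h1 := (measureReal_mono hcover hun).trans (measureReal_union_le A E)
  rw [Real.volume_real_Ioc] at h1
  rw [max_eq_left (by linarith)] at h1
  nlinarith

theorem exists_center_of_oscillation {L : ℂ → ℂ} {δ : ℝ}
    (h : ∀ ζ₁ ∈ rightHalfPlane, ∀ ζ₂ ∈ rightHalfPlane, (L ζ₂).im - (L ζ₁).im ≤ δ) :
    ∃ c : ℝ, ∀ ζ ∈ rightHalfPlane, |(L ζ).im - c| ≤ δ / 2 := by
  set I := (fun ζ => (L ζ).im) '' rightHalfPlane with hI
  have hne : I.Nonempty := ⟨_, Set.mem_image_of_mem _ one_mem_rightHalfPlane⟩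
  have hbdd : BddAbove I := by
    refine ⟨(L 1).im + δ, ?_⟩
    rintro _ ⟨ζ, hζ, rfl⟩
    have := h 1 one_mem_rightHalfPlane ζ hζ
    simp only
    linarith
  refine ⟨sSup I - δ / 2, fun ζ hζ => ?_⟩
  have h1 : (L ζ).im ≤ sSup I := le_csSup hbdd (Set.mem_image_of_mem _ hζ)
  have h2 : sSup I ≤ (L ζ).im + δ := by
    apply csSup_le hne
    rintro _ ⟨ζ', hζ', rfl⟩
    have := h ζ hζ ζ' hζ'
    simp only
    linarith
  rw [abs_le]
  constructor <;> linarith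

/-! ### Decay of F''/F' and positivity of the transformed expression -/

/-- After centring, exp((L - ic)/δ) takes values in the closed right half-plane and has logarithmic
derivative q/δ, so Schwarz–Pick applies. -/
theorem norm_logDeriv_mul_re_le {L q : ℂ → ℂ} {δ : ℝ} (hδ : 0 < δ)
    (hL : ∀ ζ ∈ rightHalfPlane, HasDerivAt L (q ζ) ζ)
    (hosc : ∀ ζ₁ ∈ rightHalfPlane, ∀ ζ₂ ∈ rightHalfPlane,
      (L ζ₂).im - (L ζ₁).im ≤ δ * Real.pi)
    {ζ : ℂ} (hζ : ζ ∈ rightHalfPlane) : ‖q ζ‖ * ζ.re ≤ δ := by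
  obtain ⟨c, hc⟩ := exists_center_of_oscillation hosc
  set g : ℂ → ℂ := fun ζ => Complex.exp ((L ζ - c * Complex.I) / δ) with hg
  have hgd : ∀ ζ ∈ rightHalfPlane, HasDerivAt g (g ζ * (q ζ / δ)) ζ := fun ζ hζ =>
    (((hL ζ hζ).sub_const _).div_const _).cexp
  have hre : ∀ ζ ∈ rightHalfPlane, 0 ≤ (g ζ).re := by
    intro ζ hζ
    rw [hg, Complex.exp_re]
    apply mul_nonneg (Real.exp_pos _).le
    rw [Complex.div_ofReal_im]
    have h1 := abs_le.1 (hc ζ hζ)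
    simp only [Complex.sub_im, Complex.mul_im, Complex.ofReal_re, Complex.I_im, mul_one,
      Complex.ofReal_im, Complex.I_re, mul_zero, add_zero]
    apply Real.cos_nonneg_of_mem_Icc
    constructor
    · rw [le_div_iff₀ hδ]; linarith [h1.1]
    · rw [div_le_iff₀ hδ]; linarith [h1.2]
  have h := schwarz_pick_half_deriv
    (fun ζ hζ => (hgd ζ hζ).differentiableAt.differentiableWithinAt) hre hζ
  rw [(hgd ζ hζ).deriv, norm_mul, norm_div, Complex.norm_real, Real.norm_of_nonneg hδ.le] at h
  have h2 := Complex.re_le_norm (g ζ)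
  have h3 : 0 < ‖g ζ‖ := norm_pos_iff.2 (Complex.exp_ne_zero _)
  have h4 : ‖g ζ‖ * (‖q ζ‖ / δ * ζ.re) ≤ ‖g ζ‖ * 1 := by linarith
  have h5 := le_of_mul_le_mul_left h4 h3
  rw [div_mul_eq_mul_div, div_le_one hδ] at h5
  exact h5

/-- A Julia-type lemma at infinity. -/
theorem normSq_mul_re_le_of_decay {q : ℂ → ℂ} {δ : ℝ}
    (hq : DifferentiableOn ℂ q rightHalfPlane) (hre : ∀ ζ ∈ rightHalfPlane, 0 ≤ (q ζ).re)
    (hdecay : ∀ ζ ∈ rightHalfPlane, ‖q ζ‖ * ζ.re ≤ δ)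
    {ζ : ℂ} (hζ : ζ ∈ rightHalfPlane) : ‖q ζ‖ ^ 2 * ζ.re ≤ δ * (q ζ).re := by
  have hx : 0 < ζ.re := hζ
  have hmem : ∀ a : ℝ, 0 < a → (a : ℂ) ∈ rightHalfPlane := fun a ha => by
    simpa [rightHalfPlane] using ha
  -- Schwarz–Pick between ζ and a real point a → ∞: there q(a) → 0, while a Re q(a) stays at most δ
  -- and takes the place of the angular derivative.
  have key : ∀ᶠ a : ℝ in atTop, ‖q ζ + conj (q a)‖ ^ 2 * ζ.re ≤
      δ * (q ζ).re * ‖ζ / a + 1‖ ^ 2 := by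
    filter_upwards [eventually_gt_atTop 0] with a ha
    have h1 := schwarz_pick_half_sq hq hre hζ (hmem a ha)
    have h2 := hdecay a (hmem a ha)
    simp only [Complex.ofReal_re, Complex.conj_ofReal] at h1 h2
    have h3 := Complex.re_le_norm (q a)
    have e : ‖ζ / a + 1‖ ^ 2 = ‖ζ + a‖ ^ 2 / a ^ 2 := by
      have : (a : ℂ) ≠ 0 := by exact_mod_cast ha.ne'
      rw [show ζ / (a : ℂ) + 1 = (ζ + a) / a by field_simp, norm_div, div_pow, Complex.norm_real,
        Real.norm_of_nonneg ha.le]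
    rw [e, mul_div_assoc', le_div_iff₀ (by positivity)]
    have h4 : (q a).re * a ≤ δ := by nlinarith
    calc ‖q ζ + conj (q a)‖ ^ 2 * ζ.re * a ^ 2
        = ‖q ζ + conj (q a)‖ ^ 2 * (ζ.re * a) * a := by ring
      _ ≤ (q ζ).re * (q a).re * ‖ζ + a‖ ^ 2 * a := by gcongr
      _ = (q ζ).re * ‖ζ + a‖ ^ 2 * ((q a).re * a) := by ring
      _ ≤ (q ζ).re * ‖ζ + a‖ ^ 2 * δ := by
          apply mul_le_mul_of_nonneg_left h4
          have := hre ζ hζ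
          positivity
      _ = δ * (q ζ).re * ‖ζ + a‖ ^ 2 := by ring
  have hqa : Tendsto (fun a : ℝ => q a) atTop (𝓝 0) := by
    have h0 : Tendsto (fun a : ℝ => δ / a) atTop (𝓝 0) :=
      tendsto_const_nhds.div_atTop tendsto_id
    apply squeeze_zero_norm' _ h0
    filter_upwards [eventually_gt_atTop 0] with a ha
    rw [le_div_iff₀ ha]
    simpa using hdecay a (hmem a ha)
  have hl : Tendsto (fun a : ℝ => ‖q ζ + conj (q a)‖ ^ 2 * ζ.re) atTop
      (𝓝 (‖q ζ + conj 0‖ ^ 2 * ζ.re)) :=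
    (((tendsto_const_nhds.add ((Complex.continuous_conj.tendsto 0).comp hqa)).norm).pow 2).mul_const _
  have hinv : Tendsto (fun a : ℝ => ζ / (a : ℂ)) atTop (𝓝 0) := by
    apply squeeze_zero_norm' (a := fun a : ℝ => ‖ζ‖ / a) _
      (tendsto_const_nhds.div_atTop tendsto_id)
    filter_upwards [eventually_gt_atTop 0] with a ha
    simp [abs_of_pos ha]
  have hr : Tendsto (fun a : ℝ => δ * (q ζ).re * ‖ζ / a + 1‖ ^ 2) atTop
      (𝓝 (δ * (q ζ).re * ‖(0 : ℂ) + 1‖ ^ 2)) :=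
    (((hinv.add_const 1).norm).pow 2).const_mul _
  have := le_of_tendsto_of_tendsto hl hr key
  simpa using this

theorem norm_sq_sub_one_lt {ζ : ℂ} (hζ : ζ ∈ rightHalfPlane) :
    ‖ζ ^ 2 - 1‖ < ‖ζ‖ ^ 2 + 1 := by
  have hx : 0 < ζ.re := hζ
  apply lt_of_pow_lt_pow_left₀ 2 (by positivity)
  rw [Complex.sq_norm, Complex.sq_norm, Complex.normSq_apply, Complex.normSq_apply]
  simp [pow_two]
  nlinarith [mul_pos hx hx]

/-- With x = Re ζ the hypothesis says |2xG - 1| ≤ 1. Multiplying the target by 2x splits off a term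
of real part |ζ|² + 1, and the rest is at most |ζ² - 1| < |ζ|² + 1. -/
theorem re_sub_mul_pos {ζ G : ℂ} (hζ : ζ ∈ rightHalfPlane) (hG : ‖G‖ ^ 2 * ζ.re ≤ G.re) :
    0 < (ζ - (ζ ^ 2 - 1) * G).re := by
  have hx : 0 < ζ.re := hζ
  have h1 := norm_sq_sub_one_lt hζ
  have hs : ‖2 * ζ.re * G - 1‖ ≤ 1 := by
    apply (sq_le_sq₀ (norm_nonneg _) zero_le_one).1
    rw [Complex.sq_norm, Complex.normSq_apply] at hG ⊢
    simp
    nlinarith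
  have e : 2 * (ζ.re : ℂ) * (ζ - (ζ ^ 2 - 1) * G) =
      2 * ζ.re * ζ - (ζ ^ 2 - 1) - (ζ ^ 2 - 1) * (2 * ζ.re * G - 1) := by ring
  have h2 : ((ζ ^ 2 - 1) * (2 * ζ.re * G - 1)).re ≤ ‖ζ ^ 2 - 1‖ := by
    calc _ ≤ ‖(ζ ^ 2 - 1) * (2 * ζ.re * G - 1)‖ := Complex.re_le_norm _
      _ = ‖ζ ^ 2 - 1‖ * ‖2 * ζ.re * G - 1‖ := norm_mul _ _
      _ ≤ ‖ζ ^ 2 - 1‖ * 1 := by gcongr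
      _ = _ := mul_one _
  have h3 := congrArg Complex.re e
  rw [Complex.sub_re, Complex.sub_re] at h3
  have e4 : (2 * (ζ.re : ℂ) * (ζ - (ζ ^ 2 - 1) * G)).re =
      2 * ζ.re * (ζ - (ζ ^ 2 - 1) * G).re := by
    rw [← Complex.re_ofReal_mul]; push_cast; rfl
  have e5 : (2 * (ζ.re : ℂ) * ζ).re - (ζ ^ 2 - 1).re = ‖ζ‖ ^ 2 + 1 := by
    rw [Complex.sq_norm, Complex.normSq_apply]
    simp [pow_two]
    ring
  rw [e4] at h3
  by_contra hcon
  push Not at hcon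
  nlinarith

theorem re_inv_pos {w : ℂ} : 0 < (w⁻¹).re ↔ 0 < w.re := by
  constructor
  · intro h
    have hw : w ≠ 0 := by rintro rfl; simp at h
    rw [Complex.inv_re] at h
    exact (div_pos_iff_of_pos_right (Complex.normSq_pos.2 hw)).1 h
  · intro h
    have hw : w ≠ 0 := by rintro rfl; simp at h
    rw [Complex.inv_re]
    exact div_pos h (Complex.normSq_pos.2 hw)

theorem re_div_pos_comm {u w : ℂ} : 0 < (u / w).re ↔ 0 < (w / u).re := by
  rw [← re_inv_pos, inv_div]

/-! ### Converse: univalence, lifted rays and convex complement -/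

/-- The Noshiro–Warschawski criterion. -/
theorem injOn_of_re_deriv_div_pos {F : ℂ → ℂ} {U : Set ℂ} (hU : IsOpen U) (hc : Convex ℝ U)
    (hF : DifferentiableOn ℂ F U) {d : ℂ} (hd : ∀ z ∈ U, 0 < (deriv F z / d).re) :
    Set.InjOn F U := by
  intro a ha b hb hab
  by_contra hne
  have hba : b - a ≠ 0 := sub_ne_zero.2 (Ne.symm hne)
  set k : ℝ → ℝ := fun t => (F (a + t * (b - a)) / (d * (b - a))).re with hk
  have hmem : ∀ t ∈ Set.Icc (0 : ℝ) 1, a + t * (b - a) ∈ U := by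
    intro t ht
    have := hc.add_smul_sub_mem ha hb ht
    simpa using this
  have hder : ∀ t ∈ Set.Icc (0 : ℝ) 1, HasDerivAt k (deriv F (a + t * (b - a)) / d).re t := by
    intro t ht
    have h1 := (hF.differentiableAt (hU.mem_nhds (hmem t ht))).hasDerivAt
    have h2 : HasDerivAt (fun t : ℝ => a + (t : ℂ) * (b - a)) (b - a) t := by
      simpa using (((hasDerivAt_id t).ofReal_comp).mul_const (b - a)).const_add a
    have h3 := (h1.comp t h2).div_const (d * (b - a))
    have h4 := (Complex.reCLM.hasFDerivAt.comp_hasDerivAt t h3)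
    refine HasDerivAt.congr_deriv (f := k) h4 ?_
    simp only [Complex.reCLM_apply]
    congr 1
    rw [mul_div_mul_right _ _ hba]
  have hmono : StrictMonoOn k (Set.Icc 0 1) := by
    apply strictMonoOn_of_deriv_pos (convex_Icc 0 1)
    · exact fun t ht => (hder t ht).continuousAt.continuousWithinAt
    · intro t ht
      have ht' := interior_subset ht
      rw [(hder t ht').deriv]
      exact hd _ (hmem t ht')
  have := hmono (Set.left_mem_Icc.2 zero_le_one) (Set.right_mem_Icc.2 zero_le_one) zero_lt_one
  simp [hk, hab] at this

/-- The centre of the range of arg F' gives the weak inequality. If F' is nonconstant its image is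
open, so the inequality is strict; if F' is constant, its own direction serves. -/
theorem exists_direction {L F : ℂ → ℂ} (hF : DifferentiableOn ℂ F rightHalfPlane)
    (hL : ∀ ζ ∈ rightHalfPlane, Complex.exp (L ζ) = deriv F ζ)
    (hosc : ∀ ζ₁ ∈ rightHalfPlane, ∀ ζ₂ ∈ rightHalfPlane, (L ζ₂).im - (L ζ₁).im ≤ Real.pi) :
    ∃ d : ℂ, ‖d‖ = 1 ∧ ∀ ζ ∈ rightHalfPlane, 0 < (deriv F ζ / d).re := by
  obtain ⟨c, hc⟩ := exists_center_of_oscillation hosc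
  have hF' := hF.deriv isOpen_rightHalfPlane
  have han : AnalyticOnNhd ℂ (deriv F) rightHalfPlane := hF'.analyticOnNhd isOpen_rightHalfPlane
  rcases han.is_constant_or_isOpen convex_rightHalfPlane.isPreconnected with ⟨w, hw⟩ | hopen
  · have hw0 : w ≠ 0 := by
      rw [← hw 1 one_mem_rightHalfPlane, ← hL 1 one_mem_rightHalfPlane]
      exact Complex.exp_ne_zero _
    have hwn := norm_pos_iff.2 hw0
    refine ⟨w / ‖w‖, by simp [hw0], fun ζ hζ => ?_⟩
    rw [hw ζ hζ, div_div_cancel₀ hw0]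
    simpa using hwn
  · refine ⟨Complex.exp (c * Complex.I), Complex.norm_exp_ofReal_mul_I c, fun ζ hζ => ?_⟩
    set e := Complex.exp (c * Complex.I) with he
    have hge : ∀ ζ ∈ rightHalfPlane, 0 ≤ (deriv F ζ / e).re := by
      intro ζ hζ
      rw [← hL ζ hζ, he, ← Complex.exp_sub, Complex.exp_re]
      apply mul_nonneg (Real.exp_pos _).le
      apply Real.cos_nonneg_of_mem_Icc
      have := abs_le.1 (hc ζ hζ)
      simp
      constructor <;> linarith
    have h1 : IsOpen ((fun w => w * e) ⁻¹' (deriv F '' rightHalfPlane)) :=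
      (hopen _ subset_rfl isOpen_rightHalfPlane).preimage (by fun_prop)
    have he0 : e ≠ 0 := Complex.exp_ne_zero _
    have h2 : (fun w => w * e) ⁻¹' (deriv F '' rightHalfPlane) ⊆ {w | 0 ≤ w.re} := by
      rintro w ⟨ζ', hζ', hw⟩
      have := hge ζ' hζ'
      rw [hw] at this
      simpa [he0] using this
    have h3 := interior_maximal h2 h1
    rw [Complex.interior_setOfPred_le_re] at h3
    exact h3 ⟨ζ, hζ, by simp [he0]⟩

/-- If images of vertical lines are convex curves, then the image contains the rays that point to
the convex side. -/
theorem ray_subset_image {F : ℂ → ℂ} (hF : DifferentiableOn ℂ F rightHalfPlane)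
    (hinj : Set.InjOn F rightHalfPlane)
    (hq : ∀ ζ ∈ rightHalfPlane, 0 ≤ (deriv (deriv F) ζ / deriv F ζ).re)
    {ζ d : ℂ} (hζ : ζ ∈ rightHalfPlane) (hd : 0 < (deriv F ζ / d).re) {t : ℝ} (ht : 0 ≤ t) :
    F ζ + t * d ∈ F '' rightHalfPlane := by
  obtain ⟨hopen, hne, g, hgf, hg'⟩ := exists_holomorphic_inverse isOpen_rightHalfPlane hF hinj
  have hF' := hF.deriv isOpen_rightHalfPlane
  by_contra hcon
  have hd0 : d ≠ 0 := by rintro rfl; simp at hd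
  set p : ℝ → ℂ := fun s => F ζ + s * d with hp
  have hpc : Continuous p := by
    have := Complex.continuous_ofReal
    simp only [hp]
    fun_prop
  set S : Set ℝ := Set.Ici 0 ∩ p ⁻¹' (F '' rightHalfPlane)ᶜ with hS
  have hScl : IsClosed S := isClosed_Ici.inter (hopen.isClosed_compl.preimage hpc)
  have hSb : BddBelow S := ⟨0, fun s hs => hs.1⟩
  -- T is the first time at which the ray leaves the image; the lift η of the ray exists up to T and
  -- will be shown to converge inside the half-plane.
  set T := sInf S with hT
  have hTS : T ∈ S := hScl.csInf_mem ⟨t, ht, hcon⟩ hSb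
  have hT0 : 0 < T := by
    apply lt_of_le_of_ne hTS.1
    intro h
    apply hTS.2
    rw [← h]
    simpa [hp] using Set.mem_image_of_mem F hζ
  have hlt : ∀ s ∈ Set.Ico 0 T, p s ∈ F '' rightHalfPlane := by
    intro s hs
    by_contra h
    exact absurd (csInf_le hSb ⟨hs.1, h⟩) (not_le.2 hs.2)
  set η : ℝ → ℂ := fun s => g (p s) with hη
  have hη1 : ∀ s ∈ Set.Ico 0 T, η s ∈ rightHalfPlane ∧ F (η s) = p s := by
    intro s hs
    obtain ⟨ω, hω, hωe⟩ := hlt s hs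
    have : η s = ω := by simp only [hη]; rw [← hωe, hgf ω hω]
    rw [this]
    exact ⟨hω, hωe⟩
  have hη0 : η 0 = ζ := by simp [hη, hp, hgf ζ hζ]
  have hηd : ∀ s ∈ Set.Ico 0 T, HasDerivAt η (d / deriv F (η s)) s := by
    intro s hs
    obtain ⟨h1, h2⟩ := hη1 s hs
    have h3 := hg' _ h1
    have h4 : HasDerivAt p d s := by
      show HasDerivAt (fun s : ℝ => F ζ + (s : ℂ) * d) d s
      simpa using (((hasDerivAt_id s).ofReal_comp).mul_const d).const_add (F ζ)
    refine (HasDerivAt.comp_of_eq s h3 h4 h2).congr_deriv ?_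
    rw [div_eq_inv_mul]
  have hcx : Convex ℝ (Set.Ico 0 T) := convex_Ico 0 T
  have hm : ∀ s ∈ Set.Ico 0 T, HasDerivAt (fun s => (deriv F (η s) / d).re)
      (deriv (deriv F) (η s) / deriv F (η s)).re s := by
    intro s hs
    obtain ⟨h1, h2⟩ := hη1 s hs
    have h3 := ((hasDerivAt_deriv_half hF' h1).comp s (hηd s hs)).div_const d
    have h4 := Complex.reCLM.hasFDerivAt.comp_hasDerivAt s h3
    refine HasDerivAt.congr_deriv (f := fun s => (deriv F (η s) / d).re) h4 ?_
    simp only [Complex.reCLM_apply]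
    congr 1
    have := hne _ h1
    field_simp
  have h0mem : (0 : ℝ) ∈ Set.Ico 0 T := ⟨le_rfl, hT0⟩
  set c₀ := (deriv F ζ / d).re with hc₀
  -- Along the lift, Re(F'/d) has derivative Re(F''/F') ≥ 0. Keeping it above c₀ bounds the speed of
  -- η by 1/c₀ and makes Re η increase, so η escapes neither to infinity nor to the boundary.
  have hmle : ∀ s ∈ Set.Ico 0 T, c₀ ≤ (deriv F (η s) / d).re := by
    intro s hs
    have hmono : MonotoneOn (fun s => (deriv F (η s) / d).re) (Set.Ico 0 T) := by
      apply monotoneOn_of_deriv_nonneg hcx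
      · exact fun s hs => (hm s hs).continuousAt.continuousWithinAt
      · exact fun s hs => (hm s (interior_subset hs)).differentiableAt.differentiableWithinAt
      · intro s hs
        rw [(hm s (interior_subset hs)).deriv]
        exact hq _ (hη1 s (interior_subset hs)).1
    have := hmono h0mem hs hs.1
    simpa [hη0] using this
  have hspeed : ∀ s ∈ Set.Ico 0 T, ‖d / deriv F (η s)‖ ≤ 1 / c₀ := by
    intro s hs
    rw [← inv_div, norm_inv, ← one_div]
    exact one_div_le_one_div_of_le hd ((hmle s hs).trans (Complex.re_le_norm _))
  have hηre : ∀ s ∈ Set.Ico 0 T, ζ.re ≤ (η s).re := by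
    intro s hs
    have hder : ∀ s ∈ Set.Ico 0 T, HasDerivAt (fun s => (η s).re) (d / deriv F (η s)).re s :=
      fun s hs => Complex.reCLM.hasFDerivAt.comp_hasDerivAt s (hηd s hs)
    have hmono : MonotoneOn (fun s => (η s).re) (Set.Ico 0 T) := by
      apply monotoneOn_of_deriv_nonneg hcx
      · exact fun s hs => (hder s hs).continuousAt.continuousWithinAt
      · exact fun s hs => (hder s (interior_subset hs)).differentiableAt.differentiableWithinAt
      · intro s hs
        have hs' := interior_subset hs
        rw [(hder s hs').deriv]
        exact (re_div_pos_comm.2 (lt_of_lt_of_le hd (hmle s hs'))).le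
    have := hmono h0mem hs hs.1
    simpa [hη0] using this
  have hηbd : ∀ s ∈ Set.Ico 0 T, ‖η s - ζ‖ ≤ 1 / c₀ * T := by
    intro s hs
    have := hcx.norm_image_sub_le_of_norm_hasDerivWithin_le
      (fun s hs => (hηd s hs).hasDerivWithinAt) hspeed h0mem hs
    rw [hη0] at this
    refine this.trans ?_
    apply mul_le_mul_of_nonneg_left _ (by positivity)
    simp [abs_of_nonneg hs.1, hs.2.le]
  set τ : ℕ → ℝ := fun n => T * (1 - 1 / ((n : ℝ) + 1)) with hτ
  have hτm : ∀ n, τ n ∈ Set.Ico 0 T := by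
    intro n
    have h1 : 1 / ((n : ℝ) + 1) ≤ 1 := by
      rw [div_le_one (by positivity)]; have : (0 : ℝ) ≤ n := n.cast_nonneg; linarith
    have h2 : 0 < 1 / ((n : ℝ) + 1) := by positivity
    constructor
    · exact mul_nonneg hT0.le (by linarith)
    · simp only [hτ]; nlinarith
  have hτl : Tendsto τ atTop (𝓝 T) := by
    have := (tendsto_one_div_add_atTop_nhds_zero_nat (𝕜 := ℝ)).const_sub 1
    simpa [hτ] using this.const_mul T
  obtain ⟨ω, -, φ, hφ, hω⟩ := (isCompact_closedBall ζ (1 / c₀ * T)).tendsto_subseq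
    (x := fun n => η (τ n)) (fun n => by
      rw [mem_closedBall_iff_norm]; exact hηbd _ (hτm n))
  have hωm : ω ∈ rightHalfPlane := by
    have h1 : ζ.re ≤ ω.re :=
      ge_of_tendsto' ((Complex.continuous_re.tendsto ω).comp hω) (fun n => hηre _ (hτm _))
    exact lt_of_lt_of_le hζ h1
  have hF1 : Tendsto (fun n => F (η (τ (φ n)))) atTop (𝓝 (F ω)) :=
    (hasDerivAt_deriv_half hF hωm).continuousAt.tendsto.comp hω
  have hF2 : Tendsto (fun n => F (η (τ (φ n)))) atTop (𝓝 (p T)) := by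
    simp only [fun n => (hη1 _ (hτm (φ n))).2]
    exact (hpc.tendsto T).comp (hτl.comp hφ.tendsto_atTop)
  exact hTS.2 ⟨ω, hωm, tendsto_nhds_unique hF1 hF2⟩

/-- By `ray_subset_image` every omitted w satisfies Re((w - F(ω))/F'(ω)) ≤ 0 for all ω, a condition
stable under convex combinations. A value F(ζ) violates it at ω = ζ - ε for small ε > 0, the
quotient being ε to first order. -/
theorem convex_compl_image {F : ℂ → ℂ} (hF : DifferentiableOn ℂ F rightHalfPlane)
    (hinj : Set.InjOn F rightHalfPlane)
    (hq : ∀ ζ ∈ rightHalfPlane, 0 ≤ (deriv (deriv F) ζ / deriv F ζ).re) :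
    Convex ℝ (F '' rightHalfPlane)ᶜ := by
  obtain ⟨-, hne, -⟩ := exists_holomorphic_inverse isOpen_rightHalfPlane hF hinj
  have hF' := hF.deriv isOpen_rightHalfPlane
  have key : ∀ w ∉ F '' rightHalfPlane, ∀ ζ ∈ rightHalfPlane,
      ((w - F ζ) / deriv F ζ).re ≤ 0 := by
    intro w hw ζ hζ
    by_contra hcon
    push Not at hcon
    apply hw
    have := ray_subset_image hF hinj hq hζ (re_div_pos_comm.1 hcon) zero_le_one
    simpa using this
  intro w₁ h₁ w₂ h₂ a b ha hb hab
  rintro ⟨ζ, hζ, hζe⟩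
  have hx : 0 < ζ.re := hζ
  have hle : ∀ ω ∈ rightHalfPlane, ((F ζ - F ω) / deriv F ω).re ≤ 0 := by
    intro ω hω
    have e : (F ζ - F ω) / deriv F ω =
        (a : ℂ) * ((w₁ - F ω) / deriv F ω) + (b : ℂ) * ((w₂ - F ω) / deriv F ω) := by
      have : (a : ℂ) + b = 1 := by exact_mod_cast hab
      rw [hζe]
      simp only [Complex.real_smul]
      rw [show a * w₁ + b * w₂ - F ω = a * (w₁ - F ω) + b * (w₂ - F ω) by
        linear_combination F ω * this]
      ring
    rw [e, Complex.add_re, Complex.re_ofReal_mul, Complex.re_ofReal_mul]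
    nlinarith [key w₁ h₁ ω hω, key w₂ h₂ ω hω]
  have hsub : HasDerivAt (fun ε : ℝ => ζ - (ε : ℂ)) (-1) 0 := by
    simpa using ((hasDerivAt_id (0 : ℝ)).ofReal_comp).const_sub ζ
  have h1 : HasDerivAt (fun ε : ℝ => F ζ - F (ζ - ε)) (deriv F ζ) 0 := by
    have := (HasDerivAt.comp_of_eq (0 : ℝ) (hasDerivAt_deriv_half hF hζ) hsub (by simp)).const_sub
      (F ζ)
    simpa using this
  have h2 : HasDerivAt (fun ε : ℝ => deriv F (ζ - ε)) (deriv (deriv F) ζ * (-1)) 0 :=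
    HasDerivAt.comp_of_eq (0 : ℝ) (hasDerivAt_deriv_half hF' hζ) hsub (by simp)
  have h3 := h1.div h2 (by simpa using hne ζ hζ)
  have h4 := (Complex.reCLM.hasFDerivAt.comp_hasDerivAt (0 : ℝ) h3).neg
  have h5 := hasDerivAt_nonneg_of_right h4 (by
    filter_upwards [Ioo_mem_nhdsGT hx] with ε hε
    have := hle (ζ - ε) (by
      show 0 < (ζ - ε).re
      simp [hε.2])
    simpa using this)
  simp only [Complex.reCLM_apply, Complex.ofReal_zero, sub_zero, sub_self, zero_mul] at h5
  have := hne ζ hζ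
  rw [show deriv F ζ * deriv F ζ / deriv F ζ ^ 2 = 1 by field_simp] at h5
  norm_num at h5

theorem sub_notMem_image {F : ℂ → ℂ} (hF : DifferentiableOn ℂ F rightHalfPlane)
    (hinj : Set.InjOn F rightHalfPlane)
    (hq : ∀ ζ ∈ rightHalfPlane, 0 ≤ (deriv (deriv F) ζ / deriv F ζ).re) {d v : ℂ}
    (hd : ∀ ζ ∈ rightHalfPlane, 0 < (deriv F ζ / d).re) (hv : v ∉ F '' rightHalfPlane)
    {t : ℝ} (ht : 0 ≤ t) : v - t * d ∉ F '' rightHalfPlane := by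
  rintro ⟨ζ, hζ, h⟩
  apply hv
  have := ray_subset_image hF hinj hq hζ (hd ζ hζ) ht
  rw [h] at this
  simpa using this

/-! ### Growth of F and boundedness of preimages -/

theorem ofReal_mem_rightHalfPlane {a : ℝ} (ha : 0 < a) : (a : ℂ) ∈ rightHalfPlane := by
  simpa [rightHalfPlane] using ha

/-- A holomorphic function with positive real part dominates `x / (4 a)` times its value at a real
point `a ≥ |ζ|`. -/
theorem re_mul_re_le_of_norm_le {h : ℂ → ℂ} (hh : DifferentiableOn ℂ h rightHalfPlane)
    (hre : ∀ ζ ∈ rightHalfPlane, 0 ≤ (h ζ).re) {ζ : ℂ} (hζ : ζ ∈ rightHalfPlane) {a : ℝ}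
    (ha : 0 < a) (hle : ‖ζ‖ ≤ a) : (h a).re * ζ.re ≤ (h ζ).re * (4 * a) := by
  have hx : 0 < ζ.re := hζ
  have h1 := schwarz_pick_half_sq hh hre hζ (ofReal_mem_rightHalfPlane ha)
  simp only [Complex.ofReal_re, Complex.conj_ofReal] at h1
  have h2 : (h a).re ^ 2 ≤ ‖h ζ + conj (h a)‖ ^ 2 := by
    have h3 : (h a).re ≤ (h ζ + conj (h a)).re := by simpa using hre ζ hζ
    exact pow_le_pow_left₀ (hre _ (ofReal_mem_rightHalfPlane ha))
      (h3.trans (Complex.re_le_norm _)) 2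
  have h4 : ‖ζ + a‖ ^ 2 ≤ (2 * a) ^ 2 := by
    apply pow_le_pow_left₀ (norm_nonneg _)
    refine (norm_add_le _ _).trans ?_
    rw [Complex.norm_real, Real.norm_of_nonneg ha.le]
    linarith
  have h5 := hre _ (ofReal_mem_rightHalfPlane ha)
  have h6 := hre _ hζ
  rcases h5.eq_or_lt with h7 | h7
  · rw [← h7]; nlinarith
  · have h8 : (h a).re ^ 2 * (ζ.re * a) ≤ (h ζ).re * (h a).re * (2 * a) ^ 2 :=
      calc _ ≤ ‖h ζ + conj (h a)‖ ^ 2 * (ζ.re * a) := by gcongr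
        _ ≤ _ := h1
        _ ≤ _ := by gcongr
    have h9 : ((h a).re * a) * ((h a).re * ζ.re) ≤ ((h a).re * a) * ((h ζ).re * (4 * a)) := by
      linarith
    exact le_of_mul_le_mul_left h9 (by positivity)

/-- Harnack between x and 1 gives Re(F'(x)/d) ≥ c/x, whose integral diverges logarithmically. -/
theorem tendsto_re_div_atTop {F : ℂ → ℂ} (hF : DifferentiableOn ℂ F rightHalfPlane) {d : ℂ}
    (hd : ∀ ζ ∈ rightHalfPlane, 0 < (deriv F ζ / d).re) :
    Tendsto (fun a : ℝ => (F a / d).re) atTop atTop := by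
  have hF' := hF.deriv isOpen_rightHalfPlane
  set c := (deriv F 1 / d).re / 4 with hc
  have hc0 : 0 < c := by have := hd 1 one_mem_rightHalfPlane; positivity
  have hlow : ∀ x : ℝ, 1 ≤ x → c / x ≤ (deriv F x / d).re := by
    intro x hx
    have hx0 : 0 < x := by linarith
    have h1 := schwarz_pick_half_sq (g := fun ζ => deriv F ζ / d) (hF'.div_const d)
      (fun ζ hζ => (hd ζ hζ).le) (ofReal_mem_rightHalfPlane hx0) one_mem_rightHalfPlane
    simp only [Complex.ofReal_re, Complex.one_re, map_one, mul_one] at h1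
    have h2 := hd 1 one_mem_rightHalfPlane
    have h3 := hd x (ofReal_mem_rightHalfPlane hx0)
    have h4 : (deriv F 1 / d).re ^ 2 ≤ ‖deriv F x / d + conj (deriv F 1 / d)‖ ^ 2 := by
      apply pow_le_pow_left₀ h2.le
      refine le_trans ?_ (Complex.re_le_norm _)
      rw [Complex.add_re, Complex.conj_re]
      linarith
    have h5 : ‖(x : ℂ) + 1‖ ^ 2 ≤ (2 * x) ^ 2 := by
      rw [show (x : ℂ) + 1 = ((x + 1 : ℝ) : ℂ) by push_cast; rfl, Complex.norm_real,
        Real.norm_of_nonneg (by linarith)]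
      exact pow_le_pow_left₀ (by linarith) (by linarith) 2
    have h6 : (deriv F 1 / d).re ^ 2 * x ≤ (deriv F x / d).re * (deriv F 1 / d).re * (2 * x) ^ 2 :=
      calc _ ≤ ‖deriv F x / d + conj (deriv F 1 / d)‖ ^ 2 * x := by gcongr
        _ ≤ _ := h1
        _ ≤ _ := by gcongr
    rw [hc, div_le_iff₀ hx0]
    have h7 : ((deriv F 1 / d).re * x) * (deriv F 1 / d).re ≤
        ((deriv F 1 / d).re * x) * ((deriv F x / d).re * (4 * x)) := by linarith
    have h8 := le_of_mul_le_mul_left h7 (by positivity)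
    linarith
  have hmono : MonotoneOn (fun x : ℝ => (F x / d).re - c * Real.log x) (Set.Ici 1) := by
    have hder : ∀ x ∈ Set.Ici (1 : ℝ), HasDerivAt (fun x : ℝ => (F x / d).re - c * Real.log x)
        ((deriv F x / d).re - c * x⁻¹) x := by
      intro x hx
      have hx0 : (0 : ℝ) < x := lt_of_lt_of_le one_pos hx
      have h1 := ((hasDerivAt_deriv_half hF (ofReal_mem_rightHalfPlane hx0)).comp_ofReal).div_const d
      have h2 := Complex.reCLM.hasFDerivAt.comp_hasDerivAt x h1
      exact h2.sub ((Real.hasDerivAt_log hx0.ne').const_mul c)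
    apply monotoneOn_of_deriv_nonneg (convex_Ici 1)
    · exact fun x hx => (hder x hx).continuousAt.continuousWithinAt
    · exact fun x hx => (hder x (interior_subset hx)).differentiableAt.differentiableWithinAt
    · intro x hx
      rw [(hder x (interior_subset hx)).deriv]
      have := hlow x (interior_subset hx)
      rw [← div_eq_mul_inv]
      linarith
  have hlim : Tendsto (fun a : ℝ => (F 1 / d).re + c * Real.log a) atTop atTop :=
    tendsto_atTop_add_const_left _ _ (Real.tendsto_log_atTop.const_mul_atTop hc0)
  apply tendsto_atTop_mono' _ _ hlim
  filter_upwards [eventually_ge_atTop 1] with a ha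
  have := hmono (Set.mem_Ici.2 le_rfl) (Set.mem_Ici.2 ha) ha
  simp at this
  linarith

/-- A univalent function on the half-plane with convex complement of the image grows at least like
a power near the boundary of the image. -/
theorem re_le_sqrt_norm_mul {F : ℂ → ℂ} (hF : DifferentiableOn ℂ F rightHalfPlane) {d k : ℂ}
    (hd : ‖d‖ = 1) (hk : ∀ t : ℝ, 0 ≤ t → k - t * d ∉ F '' rightHalfPlane) {A : ℝ} (hA : 0 < A)
    (hbig : ∀ a : ℝ, A ≤ a → 1 ≤ ((F a - k) / d).re) {ζ : ℂ} (hζ : ζ ∈ rightHalfPlane) :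
    ζ.re ≤ 4 * (A + ‖ζ‖) * Real.sqrt ‖F ζ - k‖ := by
  have hd0 : d ≠ 0 := by rw [← norm_pos_iff, hd]; exact one_pos
  have hslit : ∀ ζ ∈ rightHalfPlane, (F ζ - k) / d ∈ Complex.slitPlane := by
    intro ζ hζ
    by_contra hcon
    rw [Complex.mem_slitPlane_iff] at hcon
    push Not at hcon
    apply hk (-((F ζ - k) / d).re) (by linarith)
    refine ⟨ζ, hζ, ?_⟩
    have e : (F ζ - k) / d = (((F ζ - k) / d).re : ℂ) := Complex.ext (by simp) (by simp [hcon.2])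
    have e2 : F ζ - k = (((F ζ - k) / d).re : ℂ) * d := by rw [← e, div_mul_cancel₀ _ hd0]
    push_cast
    linear_combination e2
  -- Since F omits the ray k - td, (F - k)/d has a square root h with Re h ≥ 0. Harnack against the
  -- real point A + |ζ|, where Re h ≥ 1, bounds Re h(ζ) from below.
  set h : ℂ → ℂ := fun ζ => Complex.exp (Complex.log ((F ζ - k) / d) / 2) with hh
  have hhd : DifferentiableOn ℂ h rightHalfPlane :=
    (((((hF.sub_const k).div_const d)).clog hslit).div_const 2).cexp
  have hre : ∀ ζ ∈ rightHalfPlane, 0 ≤ (h ζ).re := by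
    intro ζ hζ
    rw [hh, Complex.exp_re]
    apply mul_nonneg (Real.exp_pos _).le
    have e : (Complex.log ((F ζ - k) / d) / 2).im = (Complex.log ((F ζ - k) / d)).im / 2 := by
      rw [show (2 : ℂ) = ((2 : ℝ) : ℂ) by norm_num, Complex.div_ofReal_im]
    rw [e]
    apply Real.cos_nonneg_of_mem_Icc
    have h1 := Complex.neg_pi_lt_log_im ((F ζ - k) / d)
    have h2 := Complex.log_im_le_pi ((F ζ - k) / d)
    constructor <;> linarith
  have hsq : ∀ ζ ∈ rightHalfPlane, h ζ ^ 2 = (F ζ - k) / d := by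
    intro ζ hζ
    rw [hh, ← Complex.exp_nat_mul]
    push_cast
    rw [mul_div_cancel₀ _ two_ne_zero, Complex.exp_log (Complex.slitPlane_ne_zero (hslit ζ hζ))]
  have ha : 0 < A + ‖ζ‖ := by positivity
  have h1 := re_mul_re_le_of_norm_le hhd hre hζ ha (by linarith)
  have h2 : 1 ≤ (h ((A + ‖ζ‖ : ℝ) : ℂ)).re := by
    have hm := ofReal_mem_rightHalfPlane ha
    have h3 := hbig (A + ‖ζ‖) (by linarith [norm_nonneg ζ])
    rw [← hsq _ hm, pow_two, Complex.mul_re] at h3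
    have := hre _ hm
    nlinarith [mul_self_nonneg (h ((A + ‖ζ‖ : ℝ) : ℂ)).im]
  have h4 : (h ζ).re ≤ Real.sqrt ‖F ζ - k‖ := by
    apply (Complex.re_le_norm _).trans
    apply Real.le_sqrt_of_sq_le
    rw [← norm_pow, hsq ζ hζ, norm_div, hd, div_one]
  have hx : 0 < ζ.re := hζ
  calc ζ.re ≤ (h ((A + ‖ζ‖ : ℝ) : ℂ)).re * ζ.re := by nlinarith
    _ ≤ (h ζ).re * (4 * (A + ‖ζ‖)) := h1
    _ ≤ Real.sqrt ‖F ζ - k‖ * (4 * (A + ‖ζ‖)) := by gcongr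
    _ = _ := by ring

/-- From F(ζ) one moves a unit distance straight away from the nearest omitted point k and ends in a
compact part of the image, where the inverse is bounded. At distance δ + τ from k, the distance
estimate and the square-root bound make the logarithmic speed of the lift at most 8/√(δ + τ). This
is integrable uniformly as δ → 0, so the starting point ζ is bounded too. -/
theorem exists_norm_le_of_norm_image_le {F : ℂ → ℂ} (hF : DifferentiableOn ℂ F rightHalfPlane)
    (hinj : Set.InjOn F rightHalfPlane)
    (hq : ∀ ζ ∈ rightHalfPlane, 0 ≤ (deriv (deriv F) ζ / deriv F ζ).re) {d : ℂ} (hd1 : ‖d‖ = 1)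
    (hd : ∀ ζ ∈ rightHalfPlane, 0 < (deriv F ζ / d).re) (R : ℝ) :
    ∃ M : ℝ, ∀ ζ ∈ rightHalfPlane, ‖F ζ‖ ≤ R → ‖ζ‖ ≤ M := by
  obtain ⟨hopen, hne, g, hgf, hg'⟩ := exists_holomorphic_inverse isOpen_rightHalfPlane hF hinj
  have hconv := convex_compl_image hF hinj hq
  obtain ⟨k₀, hk₀⟩ := exists_notMem_image_half hF hinj
  set R₁ := R + ‖k₀‖ with hR₁
  -- Each nearest omitted point k below satisfies |k| ≤ R + R₁, so this threshold gives Re((F(a) -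
  -- k)/d) ≥ 1 with A independent of ζ.
  obtain ⟨A, hA⟩ := ((tendsto_re_div_atTop hF hd).eventually_ge_atTop (1 + (R + R₁))).exists_forall_of_atTop
  set B := max A 1 with hB
  have hB0 : 0 < B := lt_of_lt_of_le one_pos (le_max_right _ _)
  set C := Metric.closedBall (0 : ℂ) (R + 1) ∩
    {w | 1 ≤ Metric.infDist w (F '' rightHalfPlane)ᶜ} with hC
  have hCc : IsCompact C := (isCompact_closedBall _ _).inter_right
    (isClosed_le continuous_const (Metric.continuous_infDist_pt _))
  have hCs : C ⊆ F '' rightHalfPlane := by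
    intro w hw
    by_contra hcon
    have h1 : Metric.infDist w (F '' rightHalfPlane)ᶜ = 0 := Metric.infDist_zero_of_mem hcon
    have h2 : 1 ≤ Metric.infDist w (F '' rightHalfPlane)ᶜ := hw.2
    linarith
  have hgc : ContinuousOn g C := by
    intro w hw
    obtain ⟨ζ, hζ, rfl⟩ := hCs hw
    exact (hg' ζ hζ).continuousAt.continuousWithinAt
  obtain ⟨M₀, hM₀⟩ := hCc.exists_bound_of_continuousOn hgc
  -- The summand 16√(R₁ + 1) dominates the integral of 8/√(δ + τ) over 0 ≤ τ ≤ 1, as δ ≤ R₁.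
  refine ⟨Real.exp (Real.log (B + M₀) + 16 * Real.sqrt (R₁ + 1)), fun ζ hζ hζR => ?_⟩
  obtain ⟨k, hk, hproj⟩ := exists_nearest_point hopen.isClosed_compl hconv ⟨k₀, hk₀⟩ (F ζ)
  set n := F ζ - k with hn
  have hn0 : n ≠ 0 := fun h => hk ⟨ζ, hζ, sub_eq_zero.1 h⟩
  set δ := ‖n‖ with hδ
  have hδ0 : 0 < δ := norm_pos_iff.2 hn0
  have hδR : δ ≤ R₁ := by
    have h1 := hproj k₀ hk₀
    have h2 : ‖n‖ ^ 2 ≤ ((F ζ - k₀) * conj n).re := by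
      have e : (F ζ - k₀) * conj n = n * conj n - (k₀ - k) * conj n := by rw [hn]; ring
      rw [e, Complex.sub_re, Complex.mul_conj, Complex.normSq_eq_norm_sq, Complex.ofReal_re]
      linarith
    have h3 : ((F ζ - k₀) * conj n).re ≤ ‖F ζ - k₀‖ * ‖n‖ := by
      refine (Complex.re_le_norm _).trans (le_of_eq ?_)
      simp
    have h4 : ‖F ζ - k₀‖ ≤ R₁ := (norm_sub_le _ _).trans (by linarith)
    by_contra hcon
    push Not at hcon
    nlinarith
  have hkR : ‖k‖ ≤ R + R₁ := by
    have : k = F ζ - n := by rw [hn]; ring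
    rw [this]
    exact (norm_sub_le _ _).trans (by linarith)
  set p : ℝ → ℂ := fun τ => F ζ + τ * (n / δ) with hp
  have hpk : ∀ τ, p τ - k = (((δ + τ) / δ : ℝ) : ℂ) * n := by
    intro τ
    have : (δ : ℂ) ≠ 0 := by exact_mod_cast hδ0.ne'
    simp only [hp]
    push_cast
    rw [show F ζ = n + k by rw [hn]; ring]
    field_simp
    ring
  have hpkn : ∀ τ, 0 ≤ τ → ‖p τ - k‖ = δ + τ := by
    intro τ hτ
    rw [hpk, norm_mul, Complex.norm_real, Real.norm_of_nonneg (by positivity), ← hδ]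
    field_simp
  have hproj' : ∀ τ, 0 ≤ τ → ∀ k' ∉ F '' rightHalfPlane,
      ((k' - k) * conj (p τ - k)).re ≤ 0 := by
    intro τ hτ k' hk'
    rw [hpk, map_mul, Complex.conj_ofReal,
      show (k' - k) * ((((δ + τ) / δ : ℝ) : ℂ) * conj n) =
        (((δ + τ) / δ : ℝ) : ℂ) * ((k' - k) * conj n) by ring, Complex.re_ofReal_mul]
    exact mul_nonpos_of_nonneg_of_nonpos (by positivity) (hproj k' hk')
  have hdist : ∀ τ, 0 ≤ τ → ∀ k' ∉ F '' rightHalfPlane, δ + τ ≤ ‖p τ - k'‖ := by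
    intro τ hτ k' hk'
    have h1 := hproj' τ hτ k' hk'
    have h2 : ‖p τ - k‖ ^ 2 ≤ ((p τ - k') * conj (p τ - k)).re := by
      have e : (p τ - k') * conj (p τ - k) =
        (p τ - k) * conj (p τ - k) - (k' - k) * conj (p τ - k) := by ring
      rw [e, Complex.sub_re, Complex.mul_conj, Complex.normSq_eq_norm_sq, Complex.ofReal_re]
      linarith
    have h3 : ((p τ - k') * conj (p τ - k)).re ≤ ‖p τ - k'‖ * ‖p τ - k‖ := by
      refine (Complex.re_le_norm _).trans (le_of_eq ?_)
      rw [norm_mul, Complex.norm_conj]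
    rw [hpkn τ hτ] at h2 h3
    have h5 : 0 < δ + τ := by linarith
    by_contra hcon
    push Not at hcon
    nlinarith
  have hpm : ∀ τ, 0 ≤ τ → p τ ∈ F '' rightHalfPlane := by
    intro τ hτ
    by_contra hcon
    have := hdist τ hτ _ hcon
    rw [sub_self, norm_zero] at this
    linarith
  set η : ℝ → ℂ := fun τ => g (p τ) with hη
  have hη1 : ∀ τ, 0 ≤ τ → η τ ∈ rightHalfPlane ∧ F (η τ) = p τ := by
    intro τ hτ
    obtain ⟨ω, hω, hωe⟩ := hpm τ hτ
    have : η τ = ω := by simp only [hη]; rw [← hωe, hgf ω hω]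
    rw [this]
    exact ⟨hω, hωe⟩
  have hnδ : ‖n / (δ : ℂ)‖ = 1 := by
    rw [norm_div, Complex.norm_real, Real.norm_of_nonneg hδ0.le, ← hδ, div_self hδ0.ne']
  have hηd : ∀ τ, 0 ≤ τ → HasDerivAt η ((deriv F (η τ))⁻¹ * (n / δ)) τ := by
    intro τ hτ
    obtain ⟨h1, h2⟩ := hη1 τ hτ
    have h4 : HasDerivAt p (n / δ) τ := by
      show HasDerivAt (fun s : ℝ => F ζ + (s : ℂ) * (n / δ)) (n / δ) τ
      simpa using (((hasDerivAt_id τ).ofReal_comp).mul_const (n / (δ : ℂ))).const_add (F ζ)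
    exact HasDerivAt.comp_of_eq τ (hg' _ h1) h4 h2
  have hslit : ∀ τ, 0 ≤ τ → (B : ℂ) + η τ ∈ Complex.slitPlane := by
    intro τ hτ
    left
    have : 0 < (η τ).re := (hη1 τ hτ).1
    simp
    linarith
  have hℓd : ∀ τ, 0 ≤ τ → HasDerivAt (fun τ => Complex.log (B + η τ))
      ((deriv F (η τ))⁻¹ * (n / δ) / (B + η τ)) τ := fun τ hτ =>
    ((hηd τ hτ).const_add (B : ℂ)).clog_real (hslit τ hτ)
  have hbound : ∀ τ, 0 ≤ τ → ‖(deriv F (η τ))⁻¹ * (n / δ) / (B + η τ)‖ ≤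
      8 / Real.sqrt (δ + τ) := by
    intro τ hτ
    obtain ⟨h1, h2⟩ := hη1 τ hτ
    have hx : 0 < (η τ).re := h1
    have hs : 0 < δ + τ := by linarith
    have e1 := norm_sub_le_re_mul_norm_deriv hF hinj h1 hk (by rw [h2]; exact hproj' τ hτ)
    rw [h2, hpkn τ hτ] at e1
    have e2 := re_le_sqrt_norm_mul hF hd1
      (fun t ht => sub_notMem_image hF hinj hq hd hk ht) hB0 (fun a ha => by
        have h3 := hA a ((le_max_left _ _).trans ha)
        have h4 : (k / d).re ≤ R + R₁ := by
          refine (Complex.re_le_norm _).trans ?_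
          rw [norm_div, hd1, div_one]
          exact hkR
        rw [sub_div, Complex.sub_re]
        linarith) h1
    rw [h2, hpkn τ hτ] at e2
    have e3 : B + ‖η τ‖ ≤ 2 * ‖(B : ℂ) + η τ‖ := by
      have h5 : B ≤ ‖(B : ℂ) + η τ‖ := by
        refine le_trans ?_ (Complex.re_le_norm _)
        simp
        linarith
      have h6 : ‖η τ‖ ≤ ‖(B : ℂ) + η τ‖ := by
        apply (sq_le_sq₀ (norm_nonneg _) (norm_nonneg _)).1
        rw [Complex.sq_norm, Complex.sq_norm, Complex.normSq_apply, Complex.normSq_apply]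
        simp
        nlinarith
      linarith
    have hF0 := norm_pos_iff.2 (hne _ h1)
    have hBn : 0 < ‖(B : ℂ) + η τ‖ := by linarith [norm_nonneg (η τ)]
    have hsq := Real.mul_self_sqrt hs.le
    have hsq0 := Real.sqrt_pos.2 hs
    rw [norm_div, norm_mul, norm_inv, hnδ, mul_one, div_le_div_iff₀ hBn hsq0,
      inv_mul_le_iff₀ hF0]
    set S := Real.sqrt (δ + τ)
    have e4 : S * S ≤ (8 * ‖(B : ℂ) + η τ‖ * S) * ‖deriv F (η τ)‖ := by
      rw [hsq]
      refine e1.trans (mul_le_mul_of_nonneg_right (e2.trans ?_) hF0.le)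
      apply mul_le_mul_of_nonneg_right _ hsq0.le
      linarith
    have e5 : S * S ≤ S * (‖deriv F (η τ)‖ * (8 * ‖(B : ℂ) + η τ‖)) := by linarith
    exact le_of_mul_le_mul_left e5 hsq0
  have hmvt := image_norm_le_of_norm_deriv_right_le_deriv_boundary' (a := 0) (b := 1)
    (f := fun τ => Complex.log (B + η τ) - Complex.log (B + η 0))
    (B := fun τ => 16 * Real.sqrt (δ + τ) - 16 * Real.sqrt δ)
    (f' := fun τ => (deriv F (η τ))⁻¹ * (n / δ) / (B + η τ))
    (B' := fun τ => 8 / Real.sqrt (δ + τ))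
    (fun τ hτ => ((hℓd τ hτ.1).sub_const _).continuousAt.continuousWithinAt)
    (fun τ hτ => ((hℓd τ hτ.1).sub_const _).hasDerivWithinAt)
    (by simp) (by fun_prop)
    (fun τ hτ => by
      have hs : 0 < δ + τ := by linarith [hτ.1]
      have h1 := ((((hasDerivAt_id τ).const_add δ).sqrt hs.ne').const_mul 16).sub_const
        (16 * Real.sqrt δ)
      refine (h1.congr_deriv ?_).hasDerivWithinAt
      simp only [id]
      have := (Real.sqrt_pos.2 hs).ne'
      field_simp
      norm_num)
    (fun τ hτ => hbound τ hτ.1) (Set.right_mem_Icc.2 zero_le_one)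
  have hη0 : η 0 = ζ := by simp [hη, hp, hgf ζ hζ]
  have hηM : ‖η 1‖ ≤ M₀ := by
    apply hM₀
    refine ⟨?_, ?_⟩
    · rw [mem_closedBall_zero_iff]
      refine (norm_add_le _ _).trans ?_
      simp only [Complex.ofReal_one, one_mul, hnδ]
      linarith
    · show 1 ≤ Metric.infDist (p 1) _
      rw [Metric.le_infDist ⟨k₀, hk₀⟩]
      intro k' hk'
      have := hdist 1 zero_le_one k' hk'
      rw [dist_eq_norm]
      linarith
  simp only [hη0] at hmvt
  have hre1 : ∀ w : ℂ, (Complex.log w).re = Real.log ‖w‖ := Complex.log_re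
  have h1 : Real.log ‖(B : ℂ) + ζ‖ - Real.log ‖(B : ℂ) + η 1‖ ≤
      16 * Real.sqrt (δ + 1) - 16 * Real.sqrt δ := by
    rw [← hre1, ← hre1, ← Complex.sub_re]
    refine (Complex.re_le_norm _).trans ?_
    rw [norm_sub_rev]
    exact hmvt
  have hηp : 0 < ‖(B : ℂ) + η 1‖ := norm_pos_iff.2 (Complex.slitPlane_ne_zero (hslit 1 zero_le_one))
  have h2 : Real.log ‖(B : ℂ) + η 1‖ ≤ Real.log (B + M₀) := by
    apply Real.log_le_log hηp
    refine (norm_add_le _ _).trans ?_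
    rw [Complex.norm_real, Real.norm_of_nonneg hB0.le]
    linarith
  have h3 : Real.sqrt (δ + 1) ≤ Real.sqrt (R₁ + 1) := Real.sqrt_le_sqrt (by linarith)
  have hζp : 0 < ‖(B : ℂ) + ζ‖ := by
    have := hslit 0 le_rfl
    rw [hη0] at this
    exact norm_pos_iff.2 (Complex.slitPlane_ne_zero this)
  have h4 : ‖ζ‖ ≤ ‖(B : ℂ) + ζ‖ := by
    have hx : 0 < ζ.re := hζ
    apply (sq_le_sq₀ (norm_nonneg _) (norm_nonneg _)).1
    rw [Complex.sq_norm, Complex.sq_norm, Complex.normSq_apply, Complex.normSq_apply]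
    simp
    nlinarith
  refine h4.trans ?_
  rw [← Real.log_le_iff_le_exp hζp]
  have := Real.sqrt_nonneg δ
  linarith

/-! ### From the inequality to Re q ≥ 0 and the oscillation of arg F' -/

/-- P = ζ - (ζ² - 1)G maps the half-plane into itself and fixes 1. Schwarz–Pick between ζ and 1,
solved for G, is the claim off ζ = 1; continuity supplies that point. -/
theorem re_nonneg_of_re_sub_pos {G : ℂ → ℂ} (hG : DifferentiableOn ℂ G rightHalfPlane)
    (hP : ∀ ζ ∈ rightHalfPlane, 0 < (ζ - (ζ ^ 2 - 1) * G ζ).re) {ζ : ℂ}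
    (hζ : ζ ∈ rightHalfPlane) : 0 ≤ (G ζ).re := by
  have hPd : DifferentiableOn ℂ (fun ζ => ζ - (ζ ^ 2 - 1) * G ζ) rightHalfPlane := by
    have : DifferentiableOn ℂ (fun ζ : ℂ => ζ ^ 2 - 1) rightHalfPlane := by fun_prop
    exact differentiableOn_id.sub (this.mul hG)
  have key : ∀ ζ ∈ rightHalfPlane, ζ ≠ 1 → 0 ≤ (G ζ).re := by
    intro ζ hζ h1
    have hx : 0 < ζ.re := hζ
    have h := schwarz_pick_half_sq hPd (fun ζ hζ => (hP ζ hζ).le) hζ one_mem_rightHalfPlane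
    have hp := hP ζ hζ
    set P := ζ - (ζ ^ 2 - 1) * G ζ with hPdef
    have hsq : ζ ^ 2 - 1 ≠ 0 := by
      rw [show ζ ^ 2 - 1 = (ζ - 1) * (ζ + 1) by ring]
      exact mul_ne_zero (sub_ne_zero.2 h1) (add_one_ne_zero_of_mem hζ)
    have hGe : G ζ = (ζ - P) / (ζ ^ 2 - 1) := by
      rw [eq_div_iff hsq, hPdef]; ring
    simp only [one_pow, sub_self, zero_mul, sub_zero, map_one, Complex.one_re, mul_one] at h
    rw [Complex.sq_norm, Complex.sq_norm, Complex.normSq_apply, Complex.normSq_apply] at h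
    simp only [Complex.add_re, Complex.add_im, Complex.one_re, Complex.one_im, add_zero] at h
    rw [hGe, Complex.div_re, ← add_div]
    apply div_nonneg _ (Complex.normSq_nonneg _)
    simp only [pow_two, Complex.sub_re, Complex.sub_im, Complex.mul_re, Complex.mul_im,
      Complex.one_re, Complex.one_im]
    nlinarith [mul_nonneg hx.le (sq_nonneg (ζ.re - P.re)),
      mul_nonneg hx.le (sq_nonneg (ζ.im - P.im))]
  by_cases h1 : ζ = 1
  · have hc : Tendsto (fun ω => (G ω).re) (𝓝[≠] ζ) (𝓝 (G ζ).re) :=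
      ((Complex.continuous_re.tendsto _).comp
        (hG.differentiableAt (isOpen_rightHalfPlane.mem_nhds hζ)).continuousAt.tendsto).mono_left
        nhdsWithin_le_nhds
    apply ge_of_tendsto hc
    filter_upwards [self_mem_nhdsWithin,
      nhdsWithin_le_nhds (isOpen_rightHalfPlane.mem_nhds hζ)] with ω h2 h3
    apply key ω h3
    rw [← h1]
    exact h2
  · exact key ζ hζ h1

theorem arg_one_sub_exp {θ : ℝ} (h0 : 0 < θ) (h1 : θ < 2 * Real.pi) :
    (1 - Complex.exp (θ * Complex.I)).arg = (θ - Real.pi) / 2 := by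
  have hs : 0 < 2 * Real.sin (θ / 2) := by
    have := Real.sin_pos_of_pos_of_lt_pi (x := θ / 2) (by linarith) (by linarith)
    linarith
  have e : 1 - Complex.exp (θ * Complex.I) = ((2 * Real.sin (θ / 2) : ℝ) : ℂ) *
      (Complex.cos ((θ - Real.pi) / 2 : ℝ) + Complex.sin ((θ - Real.pi) / 2 : ℝ) * Complex.I) := by
    rw [Complex.exp_mul_I, ← Complex.ofReal_cos, ← Complex.ofReal_sin, ← Complex.ofReal_cos,
      ← Complex.ofReal_sin]
    have hc : Real.cos ((θ - Real.pi) / 2) = Real.sin (θ / 2) := by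
      rw [show (θ - Real.pi) / 2 = θ / 2 - Real.pi / 2 by ring, Real.cos_sub_pi_div_two]
    have hs : Real.sin ((θ - Real.pi) / 2) = -Real.cos (θ / 2) := by
      rw [show (θ - Real.pi) / 2 = θ / 2 - Real.pi / 2 by ring, Real.sin_sub_pi_div_two]
    rw [hc, hs]
    have h1 : Real.cos θ = 1 - 2 * Real.sin (θ / 2) ^ 2 := by
      have := Real.cos_sq_add_sin_sq (θ / 2)
      have h2 := Real.cos_two_mul (θ / 2)
      rw [show 2 * (θ / 2) = θ by ring] at h2
      linarith
    have h2 : Real.sin θ = 2 * Real.sin (θ / 2) * Real.cos (θ / 2) := by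
      rw [← Real.sin_two_mul]; congr 1; ring
    rw [h1, h2]
    push_cast
    ring
  rw [e, Complex.arg_mul_cos_add_sin_mul_I hs]
  constructor <;> linarith [Real.pi_pos]

theorem re_one_sub_mul_pos {ρ : ℝ} {z : ℂ} (h : ‖(ρ : ℂ) * z‖ < 1) :
    0 < (1 - ρ * z).re := by
  have := (Complex.re_le_norm ((ρ : ℂ) * z)).trans_lt h
  simp only [Complex.sub_re, Complex.one_re]
  linarith

/-- Comparison of the boundary argument of a function with `Re (z E') ≤ 1/2` to that of
`log (1 - z)`. -/
theorem exists_radius_abs_im_le {E E' : ℂ → ℂ} (hE : ∀ z ∈ unitDisk, HasDerivAt E (E' z) z)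
    (hre : ∀ z ∈ unitDisk, (z * E' z).re ≤ 1 / 2) {r : ℝ} (hr0 : 0 ≤ r) (hr1 : r < 1) {ε : ℝ}
    (hε : 0 < ε) :
    ∃ ρ₀ < 1, ∀ ρ : ℝ, ρ₀ < ρ → ρ < 1 → ∀ θ : ℝ, 0 ≤ θ → θ < 2 * Real.pi →
      |(E (r * Complex.exp (θ * Complex.I))).im -
        (1 - ρ * Complex.exp (θ * Complex.I)).arg - (E r).im| ≤ Real.pi / 2 + ε := by
  have hπ := Real.pi_pos
  have hmem : ∀ θ : ℝ, (r : ℂ) * Complex.exp (θ * Complex.I) ∈ unitDisk := by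
    intro θ
    rw [mem_unitDisk, norm_mul, Complex.norm_exp_ofReal_mul_I, Complex.norm_real,
      Real.norm_of_nonneg hr0, mul_one]
    exact hr1
  set a : ℝ → ℝ := fun θ => (E (r * Complex.exp (θ * Complex.I))).im with ha
  have had : ∀ θ : ℝ, HasDerivAt a
      ((r * Complex.exp (θ * Complex.I)) * E' (r * Complex.exp (θ * Complex.I))).re θ := by
    intro θ
    have h1 : HasDerivAt (fun θ : ℝ => (r : ℂ) * Complex.exp (θ * Complex.I))
        (r * (Complex.exp (θ * Complex.I) * Complex.I)) θ := by
      simpa using ((((hasDerivAt_id θ).ofReal_comp).mul_const Complex.I).cexp).const_mul (r : ℂ)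
    have h2 := (hE _ (hmem θ)).comp θ h1
    have h3 := Complex.imCLM.hasFDerivAt.comp_hasDerivAt θ h2
    refine HasDerivAt.congr_deriv (f := a) h3 ?_
    simp only [Complex.imCLM_apply]
    rw [show E' (r * Complex.exp (θ * Complex.I)) * (r * (Complex.exp (θ * Complex.I) * Complex.I)) =
      (r * Complex.exp (θ * Complex.I) * E' (r * Complex.exp (θ * Complex.I))) * Complex.I by ring]
    simp only [Complex.mul_im, Complex.I_re, Complex.I_im]
    ring
  -- Together with the periodicity of a, this confines a θ - θ/2 to [a 0 - π, a 0] over one turn,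
  -- while arg(1 - e^{iθ}) = (θ - π)/2; the difference is then within π/2 of a 0.
  have hanti : Antitone fun θ => a θ - θ / 2 := by
    have hd : ∀ θ : ℝ, HasDerivAt (fun θ => a θ - θ / 2)
        (((r * Complex.exp (θ * Complex.I)) * E' (r * Complex.exp (θ * Complex.I))).re - 1 / 2) θ :=
      fun θ => (had θ).sub ((hasDerivAt_id θ).div_const 2)
    apply antitone_of_deriv_nonpos (fun θ => (hd θ).differentiableAt)
    intro θ
    rw [(hd θ).deriv]
    linarith [hre _ (hmem θ)]
  have hper : ∀ θ : ℝ, a (θ - 2 * Real.pi) = a θ := by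
    intro θ
    simp only [ha]
    congr 3
    push_cast
    rw [sub_mul, Complex.exp_sub, Complex.exp_two_pi_mul_I, div_one]
  have ha0 : a 0 = (E r).im := by simp [ha]
  obtain ⟨η', hη'0, hη'⟩ := Metric.continuousAt_iff.1 (had 0).continuousAt ε hε
  set η := min η' 1 with hη
  have hη0 : 0 < η := lt_min hη'0 one_pos
  set Q : Set (ℝ × ℝ) := Set.Icc 0 1 ×ˢ Set.Icc η (2 * Real.pi - η) with hQ
  have hQc : IsCompact Q := isCompact_Icc.prod isCompact_Icc
  have hcont : ContinuousOn (fun x : ℝ × ℝ =>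
      (1 - (x.1 : ℂ) * Complex.exp (x.2 * Complex.I)).arg) Q := by
    intro x hx
    apply ContinuousAt.continuousWithinAt
    have hre0 : 0 < (1 - (x.1 : ℂ) * Complex.exp (x.2 * Complex.I)).re := by
      have hcos : Real.cos x.2 < 1 := by
        apply lt_of_le_of_ne (Real.cos_le_one _)
        intro h
        have := (Real.cos_eq_one_iff_of_lt_of_lt (x := x.2) (by linarith [hx.2.1])
          (by linarith [hx.2.2])).1 h
        linarith [hx.2.1]
      rw [Complex.sub_re, Complex.re_ofReal_mul, Complex.exp_ofReal_mul_I_re, Complex.one_re]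
      rcases le_or_gt (Real.cos x.2) 0 with h | h
      · nlinarith [hx.1.1]
      · nlinarith [hx.1.2]
    have h1 : ContinuousAt (fun x : ℝ × ℝ => 1 - (x.1 : ℂ) * Complex.exp (x.2 * Complex.I)) x := by
      fun_prop
    exact ContinuousAt.comp (f := fun x : ℝ × ℝ => 1 - (x.1 : ℂ) * Complex.exp (x.2 * Complex.I))
      (Complex.continuousAt_arg (Or.inl hre0)) h1
  obtain ⟨κ, hκ0, hκ⟩ := Metric.uniformContinuousOn_iff.1
    (hQc.uniformContinuousOn_of_continuous hcont) ε hε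
  refine ⟨max 0 (1 - κ), max_lt one_pos (by linarith), fun ρ hρ hρ1 θ hθ0 hθ1 => ?_⟩
  have hρ0 : 0 < ρ := (le_max_left _ _).trans_lt hρ
  have hρκ : 1 - κ < ρ := (le_max_right _ _).trans_lt hρ
  have harg : |(1 - (ρ : ℂ) * Complex.exp (θ * Complex.I)).arg| ≤ Real.pi / 2 := by
    rw [Complex.abs_arg_le_pi_div_two_iff]
    apply le_of_lt
    apply re_one_sub_mul_pos
    rw [norm_mul, Complex.norm_exp_ofReal_mul_I, Complex.norm_real, Real.norm_of_nonneg hρ0.le,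
      mul_one]
    exact hρ1
  have harg' := abs_le.1 harg
  rw [← ha0, show (E (r * Complex.exp (θ * Complex.I))).im = a θ from rfl]
  have hnear : ∀ θ' : ℝ, |θ'| < η → |a θ' - a 0| < ε := by
    intro θ' h
    have := hη' (x := θ') (by simpa using h.trans_le (min_le_left _ _))
    rwa [Real.dist_eq] at this
  -- Near θ = 0 and θ = 2π the argument of 1 - ρe^{iθ} is not uniformly close to its boundary value,
  -- but it is at most π/2 in modulus and a is close to a 0. In between, uniform continuity applies.
  rcases lt_or_ge θ η with h1 | h1
  · have := abs_lt.1 (hnear θ (by rwa [abs_of_nonneg hθ0]))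
    rw [abs_le]
    constructor <;> linarith
  rcases lt_or_ge (2 * Real.pi - η) θ with h2 | h2
  · have := abs_lt.1 (hnear (θ - 2 * Real.pi) (by rw [abs_of_neg (by linarith)]; linarith))
    rw [hper] at this
    rw [abs_le]
    constructor <;> linarith
  · have h3 := hκ (ρ, θ) ⟨⟨hρ0.le, hρ1.le⟩, h1, h2⟩ (1, θ) ⟨⟨zero_le_one, le_rfl⟩, h1, h2⟩ (by
      rw [Prod.dist_eq]
      simp only [dist_self, Real.dist_eq]
      rw [max_eq_left (abs_nonneg _), abs_lt]
      constructor <;> linarith)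
    simp only [Complex.ofReal_one, one_mul] at h3
    rw [arg_one_sub_exp (by linarith) (by linarith), Real.dist_eq] at h3
    have h4 := abs_lt.1 h3
    have h5 : a θ - θ / 2 ≤ a 0 - 0 / 2 := hanti hθ0
    have h6 : a (2 * Real.pi) - (2 * Real.pi) / 2 ≤ a θ - θ / 2 := hanti hθ1.le
    have h7 := hper (2 * Real.pi)
    rw [sub_self] at h7
    rw [abs_le]
    constructor <;> linarith

/-- The maximum principle for exp(-iσ(Ψ - ic)), σ = ±1, whose modulus is exp(σ(Im Ψ - c)). -/
theorem abs_im_le_of_sphere {Ψ : ℂ → ℂ} (hΨ : DifferentiableOn ℂ Ψ (Metric.closedBall 0 1))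
    {c M : ℝ} (h : ∀ z : ℂ, ‖z‖ = 1 → |(Ψ z).im - c| ≤ M) {z : ℂ} (hz : ‖z‖ ≤ 1) :
    |(Ψ z).im - c| ≤ M := by
  have key : ∀ σ : ℝ, (∀ z : ℂ, ‖z‖ = 1 → σ * ((Ψ z).im - c) ≤ M) →
      σ * ((Ψ z).im - c) ≤ M := by
    intro σ hσ
    have hn : ∀ z, ‖Complex.exp (-(σ * Complex.I) * (Ψ z - c * Complex.I))‖ =
        Real.exp (σ * ((Ψ z).im - c)) := by
      intro z
      rw [Complex.norm_exp]
      congr 1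
      simp
    have h1 := Complex.norm_le_of_forall_mem_frontier_norm_le (U := Metric.ball (0 : ℂ) 1)
      (f := fun z => Complex.exp (-(σ * Complex.I) * (Ψ z - c * Complex.I))) (C := Real.exp M)
      (z := z)
      Metric.isBounded_ball
      (by
        apply DifferentiableOn.diffContOnCl
        rw [closure_ball _ one_ne_zero]
        exact ((hΨ.sub_const _).const_mul _).cexp)
      (by
        intro w hw
        rw [frontier_ball _ one_ne_zero, mem_sphere_zero_iff_norm] at hw
        rw [hn]
        exact Real.exp_le_exp.2 (hσ w hw))
      (by rw [closure_ball _ one_ne_zero]; simpa using hz)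
    rw [hn] at h1
    exact Real.exp_le_exp.1 h1
  rw [abs_le]
  constructor
  · have := key (-1) (fun z hz => by linarith [(abs_le.1 (h z hz)).1])
    linarith
  · have := key 1 (fun z hz => by linarith [(abs_le.1 (h z hz)).2])
    linarith

/-- E and log(1 - z) are dilated with separate radii r and ρ, so that both are holomorphic on the
closed disk. First ρ → 1 with r fixed, which makes the boundary comparison exact, then r → 1. -/
theorem im_sub_log_sub_le_pi {E E' : ℂ → ℂ} (hE : ∀ z ∈ unitDisk, HasDerivAt E (E' z) z)
    (hre : ∀ z ∈ unitDisk, (z * E' z).re ≤ 1 / 2) {z₁ z₂ : ℂ} (h₁ : z₁ ∈ unitDisk)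
    (h₂ : z₂ ∈ unitDisk) :
    (E z₂ - Complex.log (1 - z₂)).im - (E z₁ - Complex.log (1 - z₁)).im ≤ Real.pi := by
  have hπ := Real.pi_pos
  have key : ∀ r : ℝ, 0 ≤ r → r < 1 → ∀ z ∈ unitDisk,
      |(E (r * z)).im - (1 - z).arg - (E r).im| ≤ Real.pi / 2 := by
    intro r hr0 hr1 z hz
    apply le_of_forall_pos_le_add
    intro ε hε
    obtain ⟨ρ₀, hρ₀, hρ⟩ := exists_radius_abs_im_le hE hre hr0 hr1 hε
    have hz1 := mem_unitDisk.1 hz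
    have h1 : ∀ᶠ ρ : ℝ in 𝓝[<] 1,
        |(E (r * z)).im - (1 - ρ * z).arg - (E r).im| ≤ Real.pi / 2 + ε := by
      filter_upwards [Ioo_mem_nhdsLT (max_lt hρ₀ one_pos)] with ρ hρm
      have hρ0 : 0 < ρ := (le_max_right _ _).trans_lt hρm.1
      have hρn : ∀ z : ℂ, ‖z‖ ≤ 1 → 0 < (1 - (ρ : ℂ) * z).re := by
        intro z hz
        apply re_one_sub_mul_pos
        rw [norm_mul, Complex.norm_real, Real.norm_of_nonneg hρ0.le]
        nlinarith [hρm.2]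
      have hΨ : DifferentiableOn ℂ (fun z => E (r * z) - Complex.log (1 - ρ * z))
          (Metric.closedBall 0 1) := by
        apply DifferentiableOn.sub
        · intro z hz
          have hz : ‖z‖ ≤ 1 := by simpa using hz
          have hrz : (r : ℂ) * z ∈ unitDisk := by
            rw [mem_unitDisk, norm_mul, Complex.norm_real, Real.norm_of_nonneg hr0]
            nlinarith
          exact ((hE _ hrz).comp z ((hasDerivAt_id z).const_mul (r : ℂ))).differentiableAt.differentiableWithinAt
        · apply DifferentiableOn.clog (by fun_prop)
          intro z hz
          exact Or.inl (hρn z (by simpa using hz))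
      have h2 := abs_im_le_of_sphere hΨ (c := (E r).im) (M := Real.pi / 2 + ε) (fun w hw => by
        obtain ⟨θ, hθ0, hθ1, hθ⟩ : ∃ θ : ℝ, 0 ≤ θ ∧ θ < 2 * Real.pi ∧
            w = Complex.exp (θ * Complex.I) := by
          have e := Complex.norm_mul_exp_arg_mul_I w
          rw [hw, Complex.ofReal_one, one_mul] at e
          rcases le_or_gt 0 w.arg with h | h
          · exact ⟨w.arg, h, by linarith [Complex.arg_le_pi w], e.symm⟩
          · refine ⟨w.arg + 2 * Real.pi, by linarith [Complex.neg_pi_lt_arg w], by linarith, ?_⟩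
            push_cast
            rw [add_mul, Complex.exp_add, Complex.exp_two_pi_mul_I, mul_one, e]
        have := hρ ρ ((le_max_left _ _).trans_lt hρm.1) hρm.2 θ hθ0 hθ1
        rw [← hθ] at this
        rw [Complex.sub_im, Complex.log_im]
        exact this) hz1.le
      rw [Complex.sub_im, Complex.log_im] at h2
      exact h2
    have h3 : Tendsto (fun ρ : ℝ => |(E (r * z)).im - (1 - ρ * z).arg - (E r).im|) (𝓝[<] 1)
        (𝓝 |(E (r * z)).im - (1 - (1 : ℝ) * z).arg - (E r).im|) := by
      apply tendsto_nhdsWithin_of_tendsto_nhds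
      apply ContinuousAt.tendsto (f := fun ρ : ℝ =>
        |(E (r * z)).im - (1 - ρ * z).arg - (E r).im|)
      have h4 : ContinuousAt (fun ρ : ℝ => (1 : ℂ) - ρ * z) 1 := by fun_prop
      have h5 : ContinuousAt (fun ρ : ℝ => ((1 : ℂ) - ρ * z).arg) 1 :=
        ContinuousAt.comp (f := fun ρ : ℝ => (1 : ℂ) - ρ * z)
          (Complex.continuousAt_arg (Or.inl (re_one_sub_mul_pos (by simpa using hz1)))) h4
      exact ((continuousAt_const.sub h5).sub continuousAt_const).abs
    have := le_of_tendsto h3 h1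
    simpa using this
  have hlim : ∀ z ∈ unitDisk, Tendsto (fun r : ℝ => (E (r * z)).im) (𝓝[<] 1) (𝓝 (E z).im) := by
    intro z hz
    apply tendsto_nhdsWithin_of_tendsto_nhds
    have h1 : ContinuousAt (fun r : ℝ => (r : ℂ) * z) 1 := by fun_prop
    have h2 : ContinuousAt E (((1 : ℝ) : ℂ) * z) := by
      simpa using (hE z hz).continuousAt
    have h3 := (Complex.continuous_im.continuousAt.comp
      (ContinuousAt.comp (f := fun r : ℝ => (r : ℂ) * z) h2 h1)).tendsto
    simpa [Function.comp_def] using h3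
  have h1 : Tendsto (fun r : ℝ => ((E (r * z₂)).im - (1 - z₂).arg) - ((E (r * z₁)).im - (1 - z₁).arg))
      (𝓝[<] 1) (𝓝 (((E z₂).im - (1 - z₂).arg) - ((E z₁).im - (1 - z₁).arg))) :=
    ((hlim z₂ h₂).sub_const _).sub ((hlim z₁ h₁).sub_const _)
  rw [Complex.sub_im, Complex.sub_im, Complex.log_im, Complex.log_im]
  apply le_of_tendsto h1
  filter_upwards [Ioo_mem_nhdsLT one_pos] with r hr
  have e1 := abs_le.1 (key r hr.1.le hr.2 z₁ h₁)
  have e2 := abs_le.1 (key r hr.1.le hr.2 z₂ h₂)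
  linarith

/-! ### Opening angle from the oscillation of arg F' -/

/-- X is closer than β to π modulo 2π, so X - Y is closer than π/2 to it. -/
theorem cos_sub_neg_of_cos_lt {X Y β : ℝ} (hβ0 : 0 ≤ β) (hβ1 : β ≤ Real.pi / 2)
    (hX : Real.cos X < -Real.cos β) (hY : |Y| ≤ Real.pi / 2 - β) : Real.cos (X - Y) < 0 := by
  have hπ := Real.pi_pos
  have hcb : 0 ≤ Real.cos β := Real.cos_nonneg_of_mem_Icc ⟨by linarith, hβ1⟩
  have hβ : 0 < β := by
    rcases hβ0.eq_or_lt with h | h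
    · rw [← h, Real.cos_zero] at hX
      linarith [Real.neg_one_le_cos X]
    · exact h
  have hsb : 0 < Real.sin β := Real.sin_pos_of_pos_of_lt_pi hβ (by linarith)
  have hcY : Real.sin β ≤ Real.cos Y := by
    rw [← Real.cos_pi_div_two_sub, ← Real.cos_abs Y]
    exact Real.cos_le_cos_of_nonneg_of_le_pi (abs_nonneg _) (by linarith) hY
  have hsY : |Real.sin Y| ≤ Real.cos β := by
    apply abs_le_of_sq_le_sq _ hcb
    nlinarith [Real.sin_sq_add_cos_sq Y, Real.sin_sq_add_cos_sq β]
  have hsX : |Real.sin X| ≤ Real.sin β := by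
    apply abs_le_of_sq_le_sq _ hsb.le
    nlinarith [Real.sin_sq_add_cos_sq X, Real.sin_sq_add_cos_sq β]
  rw [Real.cos_sub]
  have h1 : Real.sin X * Real.sin Y ≤ Real.sin β * Real.cos β := by
    calc _ ≤ |Real.sin X * Real.sin Y| := le_abs_self _
      _ = |Real.sin X| * |Real.sin Y| := abs_mul _ _
      _ ≤ _ := by gcongr
  have h2 : Real.cos X * Real.cos Y < -Real.cos β * Real.cos Y :=
    mul_lt_mul_of_pos_right hX (by linarith)
  nlinarith

theorem volume_le_cos_inter_le {c β : ℝ} (hβ1 : β ≤ Real.pi) :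
    volume.real ({θ : ℝ | -Real.cos β ≤ Real.cos (θ - c)} ∩ Set.Ioc (-Real.pi) Real.pi) ≤
      2 * (Real.pi - β) := by
  have hπ := Real.pi_pos
  set S := {θ : ℝ | -Real.cos β ≤ Real.cos (θ - c)} with hS
  have hSm : MeasurableSet S := by
    apply IsClosed.measurableSet
    exact isClosed_le continuous_const (by fun_prop)
  have hper : volume (S ∩ Set.Ioc (-Real.pi) (-Real.pi + 2 * Real.pi)) =
      volume (S ∩ Set.Ioc (c - Real.pi) (c - Real.pi + 2 * Real.pi)) := by
    apply (isAddFundamentalDomain_Ioc Real.two_pi_pos (-Real.pi) volume).measure_set_eq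
      (isAddFundamentalDomain_Ioc Real.two_pi_pos (c - Real.pi) volume) hSm
    rintro ⟨g, hg⟩
    obtain ⟨n, rfl⟩ := AddSubgroup.mem_zmultiples_iff.1 hg
    ext θ
    have e : ∀ ψ, Real.cos (n * (2 * Real.pi) + θ - ψ) = Real.cos (θ - ψ) := by
      intro ψ
      rw [show (n : ℝ) * (2 * Real.pi) + θ - ψ = (θ - ψ) + n * (2 * Real.pi) by ring,
        Real.cos_add_int_mul_two_pi]
    simp [hS, AddSubgroup.vadd_def, e]
  rw [show -Real.pi + 2 * Real.pi = Real.pi by ring] at hper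
  rw [measureReal_def, hper]
  have hsub : S ∩ Set.Ioc (c - Real.pi) (c - Real.pi + 2 * Real.pi) ⊆
      Set.Icc (c - (Real.pi - β)) (c + (Real.pi - β)) := by
    rintro θ ⟨hc1, h3, h4⟩
    have h5 : |θ - c| ≤ Real.pi - β := by
      by_contra hcon
      push Not at hcon
      have h6 : |θ - c| ≤ Real.pi := abs_le.2 ⟨by linarith, by linarith⟩
      have h7 := Real.cos_lt_cos_of_nonneg_of_le_pi (by linarith) h6 hcon
      rw [Real.cos_abs, Real.cos_pi_sub] at h7
      have h8 : -Real.cos β ≤ Real.cos (θ - c) := hc1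
      linarith
    have := abs_le.1 h5
    constructor <;> linarith
  have h2 : volume (S ∩ Set.Ioc (c - Real.pi) (c - Real.pi + 2 * Real.pi)) ≤
      ENNReal.ofReal (2 * (Real.pi - β)) := by
    refine (measure_mono hsub).trans ?_
    rw [Real.volume_Icc]
    apply ENNReal.ofReal_le_ofReal
    linarith
  exact ENNReal.toReal_le_of_le_ofReal (by linarith) h2

/-- If e^{iθ} is uniformly more than π/2 away from all values of arg F', then for an omitted v and
large t the vector v - te^{iθ} is an admissible direction d, and v - d = te^{iθ} is omitted. The
remaining θ form an arc of length 2(π - β) = πα. -/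
theorem openingAngle_le {F L : ℂ → ℂ} {α : ℝ} (hα₁ : 1 ≤ α) (hα₂ : α ≤ 2)
    (hF : DifferentiableOn ℂ F rightHalfPlane)
    (hinj : Set.InjOn F rightHalfPlane)
    (hq : ∀ ζ ∈ rightHalfPlane, 0 ≤ (deriv (deriv F) ζ / deriv F ζ).re)
    (hL : ∀ ζ ∈ rightHalfPlane, Complex.exp (L ζ) = deriv F ζ)
    (hosc : ∀ ζ₁ ∈ rightHalfPlane, ∀ ζ₂ ∈ rightHalfPlane,
      (L ζ₂).im - (L ζ₁).im ≤ (α - 1) * Real.pi) :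
    openingAngleAtInfinity (F '' rightHalfPlane) ≤ Real.pi * α := by
  have hπ := Real.pi_pos
  obtain ⟨c, hc⟩ := exists_center_of_oscillation hosc
  obtain ⟨v, hv⟩ := exists_notMem_image_half hF hinj
  set β := (2 - α) * Real.pi / 2 with hβ
  have hβ0 : 0 ≤ β := by rw [hβ]; apply div_nonneg (mul_nonneg _ _) <;> linarith
  have hβ1 : β ≤ Real.pi / 2 := by rw [hβ]; nlinarith
  have hsub : {θ : ℝ | θ ∈ Set.Ioc (-Real.pi) Real.pi ∧
      ∀ᶠ t : ℝ in atTop, (t : ℂ) * Complex.exp (θ * Complex.I) ∈ F '' rightHalfPlane} ⊆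
      {θ : ℝ | -Real.cos β ≤ Real.cos (θ - c)} ∩ Set.Ioc (-Real.pi) Real.pi := by
    rintro θ ⟨hθ, hev⟩
    refine ⟨?_, hθ⟩
    by_contra hcon
    have hcon : Real.cos (θ - c) < -Real.cos β := not_le.1 hcon
    have hneg : ∀ ψ ∈ Set.Icc (c - (Real.pi / 2 - β)) (c + (Real.pi / 2 - β)),
        Real.cos (θ - ψ) < 0 := by
      intro ψ hψ
      have := cos_sub_neg_of_cos_lt hβ0 hβ1 hcon (Y := ψ - c)
        (abs_le.2 ⟨by linarith [hψ.1], by linarith [hψ.2]⟩)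
      rwa [show θ - c - (ψ - c) = θ - ψ by ring] at this
    obtain ⟨ψ₀, hψ₀, hmax⟩ := (isCompact_Icc (a := c - (Real.pi / 2 - β))
      (b := c + (Real.pi / 2 - β))).exists_isMaxOn ⟨c, by linarith, by linarith⟩
      (f := fun ψ => Real.cos (θ - ψ)) (by fun_prop)
    set ε := -Real.cos (θ - ψ₀) with hε
    have hε0 : 0 < ε := by linarith [hneg ψ₀ hψ₀]
    have hlarge : ∀ᶠ t : ℝ in atTop, ‖v‖ / ε < t := eventually_gt_atTop _
    obtain ⟨t, ht1, ht2⟩ := (hev.and hlarge).exists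
    have hvt : ‖v‖ < t * ε := by rwa [div_lt_iff₀ hε0] at ht2
    have hd : ∀ ζ ∈ rightHalfPlane,
        0 < (deriv F ζ / (v - t * Complex.exp (θ * Complex.I))).re := by
      intro ζ hζ
      rw [re_div_pos_comm, sub_div, mul_div_assoc, Complex.sub_re, Complex.re_ofReal_mul,
        ← hL ζ hζ, re_exp_sub]
      have h1 : Real.cos (θ - (L ζ).im) ≤ -ε := by
        rw [hε, neg_neg]
        apply hmax
        have := abs_le.1 (hc ζ hζ)
        constructor <;> rw [hβ] <;> linarith
      have h2 : -(‖v‖ * Real.exp (-(L ζ).re)) ≤ (v / Complex.exp (L ζ)).re := by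
        have := (abs_le.1 (Complex.abs_re_le_norm (v / Complex.exp (L ζ)))).1
        rw [norm_div, Complex.norm_exp, div_eq_mul_inv, ← Real.exp_neg] at this
        exact this
      have h3 := Real.exp_pos (-(L ζ).re)
      have ht0 : 0 < t := lt_of_le_of_lt (by positivity) ht2
      have h4 : t * Real.cos (θ - (L ζ).im) ≤ t * -ε := mul_le_mul_of_nonneg_left h1 ht0.le
      nlinarith [mul_lt_mul_of_pos_right hvt h3, mul_le_mul_of_nonneg_right h4 h3.le]
    have := sub_notMem_image hF hinj hq hd hv zero_le_one
    apply this
    simpa using ht1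
  have hfin : volume ({θ : ℝ | -Real.cos β ≤ Real.cos (θ - c)} ∩ Set.Ioc (-Real.pi) Real.pi) ≠ ⊤ :=
    measure_ne_top_of_subset Set.inter_subset_right (by simp)
  refine (measureReal_mono hsub hfin).trans ((volume_le_cos_inter_le (by linarith)).trans ?_)
  rw [hβ]
  linarith

/-! ### Transfer between disk and half-plane -/

theorem hasDerivAt_comp_toDisk {f : ℂ → ℂ} (hf : DifferentiableOn ℂ f unitDisk) {ζ : ℂ}
    (hζ : ζ ∈ rightHalfPlane) :
    HasDerivAt (fun ζ => f (toDisk ζ)) (deriv f (toDisk ζ) * (2 / (ζ + 1) ^ 2)) ζ :=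
  ((hf.differentiableAt (isOpen_unitDisk.mem_nhds (toDisk_mem hζ))).hasDerivAt).comp ζ
    (hasDerivAt_toDisk hζ)

theorem deriv_deriv_comp_toDisk {f : ℂ → ℂ} (hf : DifferentiableOn ℂ f unitDisk) {ζ : ℂ}
    (hζ : ζ ∈ rightHalfPlane) :
    deriv (deriv fun ζ => f (toDisk ζ)) ζ =
      deriv (deriv f) (toDisk ζ) * (2 / (ζ + 1) ^ 2) ^ 2 -
        deriv f (toDisk ζ) * (4 / (ζ + 1) ^ 3) := by
  have h0 := add_one_ne_zero_of_mem hζ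
  have e : deriv (fun ζ => f (toDisk ζ)) =ᶠ[𝓝 ζ]
      fun ζ => deriv f (toDisk ζ) * (2 / (ζ + 1) ^ 2) := by
    filter_upwards [isOpen_rightHalfPlane.mem_nhds hζ] with w hw
    exact (hasDerivAt_comp_toDisk hf hw).deriv
  rw [e.deriv_eq]
  have h1 := hasDerivAt_comp_toDisk (hf.deriv isOpen_unitDisk) hζ
  have h2 : HasDerivAt (fun ζ : ℂ => 2 / (ζ + 1) ^ 2) (-4 / (ζ + 1) ^ 3) ζ := by
    refine ((hasDerivAt_const ζ (2 : ℂ)).div (((hasDerivAt_id ζ).add_const 1).fun_pow 2)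
      (pow_ne_zero 2 h0)).congr_deriv ?_
    simp only [id]
    field_simp
    ring
  rw [(h1.fun_mul h2).deriv]
  ring

theorem mul_logDeriv_eq_half {f : ℂ → ℂ} {α : ℝ} (hα : 1 < α)
    (hf : DifferentiableOn ℂ f unitDisk) {ζ : ℂ} (hζ : ζ ∈ rightHalfPlane)
    (hne : deriv f (toDisk ζ) ≠ 0) :
    toDisk ζ * (deriv (deriv f) (toDisk ζ) / deriv f (toDisk ζ) - (α + 1) / (1 - toDisk ζ)) =
      ((α - 1) / 2 : ℝ) * (1 - (ζ - (ζ ^ 2 - 1) * (deriv (deriv fun ζ => f (toDisk ζ)) ζ /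
        deriv (fun ζ => f (toDisk ζ)) ζ / (α - 1)))) := by
  have h0 := add_one_ne_zero_of_mem hζ
  have hα0 : (α : ℂ) - 1 ≠ 0 := by
    rw [← Complex.ofReal_one, ← Complex.ofReal_sub]
    exact Complex.ofReal_ne_zero.2 (by linarith)
  rw [deriv_deriv_comp_toDisk hf hζ, (hasDerivAt_comp_toDisk hf hζ).deriv, one_sub_toDisk hζ]
  generalize deriv (deriv f) (toDisk ζ) = A
  generalize deriv f (toDisk ζ) = B at *
  rw [toDisk]
  push_cast
  field_simp
  ring

theorem re_mul_logDeriv_lt_iff {f : ℂ → ℂ} {α : ℝ} (hα : 1 < α)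
    (hf : DifferentiableOn ℂ f unitDisk) {ζ : ℂ} (hζ : ζ ∈ rightHalfPlane)
    (hne : deriv f (toDisk ζ) ≠ 0) :
    (toDisk ζ * (deriv (deriv f) (toDisk ζ) / deriv f (toDisk ζ) -
        (α + 1) / (1 - toDisk ζ))).re < (α - 1) / 2 ↔
      0 < (ζ - (ζ ^ 2 - 1) * (deriv (deriv fun ζ => f (toDisk ζ)) ζ /
        deriv (fun ζ => f (toDisk ζ)) ζ / (α - 1))).re := by
  rw [mul_logDeriv_eq_half hα hf hζ hne, Complex.re_ofReal_mul, Complex.sub_re 1, Complex.one_re]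
  have : 0 < (α - 1) / 2 := by linarith
  constructor
  · intro h
    nlinarith
  · intro h
    nlinarith

theorem re_mul_logDeriv_lt_of_mem_Co {α : ℝ} (hα₁ : 1 < α) {f : ℂ → ℂ}
    (hf : f ∈ Co α) {z : ℂ} (hz : z ∈ unitDisk) :
    deriv f z ≠ 0 ∧
      (z * (deriv (deriv f) z / deriv f z - (α + 1) / (1 - z))).re < (α - 1) / 2 := by
  obtain ⟨⟨hd, -, -⟩, hlim, hinj, hconv, hang⟩ := hf
  have hne : ∀ z ∈ unitDisk, deriv f z ≠ 0 :=
    (exists_holomorphic_inverse isOpen_unitDisk hd hinj).2.1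
  refine ⟨hne z hz, ?_⟩
  set F : ℂ → ℂ := fun ζ => f (toDisk ζ) with hFdef
  have hF' : ∀ ζ ∈ rightHalfPlane, HasDerivAt F (deriv f (toDisk ζ) * (2 / (ζ + 1) ^ 2)) ζ :=
    fun ζ hζ => hasDerivAt_comp_toDisk hd hζ
  have hF : DifferentiableOn ℂ F rightHalfPlane :=
    fun ζ hζ => (hF' ζ hζ).differentiableAt.differentiableWithinAt
  have himg : F '' rightHalfPlane = f '' unitDisk := by
    rw [← toDisk_image, Set.image_image]
  have hFinj : Set.InjOn F rightHalfPlane :=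
    hinj.comp toDisk_injOn fun ζ hζ => toDisk_mem hζ
  have hFne : ∀ ζ ∈ rightHalfPlane, deriv F ζ ≠ 0 :=
    (exists_holomorphic_inverse isOpen_rightHalfPlane hF hFinj).2.1
  rw [← himg] at hconv hang
  have hB : ∀ v ∉ F '' rightHalfPlane, ∀ ζ ∈ rightHalfPlane, 0 ≤ ((F ζ - v) / deriv F ζ).re := by
    intro v hv ζ hζ
    rw [himg] at hconv hv
    have h := re_sub_div_deriv_nonneg hd hinj hconv hlim hv (toDisk_mem hζ)
    have h0 := add_one_ne_zero_of_mem hζ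
    have e : (F ζ - v) / deriv F ζ = ((2 : ℝ) : ℂ) * ((f (toDisk ζ) - v) /
        (deriv f (toDisk ζ) * (1 - toDisk ζ) ^ 2)) := by
      rw [(hF' ζ hζ).deriv, one_sub_toDisk hζ]
      have := hne _ (toDisk_mem hζ)
      push_cast
      field_simp
      rfl
    rw [e, Complex.re_ofReal_mul]
    linarith
  have hunb := not_isBounded_compl_image_half hF hFinj
  have hnonempty : (F '' rightHalfPlane)ᶜ.Nonempty := by
    by_contra h
    rw [Set.not_nonempty_iff_eq_empty] at h
    rw [h] at hunb
    exact hunb Bornology.isBounded_empty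
  have hq := fun ζ (hζ : ζ ∈ rightHalfPlane) =>
    re_deriv_deriv_div_nonneg hF hFinj hconv hnonempty hB hζ
  have hdF := hF.deriv isOpen_rightHalfPlane
  have hqd : DifferentiableOn ℂ (fun ζ => deriv (deriv F) ζ / deriv F ζ) rightHalfPlane :=
    (hdF.deriv isOpen_rightHalfPlane).div hdF hFne
  obtain ⟨L, hL⟩ := exists_log_half hdF hFne
  have hosc : ∀ ζ₁ ∈ rightHalfPlane, ∀ ζ₂ ∈ rightHalfPlane,
      (L ζ₂).im - (L ζ₁).im ≤ (α - 1) * Real.pi := fun ζ₁ h₁ ζ₂ h₂ =>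
    im_log_deriv_sub_le hunb hB hang
      (fun ζ hζ => (hL ζ hζ).1.continuousAt.continuousWithinAt)
      (fun ζ hζ => (hL ζ hζ).2) hα₁ h₁ h₂
  have hα0 : 0 < α - 1 := by linarith
  have hdecay := fun ζ (hζ : ζ ∈ rightHalfPlane) =>
    norm_logDeriv_mul_re_le hα0 (fun ζ hζ => (hL ζ hζ).1) hosc hζ
  have hζ := toHalf_mem hz
  have h1 := normSq_mul_re_le_of_decay hqd hq hdecay hζ
  rw [← toDisk_toHalf hz, re_mul_logDeriv_lt_iff hα₁ hd hζ (hne _ (toDisk_mem hζ))]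
  apply re_sub_mul_pos hζ
  have e : (α : ℂ) - 1 = ((α - 1 : ℝ) : ℂ) := by push_cast; rfl
  rw [e, Complex.div_ofReal_re, norm_div, Complex.norm_real, Real.norm_of_nonneg hα0.le, div_pow,
    div_mul_eq_mul_div, div_le_div_iff₀ (by positivity) hα0]
  calc _ ≤ (α - 1) * (deriv (deriv F) (toHalf z) / deriv F (toHalf z)).re * (α - 1) :=
        mul_le_mul_of_nonneg_right h1 hα0.le
    _ = _ := by ring

theorem mem_Co_of_re_mul_logDeriv_lt {α : ℝ} (hα₁ : 1 < α) (hα₂ : α ≤ 2) {f : ℂ → ℂ}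
    (hf : f ∈ classA) (hne : ∀ z ∈ unitDisk, deriv f z ≠ 0)
    (hlt : ∀ z ∈ unitDisk,
      (z * (deriv (deriv f) z / deriv f z - (α + 1) / (1 - z))).re < (α - 1) / 2) :
    f ∈ Co α := by
  have hd := hf.1
  have hπ := Real.pi_pos
  have hα0 : 0 < α - 1 := by linarith
  have e : (α : ℂ) - 1 = ((α - 1 : ℝ) : ℂ) := by push_cast; rfl
  set F : ℂ → ℂ := fun ζ => f (toDisk ζ) with hFdef
  have hF' : ∀ ζ ∈ rightHalfPlane, HasDerivAt F (deriv f (toDisk ζ) * (2 / (ζ + 1) ^ 2)) ζ :=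
    fun ζ hζ => hasDerivAt_comp_toDisk hd hζ
  have hF : DifferentiableOn ℂ F rightHalfPlane :=
    fun ζ hζ => (hF' ζ hζ).differentiableAt.differentiableWithinAt
  have himg : F '' rightHalfPlane = f '' unitDisk := by
    rw [← toDisk_image, Set.image_image]
  have hFne : ∀ ζ ∈ rightHalfPlane, deriv F ζ ≠ 0 := by
    intro ζ hζ
    rw [(hF' ζ hζ).deriv]
    exact mul_ne_zero (hne _ (toDisk_mem hζ))
      (div_ne_zero two_ne_zero (pow_ne_zero 2 (add_one_ne_zero_of_mem hζ)))
  have hdF := hF.deriv isOpen_rightHalfPlane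
  set q : ℂ → ℂ := fun ζ => deriv (deriv F) ζ / deriv F ζ with hqdef
  have hqd : DifferentiableOn ℂ q rightHalfPlane :=
    (hdF.deriv isOpen_rightHalfPlane).div hdF hFne
  have hP : ∀ ζ ∈ rightHalfPlane, 0 < (ζ - (ζ ^ 2 - 1) * (q ζ / (α - 1))).re := fun ζ hζ =>
    (re_mul_logDeriv_lt_iff hα₁ hd hζ (hne _ (toDisk_mem hζ))).1 (hlt _ (toDisk_mem hζ))
  have hq : ∀ ζ ∈ rightHalfPlane, 0 ≤ (deriv (deriv F) ζ / deriv F ζ).re := by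
    intro ζ hζ
    have h := re_nonneg_of_re_sub_pos (G := fun ζ => q ζ / (α - 1)) (hqd.div_const _) hP hζ
    simp only [e, Complex.div_ofReal_re] at h
    have h1 := mul_nonneg h hα0.le
    rwa [div_mul_cancel₀ _ hα0.ne'] at h1
  obtain ⟨L, hL⟩ := exists_log_half hdF hFne
  have hLd : ∀ ζ ∈ rightHalfPlane, Complex.exp (L ζ) = deriv F ζ := fun ζ hζ => (hL ζ hζ).2
  have hosc : ∀ ζ₁ ∈ rightHalfPlane, ∀ ζ₂ ∈ rightHalfPlane,
      (L ζ₂).im - (L ζ₁).im ≤ (α - 1) * Real.pi := by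
    -- Adding log(1 - z) to L/(α-1) produces an E for which Re(zE') ≤ 1/2 is exactly the weak form
    -- of the hypothesis; subtracting it again leaves the oscillation of L/(α-1), bounded by π.
    have hE : ∀ z ∈ unitDisk, HasDerivAt
        (fun z => L (toHalf z) / (α - 1) + Complex.log (1 - z))
        (q (toHalf z) * (2 / (1 - z) ^ 2) / (α - 1) + -1 / (1 - z)) z := by
      intro z hz
      have h1 := (((hL _ (toHalf_mem hz)).1.comp z (hasDerivAt_toHalf hz)).div_const (α - 1 : ℂ))
      refine h1.add ?_
      apply ((hasDerivAt_id z).const_sub 1).clog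
      left
      have := (Complex.re_le_norm z).trans_lt (mem_unitDisk.1 hz)
      simpa using this
    have hre : ∀ z ∈ unitDisk, (z * (q (toHalf z) * (2 / (1 - z) ^ 2) / (α - 1) +
        -1 / (1 - z))).re ≤ 1 / 2 := by
      intro z hz
      have hζ := toHalf_mem hz
      have e1 : z * (q (toHalf z) * (2 / (1 - z) ^ 2) / (α - 1) + -1 / (1 - z)) =
          ((1 / 2 : ℝ) : ℂ) * (1 - (toHalf z - (toHalf z ^ 2 - 1) * (q (toHalf z) / (α - 1)))) := by
        have h0 := one_sub_ne_zero_of_mem hz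
        have hα0' : (α : ℂ) - 1 ≠ 0 := by
          rw [e]
          exact Complex.ofReal_ne_zero.2 hα0.ne'
        generalize q (toHalf z) = A
        rw [toHalf]
        push_cast
        field_simp
        ring
      rw [e1, Complex.re_ofReal_mul, Complex.sub_re 1, Complex.one_re]
      linarith [hP _ hζ]
    intro ζ₁ h₁ ζ₂ h₂
    have h := im_sub_log_sub_le_pi hE hre (toDisk_mem h₁) (toDisk_mem h₂)
    simp only [add_sub_cancel_right, toHalf_toDisk h₁, toHalf_toDisk h₂, e,
      Complex.div_ofReal_im] at h
    rw [← sub_div, div_le_iff₀ hα0] at h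
    linarith
  have hosc' : ∀ ζ₁ ∈ rightHalfPlane, ∀ ζ₂ ∈ rightHalfPlane,
      (L ζ₂).im - (L ζ₁).im ≤ Real.pi := fun ζ₁ h₁ ζ₂ h₂ =>
    (hosc ζ₁ h₁ ζ₂ h₂).trans (by nlinarith)
  obtain ⟨d, hd1, hdp⟩ := exists_direction hF hLd hosc'
  have hFinj := injOn_of_re_deriv_div_pos isOpen_rightHalfPlane convex_rightHalfPlane hF hdp
  refine ⟨hf, ?_, ?_, ?_, ?_⟩
  · rw [← tendsto_norm_atTop_iff_cobounded, tendsto_atTop]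
    intro R
    obtain ⟨M, hM⟩ := exists_norm_le_of_norm_image_le hF hFinj hq hd1 hdp R
    -- Near 1 the Cayley image has modulus above M + 1, beyond the preimage of the ball of radius R.
    have hnear : ∀ᶠ z in 𝓝 (1 : ℂ), (M + 1) * ‖1 - z‖ < ‖1 + z‖ := by
      apply ContinuousAt.eventually_lt (by fun_prop) (by fun_prop)
      simp
    filter_upwards [self_mem_nhdsWithin, nhdsWithin_le_nhds hnear] with z hz hzn
    by_contra hcon
    have h1 := hM _ (toHalf_mem hz) (by
      rw [hFdef]
      simp only [toDisk_toHalf hz]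
      linarith)
    have h0 : 0 < ‖1 - z‖ := norm_pos_iff.2 (one_sub_ne_zero_of_mem hz)
    rw [toHalf, norm_div, div_le_iff₀ h0] at h1
    nlinarith
  · intro z₁ h₁ z₂ h₂ h
    have h3 := hFinj (toHalf_mem h₁) (toHalf_mem h₂) (by
      simp only [hFdef, toDisk_toHalf h₁, toDisk_toHalf h₂, h])
    rw [← toDisk_toHalf h₁, h3, toDisk_toHalf h₂]
  · rw [← himg]
    exact convex_compl_image hF hFinj hq
  · rw [← himg]
    exact openingAngle_le hα₁.le hα₂ hF hFinj hq hLd hosc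

/-! ### The attached function and the analytic criterion -/

theorem one_sub_mem_slitPlane {z : ℂ} (hz : z ∈ unitDisk) : 1 - z ∈ Complex.slitPlane := by
  left
  have := (Complex.re_le_norm z).trans_lt (mem_unitDisk.1 hz)
  simpa using this

theorem hasDerivAt_attached {f : ℂ → ℂ} (hf : DifferentiableOn ℂ f unitDisk) (α : ℝ) {z : ℂ}
    (hz : z ∈ unitDisk) :
    HasDerivAt (attached α f)
      ((1 - z) ^ ((α : ℂ) + 1) * (deriv (deriv f) z - (α + 1) / (1 - z) * deriv f z)) z := by
  have h0 := one_sub_ne_zero_of_mem hz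
  have h1 := (((hasDerivAt_id z).const_sub 1).cpow_const (c := (α : ℂ) + 1)
    (one_sub_mem_slitPlane hz))
  have h2 := ((hf.deriv isOpen_unitDisk).differentiableAt (isOpen_unitDisk.mem_nhds hz)).hasDerivAt
  refine (h1.fun_mul h2).congr_deriv ?_
  simp only [id]
  rw [add_sub_cancel_right, Complex.cpow_add _ _ h0, Complex.cpow_one]
  field_simp
  ring

theorem differentiableOn_attached {f : ℂ → ℂ} (hf : DifferentiableOn ℂ f unitDisk) (α : ℝ) :
    DifferentiableOn ℂ (attached α f) unitDisk :=
  fun _ hz => (hasDerivAt_attached hf α hz).differentiableAt.differentiableWithinAt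

theorem attached_zero {f : ℂ → ℂ} (hf : f ∈ classA) (α : ℝ) : attached α f 0 = 1 := by
  simp [attached, hf.2.2]

theorem attached_ne_zero_iff {f : ℂ → ℂ} (α : ℝ) {z : ℂ} (hz : z ∈ unitDisk) :
    attached α f z ≠ 0 ↔ deriv f z ≠ 0 := by
  have h : (1 - z) ^ ((α : ℂ) + 1) ≠ 0 := by
    rw [Complex.cpow_def_of_ne_zero (one_sub_ne_zero_of_mem hz)]
    exact Complex.exp_ne_zero _
  simp [attached, h]

theorem logDeriv_attached {f : ℂ → ℂ} (hf : DifferentiableOn ℂ f unitDisk) (α : ℝ) {z : ℂ}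
    (hz : z ∈ unitDisk) (hne : deriv f z ≠ 0) :
    deriv (attached α f) z / attached α f z =
      deriv (deriv f) z / deriv f z - (α + 1) / (1 - z) := by
  have h : (1 - z) ^ ((α : ℂ) + 1) ≠ 0 := by
    rw [Complex.cpow_def_of_ne_zero (one_sub_ne_zero_of_mem hz)]
    exact Complex.exp_ne_zero _
  have h0 := one_sub_ne_zero_of_mem hz
  rw [(hasDerivAt_attached hf α hz).deriv, attached, mul_div_mul_left _ _ h]
  field_simp

/-- Analytic characterisation of the class `Co α`. -/
theorem mem_Co_iff {α : ℝ} (hα₁ : 1 < α) (hα₂ : α ≤ 2) {f : ℂ → ℂ} (hf : f ∈ classA) :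
    f ∈ Co α ↔ ∀ z ∈ unitDisk, attached α f z ≠ 0 ∧
      (z * (deriv (attached α f) z / attached α f z)).re < (α - 1) / 2 := by
  constructor
  · intro h z hz
    obtain ⟨h1, h2⟩ := re_mul_logDeriv_lt_of_mem_Co hα₁ h hz
    exact ⟨(attached_ne_zero_iff α hz).2 h1, by rwa [logDeriv_attached hf.1 α hz h1]⟩
  · intro h
    have hne : ∀ z ∈ unitDisk, deriv f z ≠ 0 := fun z hz =>
      (attached_ne_zero_iff α hz).1 (h z hz).1
    refine mem_Co_of_re_mul_logDeriv_lt hα₁ hα₂ hf hne fun z hz => ?_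
    rw [← logDeriv_attached hf.1 α hz (hne z hz)]
    exact (h z hz).2

/-! ### Convolution with the kernel -/

/-- Based on z/(1-z)² = 1/(1-z)² - 1/(1-z), which accounts for the -1 in the second coefficient. -/
theorem iteratedDeriv_kernel (α : ℝ) (x : ℂ) (n : ℕ) : ∀ z ∈ unitDisk,
    iteratedDeriv n (kernel α x) z = (n + 1).factorial / (1 - z) ^ (n + 2) +
      ((1 - (α : ℂ)) / (x + 1) - 1) * (n.factorial / (1 - z) ^ (n + 1)) := by
  induction n with
  | zero =>
    intro z hz
    have h0 := one_sub_ne_zero_of_mem hz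
    simp only [iteratedDeriv_zero, kernel, Nat.factorial]
    generalize (1 - (α : ℂ)) / (x + 1) = c
    push_cast
    field_simp
    ring
  | succ n ih =>
    intro z hz
    have h0 := one_sub_ne_zero_of_mem hz
    have e : iteratedDeriv n (kernel α x) =ᶠ[𝓝 z] fun z => (n + 1).factorial / (1 - z) ^ (n + 2) +
        ((1 - (α : ℂ)) / (x + 1) - 1) * (n.factorial / (1 - z) ^ (n + 1)) := by
      filter_upwards [isOpen_unitDisk.mem_nhds hz] with w hw
      exact ih w hw
    have key : ∀ (a : ℂ) (m : ℕ), HasDerivAt (fun z : ℂ => a / (1 - z) ^ (m + 1))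
        ((m + 1) * a / (1 - z) ^ (m + 2)) z := by
      intro a m
      refine ((hasDerivAt_const z a).div (((hasDerivAt_id z).const_sub 1).fun_pow (m + 1))
        (pow_ne_zero _ h0)).congr_deriv ?_
      simp only [id, add_tsub_cancel_right]
      push_cast
      field_simp
      ring
    rw [iteratedDeriv_succ, e.deriv_eq,
      ((key _ (n + 1)).fun_add ((key _ n).const_mul _)).deriv]
    simp only [Nat.factorial]
    push_cast
    ring

theorem taylorCoeff_kernel (α : ℝ) (x : ℂ) (n : ℕ) :
    taylorCoeff (kernel α x) n = n + (1 - (α : ℂ)) / (x + 1) := by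
  rw [taylorCoeff, iteratedDeriv_kernel α x n 0 zero_mem_unitDisk, Nat.factorial_succ]
  have : (n.factorial : ℂ) ≠ 0 := Nat.cast_ne_zero.2 n.factorial_ne_zero
  push_cast
  field_simp
  ring

theorem hasSum_taylorCoeff {s : ℂ → ℂ} (hs : DifferentiableOn ℂ s unitDisk) {z : ℂ}
    (hz : z ∈ unitDisk) : HasSum (fun n => taylorCoeff s n * z ^ n) (s z) := by
  have e : (fun n => taylorCoeff s n * z ^ n) =
      fun n : ℕ => (n.factorial : ℂ)⁻¹ • (z - 0) ^ n • iteratedDeriv n s 0 := by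
    funext n
    simp only [taylorCoeff, smul_eq_mul, sub_zero]
    ring
  rw [e]
  exact Complex.hasSum_taylorSeries_on_ball hs hz

theorem taylorCoeff_deriv (s : ℂ → ℂ) (n : ℕ) :
    taylorCoeff (deriv s) n = (n + 1) * taylorCoeff s (n + 1) := by
  have h1 : (n.factorial : ℂ) ≠ 0 := Nat.cast_ne_zero.2 n.factorial_ne_zero
  have h2 : (n : ℂ) + 1 ≠ 0 := Nat.cast_add_one_ne_zero n
  rw [taylorCoeff, taylorCoeff, iteratedDeriv_succ', Nat.factorial_succ]
  push_cast
  field_simp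

theorem hadamard_kernel {s : ℂ → ℂ} (hs : DifferentiableOn ℂ s unitDisk) (α : ℝ) (x : ℂ) {z : ℂ}
    (hz : z ∈ unitDisk) :
    hadamard s (kernel α x) z = z * deriv s z + (1 - (α : ℂ)) / (x + 1) * s z := by
  have h1 := hasSum_taylorCoeff hs hz
  have h2 : HasSum (fun n : ℕ => (n : ℂ) * taylorCoeff s n * z ^ n) (z * deriv s z) := by
    rw [← hasSum_nat_add_iff' 1]
    have := (hasSum_taylorCoeff (hs.deriv isOpen_unitDisk) hz).mul_left z
    rw [Finset.sum_range_one, Nat.cast_zero, zero_mul, zero_mul, sub_zero]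
    have e : (fun n : ℕ => ((n + 1 : ℕ) : ℂ) * taylorCoeff s (n + 1) * z ^ (n + 1)) =
        fun n => z * (taylorCoeff (deriv s) n * z ^ n) := by
      funext n
      rw [taylorCoeff_deriv]
      push_cast
      ring
    rw [e]
    exact this
  rw [hadamard]
  apply HasSum.tsum_eq
  convert h2.add (h1.mul_left ((1 - (α : ℂ)) / (x + 1))) using 2 with n
  rw [taylorCoeff_kernel]
  ring

theorem re_inv_add_one {x : ℂ} (hx : ‖x‖ = 1) (hx1 : x ≠ -1) : ((x + 1)⁻¹).re = 1 / 2 := by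
  have h0 : x + 1 ≠ 0 := fun h => hx1 (eq_neg_of_add_eq_zero_left h)
  have h1 : Complex.normSq (x + 1) ≠ 0 := Complex.normSq_eq_zero.not.2 h0
  have h2 : Complex.normSq x = 1 := by rw [Complex.normSq_eq_norm_sq, hx, one_pow]
  rw [Complex.inv_re, div_eq_div_iff h1 two_ne_zero]
  rw [Complex.normSq_apply] at h2 ⊢
  simp only [Complex.add_re, Complex.add_im, Complex.one_re, Complex.one_im]
  linarith

theorem exists_inv_add_one_eq {w : ℂ} (hw : w.re = 1 / 2) :
    ∃ x : ℂ, ‖x‖ = 1 ∧ x ≠ -1 ∧ (x + 1)⁻¹ = w := by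
  have hw0 : w ≠ 0 := by
    rintro rfl
    norm_num at hw
  refine ⟨(1 - w) / w, ?_, ?_, ?_⟩
  · have : ‖1 - w‖ = ‖w‖ := by
      rw [← sq_eq_sq₀ (norm_nonneg _) (norm_nonneg _), ← Complex.normSq_eq_norm_sq,
        ← Complex.normSq_eq_norm_sq, Complex.normSq_apply, Complex.normSq_apply]
      simp only [Complex.sub_re, Complex.sub_im, Complex.one_re, Complex.one_im]
      rw [hw]
      ring
    rw [norm_div, this, div_self (norm_ne_zero_iff.2 hw0)]
  · intro h
    rw [div_eq_iff hw0] at h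
    have : (1 : ℂ) = 0 := by linear_combination h
    exact one_ne_zero this
  · rw [div_add_one hw0]
    simp

/-- The forbidden equation with parameter x says that z s'/(z s' - δ s) equals -1/x. At a zero of s
this quotient is 1, matching the excluded x = -1, but by the open mapping theorem it also takes
unimodular values near 1. A constant quotient would force s to vanish identically, against s(0) = 1.
-/
theorem ne_zero_of_forall_add_ne_zero {s : ℂ → ℂ} {δ : ℝ} (hδ : 0 < δ)
    (hs : DifferentiableOn ℂ s unitDisk) (h0 : s 0 = 1)
    (h : ∀ z ∈ unitDisk, ∀ x : ℂ, ‖x‖ = 1 → x ≠ -1 → z * deriv s z + -δ / (x + 1) * s z ≠ 0)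
    {z₀ : ℂ} (hz₀ : z₀ ∈ unitDisk) : s z₀ ≠ 0 := by
  intro hs0
  have han : AnalyticOnNhd ℂ s unitDisk := hs.analyticOnNhd isOpen_unitDisk
  have hd0 : z₀ * deriv s z₀ ≠ 0 := by
    have := h z₀ hz₀ 1 (by simp) (by norm_num)
    rwa [hs0, mul_zero, add_zero] at this
  have hA : AnalyticAt ℂ (fun z => z * deriv s z) z₀ := analyticAt_id.mul (han z₀ hz₀).deriv
  have hC : AnalyticAt ℂ (fun z => z * deriv s z - δ * s z) z₀ :=
    hA.sub (analyticAt_const.mul (han z₀ hz₀))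
  have hC0 : z₀ * deriv s z₀ - δ * s z₀ ≠ 0 := by rwa [hs0, mul_zero, sub_zero]
  have hB : AnalyticAt ℂ (fun z => z * deriv s z / (z * deriv s z - δ * s z)) z₀ :=
    hA.div hC hC0
  have hV : ∀ᶠ z in 𝓝 z₀, z ∈ unitDisk ∧ z * deriv s z - δ * s z ≠ 0 :=
    (isOpen_unitDisk.eventually_mem hz₀).and (hC.continuousAt.eventually_ne hC0)
  have hδ0 : (δ : ℂ) ≠ 0 := Complex.ofReal_ne_zero.2 hδ.ne'
  have hB1 : z₀ * deriv s z₀ / (z₀ * deriv s z₀ - δ * s z₀) = 1 := by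
    rw [hs0, mul_zero, sub_zero, div_self hd0]
  rcases hB.eventually_constant_or_nhds_le_map_nhds with hc | hc
  · have hz : s =ᶠ[𝓝 z₀] fun _ => 0 := by
      filter_upwards [hc, hV] with z hz hzV
      rw [hB1, div_eq_one_iff_eq hzV.2] at hz
      have : (δ : ℂ) * s z = 0 := by linear_combination hz
      exact (mul_eq_zero.1 this).resolve_left hδ0
    have := han.eqOn_of_preconnected_of_eventuallyEq (g := fun _ => 0)
      (fun _ _ => analyticAt_const) (convex_ball 0 1).isPreconnected hz₀ hz zero_mem_unitDisk
    rw [h0] at this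
    exact one_ne_zero this
  · rw [hB1] at hc
    have himg := hc (image_mem_map hV)
    have hexp : Tendsto (fun t : ℝ => Complex.exp (t * Complex.I)) (𝓝[>] 0) (𝓝 1) := by
      apply tendsto_nhdsWithin_of_tendsto_nhds
      have : ContinuousAt (fun t : ℝ => Complex.exp (t * Complex.I)) 0 := by fun_prop
      simpa [ContinuousAt] using this
    obtain ⟨t, ⟨z, ⟨hz, hzne⟩, hzt⟩, ht0, ht1⟩ :=
      ((hexp.eventually_mem himg).and
        (eventually_mem_set.2 (Ioo_mem_nhdsGT (zero_lt_one' ℝ)))).exists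
    set y := Complex.exp (t * Complex.I) with hy
    have hy0 : y ≠ 0 := Complex.exp_ne_zero _
    have hy1 : y ≠ 1 := by
      intro h1
      have : y.im = Real.sin t := Complex.exp_ofReal_mul_I_im t
      rw [h1, Complex.one_im] at this
      linarith [Real.sin_pos_of_pos_of_lt_pi ht0 (by linarith [Real.pi_gt_three])]
    have hyn : ‖y‖ = 1 := Complex.norm_exp_ofReal_mul_I t
    apply h z hz (-y⁻¹) (by rw [norm_neg, norm_inv, hyn, inv_one])
      (by rwa [Ne, neg_inj, inv_eq_one])
    have hzt : z * deriv s z / (z * deriv s z - δ * s z) = y := hzt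
    rw [div_eq_iff hzne] at hzt
    have hy2 : y - 1 ≠ 0 := sub_ne_zero.2 hy1
    have e : -(δ : ℂ) / (-y⁻¹ + 1) = -δ * y / (y - 1) := by
      have : -y⁻¹ + 1 = (y - 1) / y := by field_simp; ring
      rw [this, div_div_eq_mul_div]
    rw [e]
    field_simp
    linear_combination -hzt

/-- The map x ↦ 1/(x+1) takes the punctured circle onto the line Re = 1/2, so the left side says
that z s'/s misses Re = δ/2. Its value at 0 is 0, and the intermediate value theorem fixes the side.
-/
theorem forall_add_ne_zero_iff {s : ℂ → ℂ} {δ : ℝ} (hδ : 0 < δ)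
    (hs : DifferentiableOn ℂ s unitDisk) (h0 : s 0 = 1) :
    (∀ z ∈ unitDisk, ∀ x : ℂ, ‖x‖ = 1 → x ≠ -1 → z * deriv s z + -δ / (x + 1) * s z ≠ 0) ↔
      ∀ z ∈ unitDisk, s z ≠ 0 ∧ (z * (deriv s z / s z)).re < δ / 2 := by
  have hδ0 : (δ : ℂ) ≠ 0 := Complex.ofReal_ne_zero.2 hδ.ne'
  constructor
  · intro h
    have hne : ∀ z ∈ unitDisk, s z ≠ 0 := fun z hz => ne_zero_of_forall_add_ne_zero hδ hs h0 h hz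
    refine fun z hz => ⟨hne z hz, ?_⟩
    by_contra hcon
    push Not at hcon
    have hcont : ContinuousOn (fun z => (z * (deriv s z / s z)).re) unitDisk :=
      Complex.continuous_re.comp_continuousOn
        (continuousOn_id.mul ((hs.deriv isOpen_unitDisk).continuousOn.div hs.continuousOn hne))
    obtain ⟨w, hw, hwe⟩ := (convex_ball (0 : ℂ) 1).isPreconnected.intermediate_value
      zero_mem_unitDisk hz hcont (show δ / 2 ∈ Set.Icc _ _ from ⟨by simp; linarith, hcon⟩)
    obtain ⟨x, hx, hx1, hxw⟩ := exists_inv_add_one_eq (w := w * (deriv s w / s w) / δ) (by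
      rw [Complex.div_ofReal_re, show (w * (deriv s w / s w)).re = δ / 2 from hwe]
      field_simp)
    apply h w hw x hx hx1
    rw [div_eq_mul_inv, hxw]
    have := hne w hw
    field_simp
    ring
  · intro h z hz x hx hx1 he
    obtain ⟨h1, h2⟩ := h z hz
    have e : z * (deriv s z / s z) = δ * (x + 1)⁻¹ := by
      field_simp
      rw [div_eq_mul_inv] at he
      linear_combination he
    rw [e, Complex.re_ofReal_mul, re_inv_add_one hx hx1] at h2
    linarith

/-! ### Kaplan class and conclusion -/

/-- The integrand is nonpositive, which is the upper bound. Over a full circle it integrates to -δπ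
by the mean value property, since z s'/s vanishes at 0; the complementary arc contributes a
nonpositive amount, which is the lower bound. -/
theorem mem_kaplanClass_zero {s : ℂ → ℂ} {δ : ℝ}
    (hs : DifferentiableOn ℂ s unitDisk) (h0 : s 0 = 1)
    (h : ∀ z ∈ unitDisk, s z ≠ 0 ∧ (z * (deriv s z / s z)).re < δ / 2) : s ∈ kaplanClass δ 0 := by
  refine ⟨hs, fun z hz => (h z hz).1, h0, fun r θ₁ θ₂ hr0 hr1 h12 h21 => ?_⟩
  have hπ := Real.pi_pos
  set k : ℂ → ℂ := fun z => z * deriv s z / s z with hk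
  have hkd : DifferentiableOn ℂ k unitDisk :=
    (differentiableOn_id.mul (hs.deriv isOpen_unitDisk)).div hs fun z hz => (h z hz).1
  have hmem : ∀ θ : ℝ, (r : ℂ) * Complex.exp (θ * Complex.I) ∈ unitDisk := by
    intro θ
    rw [mem_unitDisk, norm_mul, Complex.norm_exp_ofReal_mul_I, Complex.norm_real,
      Real.norm_of_nonneg hr0.le, mul_one]
    exact hr1
  have hkc : Continuous fun θ : ℝ => k (r * Complex.exp (θ * Complex.I)) :=
    hkd.continuousOn.comp_continuous (by fun_prop) hmem
  set g : ℝ → ℝ := fun θ => (k (r * Complex.exp (θ * Complex.I))).re - δ / 2 with hg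
  have hkre : Continuous fun θ : ℝ => (k (r * Complex.exp (θ * Complex.I))).re :=
    Complex.continuous_re.comp hkc
  have hgc : Continuous g := hkre.sub continuous_const
  have hg0 : ∀ θ, g θ ≤ 0 := by
    intro θ
    have := (h _ (hmem θ)).2
    rw [← mul_div_assoc] at this
    simp only [hg, hk]
    linarith
  have hper : Function.Periodic g (2 * Real.pi) := by
    intro θ
    simp only [hg]
    push_cast
    rw [add_mul, Complex.exp_add, Complex.exp_two_pi_mul_I, mul_one]
  have htotal : ∫ θ in θ₁..θ₁ + 2 * Real.pi, g θ = -(δ * Real.pi) := by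
    rw [hper.intervalIntegral_add_eq θ₁ 0, zero_add]
    have hmean : Real.circleAverage k 0 r = k 0 := by
      apply DiffContOnCl.circleAverage
      apply DifferentiableOn.diffContOnCl
      apply hkd.mono
      refine Metric.closure_ball_subset_closedBall.trans ?_
      exact Metric.closedBall_subset_ball (by rwa [abs_of_pos hr0])
    have hk0 : k 0 = 0 := by simp [hk]
    rw [hk0, Real.circleAverage_def, smul_eq_zero_iff_right (by positivity)] at hmean
    simp only [circleMap, zero_add] at hmean
    have hre := Complex.reCLM.intervalIntegral_comp_comm (μ := volume)
      (hkc.intervalIntegrable 0 (2 * Real.pi))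
    rw [hmean] at hre
    simp only [Complex.reCLM_apply, Complex.zero_re] at hre
    simp only [hg]
    rw [intervalIntegral.integral_sub
      (hkre.intervalIntegrable 0 (2 * Real.pi))
      intervalIntegrable_const, hre, intervalIntegral.integral_const]
    simp
    ring
  have hgoal : (∫ θ in θ₁..θ₂, (((r * Complex.exp (θ * Complex.I)) *
      deriv s (r * Complex.exp (θ * Complex.I)) / s (r * Complex.exp (θ * Complex.I))).re -
        (δ - 0) / 2)) = ∫ θ in θ₁..θ₂, g θ := by
    simp only [hg, hk, sub_zero]
  rw [hgoal, zero_mul]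
  have hsplit := intervalIntegral.integral_add_adjacent_intervals
    (hgc.intervalIntegrable (μ := volume) θ₁ θ₂)
    (hgc.intervalIntegrable (μ := volume) θ₂ (θ₁ + 2 * Real.pi))
  have hnonpos : ∀ a b : ℝ, a ≤ b → ∫ θ in a..b, g θ ≤ 0 := by
    intro a b hab
    rw [← neg_nonneg, ← intervalIntegral.integral_neg]
    exact intervalIntegral.integral_nonneg hab fun θ _ => neg_nonneg.2 (hg0 θ)
  constructor
  · linarith [hnonpos θ₂ (θ₁ + 2 * Real.pi) h21.le]
  · exact hnonpos θ₁ θ₂ h12.le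

theorem hadamard_congr {s t : ℂ → ℂ} (h : ∀ z ∈ unitDisk, s z = t z) (g : ℂ → ℂ) (z : ℂ) :
    hadamard s g z = hadamard t g z := by
  have e : s =ᶠ[𝓝 0] t := by
    filter_upwards [isOpen_unitDisk.mem_nhds zero_mem_unitDisk] with w hw
    exact h w hw
  simp only [hadamard, taylorCoeff, fun n => e.iteratedDeriv_eq n]

theorem mem_Co_iff_hadamard {α : ℝ} (hα₁ : 1 < α) (hα₂ : α ≤ 2) {f : ℂ → ℂ} (hf : f ∈ classA) :
    f ∈ Co α ↔ ∀ z ∈ unitDisk, ∀ x : ℂ, ‖x‖ = 1 → x ≠ -1 →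
      hadamard (attached α f) (kernel α x) z ≠ 0 := by
  have hs := differentiableOn_attached hf.1 α
  rw [mem_Co_iff hα₁ hα₂ hf,
    ← forall_add_ne_zero_iff (by linarith) hs (attached_zero hf α)]
  refine forall₂_congr fun z hz => forall₃_congr fun x _ _ => ?_
  rw [hadamard_kernel hs α x hz]
  push_cast
  rw [neg_sub]

end Concave

end

theorem mainTheorem11 (α : ℝ) (hα₁ : 1 < α) (hα₂ : α ≤ 2)
    (f : ℂ → ℂ) (hf : f ∈ Concave.classA) :
    (f ∈ Concave.Co α ↔
      ∀ z ∈ Concave.unitDisk, ∀ x : ℂ, ‖x‖ = 1 → x ≠ -1 →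
        Concave.hadamard (Concave.attached α f) (Concave.kernel α x) z ≠ 0) ∧
    (f ∈ Concave.Co α ↔
      ∃ s ∈ Concave.PiClass (α - 1),
        (∀ z ∈ Concave.unitDisk, s z = Concave.attached α f z) ∧
        ∀ z ∈ Concave.unitDisk, ∀ x : ℂ, ‖x‖ = 1 → x ≠ -1 →
          Concave.hadamard s (Concave.kernel α x) z ≠ 0) := by
  have key := Concave.mem_Co_iff_hadamard hα₁ hα₂ hf
  refine ⟨key, fun h => ⟨Concave.attached α f, ?_, fun _ _ => rfl, key.1 h⟩, ?_⟩
  · rw [Concave.PiClass, if_pos (by linarith)]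
    exact Concave.mem_kaplanClass_zero (Concave.differentiableOn_attached hf.1 α)
      (Concave.attached_zero hf α) ((Concave.mem_Co_iff hα₁ hα₂ hf).1 h)
  · rintro ⟨s, -, hs, h⟩
    refine key.2 fun z hz x hx hx1 => ?_
    rw [← Concave.hadamard_congr hs]
    exact h z hz x hx hx1
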